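/- Let $N\cong\mathbb Z^n$ and $M$ be dual lattices with pairing $\langle\cdot,\cdot\rangle$, extended to $M_{\mathbb R}\times N_{\mathbb C}$, let $\mathbb T=N\otimes\mathbb C^*$, and let $P\subset M_{\mathbb R}$ be a full-dimensional simple lattice polytope with inner normal fan $\Sigma$, toric variety $X=X_P$, and $k$-dimensional cones $\Sigma(k)$. For $\rho\in\Sigma(1)$ let $u_\rho\in N$ be the ray generator, $D_\rho$ the corresponding $\mathbb T$-invariant divisor and $F_\rho=[D_\rho]_{\mathbb T}\in H^2_{\mathbb T}(X;\mathbb Q)$ its equivariant fundamental class. Write $P=\{m:\langle m,u_\rho\rangle+c_\rho\ge 0\ \forall\rho\}$ with $c_\rho\in\mathbb Z$, $D_P=\sum_\rho c_\rho D_\rho$, and for $h=(h_\rho)\in\mathbb R^{\Sigma(1)}$ put $P(h)=\{m:\langle m,u_\rho\rangle+c_\rho+h_\rho\ge 0\ \forall\rho\}$. For a cone $\sigma$ with rays $\sigma(1)$ let ${\rm mult}(\sigma)=|G_\sigma|$, $G_\sigma=\{(t_\rho)\in(\mathbb C^*)^{\sigma(1)}:\prod_\rho u_\rho(t_\rho)=1\}$.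 For $\sigma\in\Sigma(n)$ let $i_\sigma:\{x_\sigma\}\hookrightarrow X$ be the corresponding $\mathbb T$-fixed point and $Eu^{\mathbb T}_X(x_\sigma)={\rm mult}(\sigma)\prod_{\rho\in\sigma(1)}i_\sigma^*F_\rho$. Classes in $H^*_{\mathbb T}(pt;\mathbb Q)$ are evaluated at $z\in N_{\mathbb C}$ by the ring homomorphism with $\langle -c^{\mathbb T}_1(\mathbb C_{\chi^m}),z\rangle=\langle m,z\rangle$ for $m\in M$; here $\mathbb T$ acts on functions by $(t\cdot f)(p)=f(t^{-1}p)$. For a nonempty face $E$ of $P$ (possibly $E=P$) let $\sigma_E\in\Sigma$ be its inner normal cone, and let $E(h)=\{m\in P(h):\langle m,u_\rho\rangle+c_\rho+h_\rho=0\ \forall\rho\in\sigma_E(1)\}$. The measure $dm$ on $E(h)$ is Lebesgue measure normalized so that the unit cube of the lattice ${\rm Span}(E_0)\cap M$ has volume $1$, where $E_0=E-m_0$ for a vertex $m_0\in E$. There is a neighbourhood $U$ of $0$ in $\mathbb R^{\Sigma(1)}$, depending only on $P$, such that for all $h\in U$ and all faces $E$: (a) for every $z\in N_{\mathbb C}$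 with $\langle i_\sigma^*F_\rho,z\rangle\neq 0$ for all $\sigma\in\Sigma(n)$ and $\rho\in\sigma(1)$, $$\int_{E(h)}e^{\langle m,z\rangle}\,dm={\rm mult}(\sigma_E)\sum_{\sigma\in\Sigma(n)}\frac{e^{\langle i_\sigma^*c_1^{\mathbb T}(\mathcal O_X(D_P)),z\rangle}}{\langle Eu^{\mathbb T}_X(x_\sigma),z\rangle}\; e^{\sum_\rho h_\rho\langle i_\sigma^*F_\rho,z\rangle}\prod_{\rho\in\sigma_E(1)}\langle i_\sigma^*F_\rho,z\rangle ;$$ (b) for every polynomial function $f$ on $M_{\mathbb R}$ with complex coefficients and every $z\in N_{\mathbb C}$, the function $h'\mapsto\int_{P(h')}f(m)e^{\langle m,z\rangle}\,dm$ is real analytic at $h$, the function $f(m)e^{\langle m,z\rangle}$ is integrable on $E(h)$, and $$\int_{E(h)}f(m)e^{\langle m,z\rangle}\,dm={\rm mult}(\sigma_E)\prod_{\rho\in\sigma_E(1)}\frac{\partial}{\partial h_\rho}\int_{P(h)}f(m)e^{\langle m,z\rangle}\,dm ,$$ the partial derivatives being taken in any order. -/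

import Mathlib

open MeasureTheory Topology Filter

/-!
Conventions.  The dual lattices are `M = ℤⁿ` and `N = ℤⁿ` (both `Fin n → ℤ`), paired by the dot
product; `M_ℝ = N_ℝ = Fin n → ℝ` and `N_ℂ = Fin n → ℂ`.  The torus is `𝕋 = N ⊗ ℂˣ = (ℂˣ)ⁿ`.
-/

/-- The inclusion of the lattice `ℤⁿ` in `ℝⁿ`. -/
def latticeIncl (n : ℕ) : (Fin n → ℤ) →ₗ[ℤ] (Fin n → ℝ) where
  toFun m i := (m i : ℝ)
  map_add' x y := by ext i; simp
  map_smul' c x := by ext i; simp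

/-- The pairing `⟨m, z⟩` of `m ∈ M_ℝ` with `z ∈ N_ℂ`. -/
noncomputable def cpair {n : ℕ} (m : Fin n → ℝ) (z : Fin n → ℂ) : ℂ := ∑ i, (m i : ℂ) * z i

/-- The character `χ^m` of the torus `𝕋 = (ℂˣ)ⁿ`. -/
def torusChar {n : ℕ} (m : Fin n → ℤ) (t : Fin n → ℂˣ) : ℂˣ := ∏ i, t i ^ m i

/-- The character `χ^m`, as an element of the group algebra `ℂ[M]`, i.e. as a regular function
on the torus. -/
noncomputable def chi {n : ℕ} (m : Fin n → ℤ) : AddMonoidAlgebra ℂ (Fin n → ℤ) :=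
  AddMonoidAlgebra.single m 1

/-- The action of the torus on regular functions on the torus, `(t • f)(p) = f (t⁻¹ p)`; on
characters it is `t • χ^m = χ^m(t⁻¹) χ^m`. -/
noncomputable def torusAct {n : ℕ} (t : Fin n → ℂˣ) :
    AddMonoidAlgebra ℂ (Fin n → ℤ) →ₐ[ℂ] AddMonoidAlgebra ℂ (Fin n → ℤ) :=
  AddMonoidAlgebra.lift ℂ (AddMonoidAlgebra ℂ (Fin n → ℤ)) (Fin n → ℤ)
    { toFun := fun m => ((torusChar m.toAdd t⁻¹ : ℂˣ) : ℂ) • chi m.toAdd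
      map_one' := by simp [torusChar, chi, AddMonoidAlgebra.one_def]
      map_mul' := fun x y => by
        simp [torusChar, chi, AddMonoidAlgebra.single_mul_single, zpow_add,
          Finset.prod_mul_distrib, mul_comm] }

/-- The rational equivariant cohomology of a point, `ℚ[t₁, …, tₙ]`, with `tᵢ = s(mᵢ)` for the
standard basis `mᵢ` of `M`, where `s = -c` and `c(m) = c₁(ℂ_{χ^m})`. -/
abbrev PtCohomology (n : ℕ) : Type := MvPolynomial (Fin n) ℚ

/-- The first equivariant Chern class `c(m)` of the one-dimensional representation `ℂ_{χ^m}`. -/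
noncomputable def ptChern {n : ℕ} (m : Fin n → ℤ) : PtCohomology n :=
  -∑ i, (m i : PtCohomology n) * MvPolynomial.X i

/-- The evaluation `⟨-, z⟩` of classes of the point at `z ∈ N_ℂ`: the ring homomorphism
with `⟨s(m), z⟩ = ⟨m, z⟩`. -/
noncomputable def ptEval {n : ℕ} (z : Fin n → ℂ) : PtCohomology n →ₐ[ℚ] ℂ := MvPolynomial.aeval z

/-- Lebesgue measure on the real span of a sublattice `L` of `M`, normalized so that the unit cube
(a fundamental parallelepiped) of `L` has volume one, viewed as a measure on `M_ℝ`. -/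
noncomputable def latticeMeasure {n : ℕ} (L : Submodule ℤ (Fin n → ℤ)) :
    Measure (Fin n → ℝ) :=
  Measure.map
    (fun t : Module.Free.ChooseBasisIndex ℤ L → ℝ =>
      ∑ i, t i • latticeIncl n (Module.Free.chooseBasis ℤ L i : Fin n → ℤ))
    volume

/-- A full-dimensional lattice polytope in `M_ℝ`, the convex hull of finitely many lattice
points. -/
structure LatticePolytope (n : ℕ) where
  /-- lattice points spanning the polytope -/
  points : Finset (Fin n → ℤ)
  fullDim : (interior (convexHull ℝ (latticeIncl n '' (points : Set (Fin n → ℤ))))).Nonempty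

namespace LatticePolytope

variable {n : ℕ} (P : LatticePolytope n)

/-- The underlying point set of the polytope. -/
def body : Set (Fin n → ℝ) := convexHull ℝ (latticeIncl n '' (P.points : Set (Fin n → ℤ)))

/-- The (nonempty) faces of the polytope, the polytope included. -/
def IsFace (E : Set (Fin n → ℝ)) : Prop := E.Nonempty ∧ IsExposed ℝ P.body E

/-- The facets: faces of codimension one. -/
def IsFacet (F : Set (Fin n → ℝ)) : Prop :=
  P.IsFace F ∧ Module.finrank ℝ (vectorSpan ℝ F) + 1 = n

/-- The polytope is simple: each vertex lies on exactly `n` facets. -/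
def IsSimple : Prop :=
  ∀ v ∈ P.body.extremePoints ℝ, {F | P.IsFacet F ∧ v ∈ F}.ncard = n

/-- The inner normal cone `σ_E ⊆ N_ℝ` of a face `E`: the `u` such that `⟨·, u⟩` attains its minimum
over the polytope at all points of `E`. -/
def normalCone (E : Set (Fin n → ℝ)) : Set (Fin n → ℝ) :=
  {u | ∀ x ∈ E, ∀ y ∈ P.body, x ⬝ᵥ u ≤ y ⬝ᵥ u}

/-- The inner normal fan `Σ_P`. -/
def fan : Set (Set (Fin n → ℝ)) := {σ | ∃ E, P.IsFace E ∧ σ = P.normalCone E}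

/-- `Σ(k)`: the `k`-dimensional cones of the inner normal fan. -/
def Cone (k : ℕ) : Type :=
  {σ : Set (Fin n → ℝ) // σ ∈ P.fan ∧ Module.finrank ℝ (Submodule.span ℝ σ) = k}

/-- `Σ(1)`: the rays of the inner normal fan. -/
abbrev Ray : Type := P.Cone 1

lemma isCompact_body : IsCompact P.body :=
  (P.points.finite_toSet.image _).isCompact_convexHull (𝕜 := ℝ)

lemma finite_faces : {E | P.IsFace E}.Finite := by
  have hfin : (Set.powerset (latticeIncl n '' (P.points : Set (Fin n → ℤ)))).Finite :=
    (P.points.finite_toSet.image _).powerset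
  refine Set.Finite.of_finite_image (f := fun E : Set (Fin n → ℝ) => E.extremePoints ℝ) (hfin.subset ?_) ?_
  · rintro _ ⟨E, hE, rfl⟩
    exact ((IsExposed.isExtreme (𝕜 := ℝ) hE.2).extremePoints_subset_extremePoints).trans
      extremePoints_convexHull_subset
  · intro E hE F hF h
    have h1 := closure_convexHull_extremePoints (hE.2.isCompact P.isCompact_body)
      (hE.2.convex (convex_convexHull ℝ _))
    have h2 := closure_convexHull_extremePoints (hF.2.isCompact P.isCompact_body)
      (hF.2.convex (convex_convexHull ℝ _))
    simp only at h
    rw [← h1, ← h2, h]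

lemma finite_fan : P.fan.Finite := by
  refine (P.finite_faces.image P.normalCone).subset ?_
  rintro σ ⟨E, hE, rfl⟩
  exact ⟨E, hE, rfl⟩

instance finite_cone (k : ℕ) : Finite (P.Cone k) :=
  (P.finite_fan.subset (fun _ h => h.1) :
    {σ | σ ∈ P.fan ∧ Module.finrank ℝ (Submodule.span ℝ σ) = k}.Finite).to_subtype

noncomputable instance fintypeCone (k : ℕ) : Fintype (P.Cone k) := Fintype.ofFinite _

noncomputable instance decEqCone (k : ℕ) : DecidableEq (P.Cone k) := Classical.decEq _

open Classical in
/-- `σ(1)`: the rays of a cone `σ` of the fan. -/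
noncomputable def rays (σ : Set (Fin n → ℝ)) : Finset P.Ray :=
  Finset.univ.filter fun ρ => ρ.1 ⊆ σ

/-- The ray generator `u_ρ ∈ N`: the generator of the semigroup `ρ ∩ N`. -/
noncomputable def gen (ρ : P.Ray) : Fin n → ℤ :=
  Classical.epsilon fun u => ∀ v : Fin n → ℤ, latticeIncl n v ∈ ρ.1 ↔ ∃ k : ℕ, v = k • u

/-- The constant `c_ρ ∈ ℤ` of the facet inequality `⟨m, u_ρ⟩ + c_ρ ≥ 0` of the polytope: the least
integer for which the inequality holds on the polytope.  It is also the coefficient of `D_ρ` in the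
ample divisor `D_P = ∑ c_ρ D_ρ`. -/
noncomputable def const (ρ : P.Ray) : ℤ :=
  sInf {c : ℤ | ∀ m ∈ P.body, 0 ≤ m ⬝ᵥ latticeIncl n (P.gen ρ) + c}

/-- The dilated polytope `P(h)`. -/
def dilate (h : P.Ray → ℝ) : Set (Fin n → ℝ) :=
  {m | ∀ ρ, 0 ≤ m ⬝ᵥ latticeIncl n (P.gen ρ) + P.const ρ + h ρ}

/-- The face `E(h)` of `P(h)` corresponding to the face `E` of `P`. -/
def dilateFace (E : Set (Fin n → ℝ)) (h : P.Ray → ℝ) : Set (Fin n → ℝ) :=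
  {m ∈ P.dilate h | ∀ ρ ∈ P.rays (P.normalCone E),
    m ⬝ᵥ latticeIncl n (P.gen ρ) + P.const ρ + h ρ = 0}

/-- The lattice `Span(E₀) ∩ M`, with `E₀` a translate of `E` through the origin. -/
def faceLattice (E : Set (Fin n → ℝ)) : Submodule ℤ (Fin n → ℤ) :=
  ((vectorSpan ℝ E).restrictScalars ℤ).comap (latticeIncl n)

open Classical in
/-- The Lebesgue measure on the affine span of `E(h)`, a translate of `Span(E₀)`, normalized so that
the unit cube of the lattice `Span(E₀) ∩ M` has volume one.  (The choice of the point of `E(h)` used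
for the translation does not matter, by translation invariance.) -/
noncomputable def faceMeasure (E : Set (Fin n → ℝ)) (h : P.Ray → ℝ) : Measure (Fin n → ℝ) :=
  if hne : (P.dilateFace E h).Nonempty then
    Measure.map (fun w => hne.some + w) (latticeMeasure (faceLattice E))
  else 0

/-- The homomorphism `(ℂˣ)^{σ(1)} → 𝕋`, `(t_ρ) ↦ ∏ u_ρ(t_ρ)`, with `u_ρ` viewed as a one-parameter
subgroup of the torus. -/
noncomputable def coxHom (σ : Set (Fin n → ℝ)) : (P.rays σ → ℂˣ) →* (Fin n → ℂˣ) where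
  toFun t i := ∏ ρ, t ρ ^ P.gen ρ.1 i
  map_one' := by ext i; simp
  map_mul' x y := by ext i; simp [mul_zpow, Finset.prod_mul_distrib]

/-- The multiplicity `mult(σ) = |G_σ|`, where `G_σ = {(t_ρ)_{ρ ∈ σ(1)} | ∏ u_ρ(t_ρ) = 1}`. -/
noncomputable def mult (σ : Set (Fin n → ℝ)) : ℕ := Nat.card (P.coxHom σ).ker

/-- The coordinate ring `ℂ[σ^∨ ∩ M] ⊆ ℂ[M]` of the affine toric variety `U_σ`. -/
noncomputable def coordRing (σ : Set (Fin n → ℝ)) :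
    Submodule ℂ (AddMonoidAlgebra ℂ (Fin n → ℤ)) :=
  Submodule.span ℂ (chi '' {m | ∀ u ∈ σ, 0 ≤ latticeIncl n m ⬝ᵥ u})

/-- The maximal ideal of the torus fixed point `x_σ` in the coordinate ring of `U_σ`, for a
full-dimensional cone `σ`: all nontrivial characters in `σ^∨ ∩ M` vanish at `x_σ`. -/
noncomputable def fixedPointIdeal (σ : Set (Fin n → ℝ)) :
    Submodule ℂ (AddMonoidAlgebra ℂ (Fin n → ℤ)) :=
  Submodule.span ℂ (chi '' {m | m ≠ 0 ∧ ∀ u ∈ σ, 0 ≤ latticeIncl n m ⬝ᵥ u})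

/-- The module of sections over `U_σ` of the sheaf `𝒪_X(D)`, for the torus invariant Weil divisor
`D = ∑ a_ρ D_ρ`, as a torus invariant submodule of `ℂ[M]`. -/
noncomputable def divSections (σ : Set (Fin n → ℝ)) (a : P.Ray → ℤ) :
    Submodule ℂ (AddMonoidAlgebra ℂ (Fin n → ℤ)) :=
  Submodule.span ℂ (chi '' {m | ∀ ρ ∈ P.rays σ, 0 ≤ m ⬝ᵥ P.gen ρ + a ρ})

/-- `D = ∑ a_ρ D_ρ` is Cartier on `U_σ`: the sheaf `𝒪_X(D)` is free of rank one there. -/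
def IsCartierOn (σ : Set (Fin n → ℝ)) (a : P.Ray → ℤ) : Prop :=
  ∃ s, P.divSections σ a = coordRing σ * Submodule.span ℂ {s}

/-- The torus acts through the character `χ^w` on the fibre at the fixed point `x_σ` of the
equivariant sheaf `𝒪_X(D)`, that is, on the sections over `U_σ` modulo the maximal ideal of `x_σ`
times the sections. -/
def HasFibreWeight (σ : Set (Fin n → ℝ)) (a : P.Ray → ℤ) (w : Fin n → ℤ) : Prop :=
  ∀ t : Fin n → ℂˣ, ∀ s ∈ P.divSections σ a,
    torusAct t s - ((torusChar w t : ℂˣ) : ℂ) • s ∈ fixedPointIdeal σ * P.divSections σ a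

/-- The restriction `i_σ^* [D]_𝕋 ∈ H²_𝕋(x_σ; ℚ)` to the fixed point `x_σ` of the equivariant class
of the torus invariant `ℚ`-Cartier divisor `D = ∑ a_ρ D_ρ`.  If `D` is Cartier, then
`[D]_𝕋 = c₁(𝒪_X(D))` restricts to the first equivariant Chern class of the fibre of the line bundle
`𝒪_X(D)` at `x_σ`; in general `[D]_𝕋 = [k D]_𝕋 / k`, where `k D` is Cartier. -/
noncomputable def restrictClass (σ : Set (Fin n → ℝ)) (a : P.Ray → ℤ) : PtCohomology n :=
  Classical.epsilon fun α => ∃ k : ℕ, 0 < k ∧ ∃ w : Fin n → ℤ,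
    P.IsCartierOn σ (k • a) ∧ P.HasFibreWeight σ (k • a) w ∧ (k : PtCohomology n) * α = ptChern w

/-- `i_σ^* F_ρ`, the restriction to `x_σ` of the equivariant fundamental class of `D_ρ`. -/
noncomputable def restrictF (σ : Set (Fin n → ℝ)) (ρ : P.Ray) : PtCohomology n :=
  P.restrictClass σ (Pi.single ρ 1)

/-- The generalized Euler class of the fixed point `x_σ`,
`Eu(x_σ) = i_σ^* (mult(σ) ∏_{ρ ∈ σ(1)} [D_ρ]_𝕋)`. -/
noncomputable def eulerClass (σ : Set (Fin n → ℝ)) : PtCohomology n :=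
  (P.mult σ : PtCohomology n) * ∏ ρ ∈ P.rays σ, P.restrictF σ ρ

/-- The function `h ↦ ∫_{P(h)} f(m) e^{⟨m, z⟩} dm`. -/
noncomputable def expIntegral (f : MvPolynomial (Fin n) ℂ) (z : Fin n → ℂ) (h : P.Ray → ℝ) : ℂ :=
  ∫ m in P.dilate h, MvPolynomial.eval (fun i => (m i : ℂ)) f * Complex.exp (cpair m z)

/-- The iterated partial derivative `∂/∂h_{ρ₁} ⋯ ∂/∂h_{ρ_k}` for a list `[ρ₁, …, ρ_k]` of rays. -/
noncomputable def iterPartial (l : List P.Ray) (G : (P.Ray → ℝ) → ℂ) : (P.Ray → ℝ) → ℂ :=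
  l.foldr (fun ρ G h => lineDeriv ℝ G h (Pi.single ρ (1 : ℝ))) G

end LatticePolytope

/-!
The exponential integral over `P(h)` is computed by mixed differences.  Moving the facets of a set
`A` of rays outwards by `ε` sweeps out a slab, the *mixed region* of `A`, and the vertex formula is
proved for all mixed regions at once (`IsSimple.integral_mixedRegion`), by downward induction on
`A`.  If `A` is not contained in `σ(1)` for any maximal cone `σ`, then the region is empty for small
parameters and every vertex contribution has a vanishing factor.  If `A = σ(1)`, then the region is
a parallelepiped at the vertex of `σ`, and the integral is a product of integrals in one variable.
In between, the induction hypothesis says that the difference of the two sides does not depend on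
the parameters outside `A`; it is therefore the same after a translation along an edge on the
facets of `A`, which multiplies it by an exponential, and for a generic parameter `z` it must vanish.
The weights in these formulas are the restrictions of the classes `F_ρ`
(`IsSimple.ptEval_restrictF`).

The mixed region of the rays of the normal cone of a face `E` is fibred into slices parallel to
`E(h)`.  In coordinates given by a basis of the lattice of the face and by the slacks of the facets
containing it, Lebesgue measure is multiplied by the index of the image of `M` in `ℤ^{σ_E(1)}`
(`exists_lattice_coordinates`), which by Pontryagin duality is the multiplicity of `σ_E`
(`mult_eq_index`).  Comparing integrals over small boxes of slices gives the formula for the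
integral over `E(h)` for generic `z` (`IsSimple.sliceIntegral_eq`), with a factor
`∏ ⟨i_σ^* F_ρ, z⟩` that comes from differentiating the exponentials.

For a polynomial `f` and an arbitrary `z`, Cauchy's formula writes `f(m) e^{⟨m, z⟩}` as a
superposition of the exponentials `e^{⟨m, z + ζ⟩}`, with `ζ` in a product of circles whose radii are
chosen such that every `z + ζ` is generic (`exists_eval_eq_setIntegral_exp`,
`IsSimple.exists_isGeneric_torusPoint`).  The integral over `P(h)` thereby becomes a sum of
exponentials of linear forms in `h`, with coefficients in the Banach algebra of continuous functions
on the box of angles, followed by integration; it is analytic, and its partial derivatives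
(`IsSimple.iterPartial_expIntegral`) are superpositions of the formulas for the faces.
-/

/-! ### Faces of a lattice polytope and their normal cones -/

namespace LatticePolytope

variable {n : ℕ} (P : LatticePolytope n)

lemma convex_body : Convex ℝ P.body := convex_convexHull ℝ _

lemma lattice_mem_body {y : Fin n → ℤ} (hy : y ∈ P.points) : latticeIncl n y ∈ P.body :=
  subset_convexHull ℝ _ ⟨y, hy, rfl⟩

lemma points_nonempty : P.points.Nonempty := by
  rw [Finset.nonempty_iff_ne_empty]
  intro h
  obtain ⟨x, hx⟩ := P.fullDim
  simp [h] at hx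

/-- A lower bound for a linear functional on the spanning points holds on the whole polytope. -/
lemma le_dotProduct_of_points {u : Fin n → ℝ} {c : ℝ}
    (h : ∀ y ∈ P.points, c ≤ latticeIncl n y ⬝ᵥ u) {x : Fin n → ℝ} (hx : x ∈ P.body) :
    c ≤ x ⬝ᵥ u := by
  have hconv : Convex ℝ {x : Fin n → ℝ | c ≤ x ⬝ᵥ u} := by
    intro a ha b hb s t hs ht hst
    simp only [Set.mem_ofPred_eq, add_dotProduct, smul_dotProduct, smul_eq_mul] at *
    have : c = s * c + t * c := by rw [← add_mul, hst, one_mul]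
    rw [this]
    gcongr
  refine convexHull_min ?_ hconv hx
  rintro _ ⟨y, hy, rfl⟩
  exact h y hy

/-- The set of points of the polytope at which the functional `⟨·, u⟩` is minimal. -/
def minFace (u : Fin n → ℝ) : Set (Fin n → ℝ) := {x ∈ P.body | ∀ y ∈ P.body, x ⬝ᵥ u ≤ y ⬝ᵥ u}

lemma exists_point_mem_minFace (u : Fin n → ℝ) :
    ∃ y ∈ P.points, latticeIncl n y ∈ P.minFace u := by
  obtain ⟨y, hy, hmin⟩ := P.points.exists_min_image (fun y => latticeIncl n y ⬝ᵥ u)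
    P.points_nonempty
  exact ⟨y, hy, P.lattice_mem_body hy, fun x hx => P.le_dotProduct_of_points hmin hx⟩

lemma isFace_minFace (u : Fin n → ℝ) : P.IsFace (P.minFace u) := by
  obtain ⟨y, -, hy⟩ := P.exists_point_mem_minFace u
  refine ⟨⟨_, hy⟩, fun _ => ?_⟩
  refine ⟨-LinearMap.toContinuousLinearMap ((dotProductBilin ℝ ℝ).flip u), ?_⟩
  ext x
  simp [minFace]

lemma IsFace.exists_eq_minFace {P : LatticePolytope n} {E : Set (Fin n → ℝ)} (hE : P.IsFace E) :
    ∃ u, E = P.minFace u := by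
  obtain ⟨l, hl⟩ := hE.2 hE.1
  refine ⟨fun i => -l (Pi.single i 1), ?_⟩
  have key : ∀ x : Fin n → ℝ, x ⬝ᵥ (fun i => -l (Pi.single i 1)) = -l x := by
    intro x
    conv_rhs => rw [← Finset.univ_sum_single x, map_sum]
    rw [dotProduct, ← Finset.sum_neg_distrib]
    refine Finset.sum_congr rfl fun i _ => ?_
    have : (Pi.single i (x i) : Fin n → ℝ) = x i • Pi.single i (1 : ℝ) := by
      rw [← Pi.single_smul]; simp
    rw [this, map_smul]
    simp
  rw [hl]
  ext x
  simp [minFace, key]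

lemma IsFace.subset_body {P : LatticePolytope n} {E : Set (Fin n → ℝ)} (hE : P.IsFace E) :
    E ⊆ P.body := hE.2.subset

lemma mem_normalCone_minFace (u : Fin n → ℝ) : u ∈ P.normalCone (P.minFace u) :=
  fun _ hx y hy => hx.2 y hy

lemma minFace_const {u : Fin n → ℝ} {x y : Fin n → ℝ} (hx : x ∈ P.minFace u)
    (hy : y ∈ P.minFace u) : x ⬝ᵥ u = y ⬝ᵥ u :=
  le_antisymm (hx.2 y hy.1) (hy.2 x hx.1)

lemma normalCone_const {E : Set (Fin n → ℝ)} (hE : E ⊆ P.body) {u : Fin n → ℝ}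
    (hu : u ∈ P.normalCone E) {x y : Fin n → ℝ} (hx : x ∈ E) (hy : y ∈ E) : x ⬝ᵥ u = y ⬝ᵥ u :=
  le_antisymm (hu x hx y (hE hy)) (hu y hy x (hE hx))

lemma smul_mem_normalCone {E : Set (Fin n → ℝ)} {u : Fin n → ℝ} (hu : u ∈ P.normalCone E)
    {t : ℝ} (ht : 0 ≤ t) : t • u ∈ P.normalCone E := by
  intro x hx y hy
  simp only [dotProduct_smul, smul_eq_mul]
  exact mul_le_mul_of_nonneg_left (hu x hx y hy) ht

/-- A face of a polytope is the convex hull of the spanning points that it contains. -/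
lemma IsFace.subset_convexHull {P : LatticePolytope n} {E : Set (Fin n → ℝ)} (hE : P.IsFace E) :
    E ⊆ convexHull ℝ (latticeIncl n '' {y | y ∈ P.points ∧ latticeIncl n y ∈ E}) := by
  have h1 := closure_convexHull_extremePoints (hE.2.isCompact P.isCompact_body)
    (hE.2.convex P.convex_body)
  have hfin : (latticeIncl n '' {y | y ∈ P.points ∧ latticeIncl n y ∈ E}).Finite :=
    (P.points.finite_toSet.subset fun _ h => h.1).image _
  have h2 : E.extremePoints ℝ ⊆ latticeIncl n '' {y | y ∈ P.points ∧ latticeIncl n y ∈ E} := by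
    intro x hx
    have hxb : x ∈ P.body.extremePoints ℝ :=
      (IsExposed.isExtreme (𝕜 := ℝ) hE.2).extremePoints_subset_extremePoints hx
    obtain ⟨y, hy, rfl⟩ := extremePoints_convexHull_subset hxb
    exact ⟨y, ⟨hy, hx.1⟩, rfl⟩
  calc E = closure (convexHull ℝ (E.extremePoints ℝ)) := h1.symm
    _ ⊆ closure (convexHull ℝ (latticeIncl n '' {y | y ∈ P.points ∧ latticeIncl n y ∈ E})) :=
      closure_mono (convexHull_mono h2)
    _ = _ := (hfin.isClosed_convexHull (𝕜 := ℝ)).closure_eq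

/-- A functional which is constant on the spanning points in a face is constant on the face. -/
lemma IsFace.const_of_points {P : LatticePolytope n} {E : Set (Fin n → ℝ)} (hE : P.IsFace E)
    {w : Fin n → ℝ} {c : ℝ}
    (h : ∀ y ∈ P.points, latticeIncl n y ∈ E → latticeIncl n y ⬝ᵥ w = c) {x : Fin n → ℝ}
    (hx : x ∈ E) : x ⬝ᵥ w = c := by
  have hconv : Convex ℝ {x : Fin n → ℝ | x ⬝ᵥ w = c} := by
    intro a ha b hb s t hs ht hst
    simp only [Set.mem_ofPred_eq, add_dotProduct, smul_dotProduct, smul_eq_mul] at *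
    rw [ha, hb, ← add_mul, hst, one_mul]
  refine convexHull_min ?_ hconv (hE.subset_convexHull hx)
  rintro _ ⟨y, hy, rfl⟩
  exact h y hy.1 hy.2

/-- Perturbing the functional that exposes a face by a functional which attains its minimum over
the spanning points of the face at some point `y₀`. -/
lemma exists_perturb (u w : Fin n → ℝ) {y₀ : Fin n → ℤ}
    (hy₀E : latticeIncl n y₀ ∈ P.minFace u)
    (hw : ∀ y ∈ P.points, latticeIncl n y ∈ P.minFace u →
      latticeIncl n y₀ ⬝ᵥ w ≤ latticeIncl n y ⬝ᵥ w) :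
    ∃ ε : ℝ, 0 < ε ∧ latticeIncl n y₀ ∈ P.minFace (u + ε • w) ∧
      ∀ y ∈ P.points, latticeIncl n y ∈ P.minFace (u + ε • w) → latticeIncl n y ∈ P.minFace u := by
  have hev : ∀ y ∈ P.points, ∀ᶠ ε : ℝ in 𝓝[>] 0, latticeIncl n y ∉ P.minFace u →
      latticeIncl n y₀ ⬝ᵥ (u + ε • w) < latticeIncl n y ⬝ᵥ (u + ε • w) := by
    intro y hy
    by_cases hyE : latticeIncl n y ∈ P.minFace u
    · exact Eventually.of_forall fun _ h => absurd hyE h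
    have hlt : latticeIncl n y₀ ⬝ᵥ u < latticeIncl n y ⬝ᵥ u := by
      by_contra hle
      exact hyE ⟨P.lattice_mem_body hy, fun z hz => (not_lt.1 hle).trans (hy₀E.2 z hz)⟩
    have hc : ∀ a : Fin n → ℝ, Tendsto (fun ε : ℝ => a ⬝ᵥ (u + ε • w)) (𝓝[>] 0)
        (𝓝 (a ⬝ᵥ u)) := by
      intro a
      have : Continuous fun ε : ℝ => a ⬝ᵥ (u + ε • w) := by
        simp only [dotProduct_add, dotProduct_smul]; fun_prop
      have h := this.tendsto 0
      simp only [zero_smul, add_zero] at h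
      exact h.mono_left nhdsWithin_le_nhds
    filter_upwards [(hc _).eventually_lt (hc _) hlt] with ε hε _ using hε
  have hall := (P.points.eventually_all).2 hev
  obtain ⟨ε, hε, hpos⟩ := (hall.and self_mem_nhdsWithin).exists
  refine ⟨ε, hpos, ⟨hy₀E.1, fun x hx => P.le_dotProduct_of_points ?_ hx⟩, ?_⟩
  · intro y hy
    by_cases hyE : latticeIncl n y ∈ P.minFace u
    · simp only [dotProduct_add, dotProduct_smul, smul_eq_mul]
      exact add_le_add (hy₀E.2 _ hyE.1) (mul_le_mul_of_nonneg_left (hw y hy hyE) (le_of_lt hpos))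
    · exact (hε y hy hyE).le
  · intro y hy hyE'
    by_contra hyE
    exact absurd (hyE'.2 _ hy₀E.1) (not_le.2 (hε y hy hyE))

/-- The linear span of the inner normal cone of a face consists of the functionals which are
constant on the face. -/
lemma IsFace.mem_span_normalCone {P : LatticePolytope n} {E : Set (Fin n → ℝ)} (hE : P.IsFace E)
    {w : Fin n → ℝ} :
    w ∈ Submodule.span ℝ (P.normalCone E) ↔ ∀ x ∈ E, ∀ y ∈ E, x ⬝ᵥ w = y ⬝ᵥ w := by
  constructor
  · intro hw
    induction hw using Submodule.span_induction with
    | mem u hu => exact fun x hx y hy => P.normalCone_const hE.subset_body hu hx hy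
    | zero => simp
    | add a b _ _ ha hb =>
      intro x hx y hy
      rw [dotProduct_add, dotProduct_add, ha x hx y hy, hb x hx y hy]
    | smul c a _ ha =>
      intro x hx y hy
      rw [dotProduct_smul, dotProduct_smul, ha x hx y hy]
  · intro hw
    obtain ⟨u, rfl⟩ := hE.exists_eq_minFace
    obtain ⟨y₀, hy₀, hy₀E⟩ := P.exists_point_mem_minFace u
    obtain ⟨ε, hε, hmem, -⟩ := P.exists_perturb u w hy₀E
      (fun y _ hyE => (hw _ hy₀E _ hyE).le)
    have h1 : u + ε • w ∈ P.normalCone (P.minFace u) := by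
      intro x hx y hy
      refine le_trans (le_of_eq ?_) (hmem.2 y hy)
      simp only [dotProduct_add, dotProduct_smul]
      rw [P.minFace_const hx hy₀E, hw x hx _ hy₀E]
    have h2 : w = ε⁻¹ • ((u + ε • w) - u) := by
      rw [add_sub_cancel_left, smul_smul, inv_mul_cancel₀ hε.ne', one_smul]
    rw [h2]
    exact Submodule.smul_mem _ _ (Submodule.sub_mem _ (Submodule.subset_span h1)
      (Submodule.subset_span (P.mem_normalCone_minFace u)))

/-- Every face contains a vertex which is itself a face: the spanning point of the face farthest
from the origin. -/
lemma IsFace.exists_vertex {P : LatticePolytope n} {E : Set (Fin n → ℝ)} (hE : P.IsFace E) :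
    ∃ y ∈ P.points, latticeIncl n y ∈ E ∧ P.IsFace {latticeIncl n y} := by
  classical
  obtain ⟨u, rfl⟩ := hE.exists_eq_minFace
  obtain ⟨y₁, hy₁, hy₁E⟩ := P.exists_point_mem_minFace u
  obtain ⟨y₀, hy₀, hmax⟩ := (P.points.filter fun y => latticeIncl n y ∈ P.minFace u).exists_max_image
    (fun y => latticeIncl n y ⬝ᵥ latticeIncl n y) ⟨y₁, by simp [hy₁, hy₁E]⟩
  rw [Finset.mem_filter] at hy₀
  -- Among the spanning points of the face, `⟨·, y₀⟩` is maximal only at `y₀`.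
  have hstrict : ∀ y ∈ P.points, latticeIncl n y ∈ P.minFace u →
      latticeIncl n y ⬝ᵥ latticeIncl n y₀ < latticeIncl n y₀ ⬝ᵥ latticeIncl n y₀ ∨
        latticeIncl n y = latticeIncl n y₀ := by
    intro y hy hyE
    by_cases h : latticeIncl n y = latticeIncl n y₀
    · exact Or.inr h
    left
    have h1 := hmax y (by simp [hy, hyE])
    have h2 : 0 < (latticeIncl n y - latticeIncl n y₀) ⬝ᵥ (latticeIncl n y - latticeIncl n y₀) := by
      have h0 : 0 ≤ (latticeIncl n y - latticeIncl n y₀) ⬝ᵥ (latticeIncl n y - latticeIncl n y₀) :=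
        Finset.sum_nonneg fun i _ => mul_self_nonneg _
      refine lt_of_le_of_ne h0 fun h3 => h ?_
      exact sub_eq_zero.1 (dotProduct_self_eq_zero.1 h3.symm)
    simp only [sub_dotProduct, dotProduct_sub] at h2
    rw [dotProduct_comm (latticeIncl n y₀) (latticeIncl n y)] at h2
    linarith
  obtain ⟨ε, hε, hmem, hsub⟩ := P.exists_perturb u (-latticeIncl n y₀) hy₀.2 (by
    intro y hy hyE
    rw [dotProduct_neg, dotProduct_neg, neg_le_neg_iff]
    rcases hstrict y hy hyE with h | h
    · exact h.le
    · rw [h])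
  refine ⟨y₀, hy₀.1, hy₀.2, ?_⟩
  have heq : P.minFace (u + ε • (-latticeIncl n y₀)) = {latticeIncl n y₀} := by
    refine Set.Subset.antisymm ?_ (Set.singleton_subset_iff.2 hmem)
    refine ((P.isFace_minFace _).subset_convexHull).trans
      ((convexHull_mono ?_).trans (convexHull_singleton (𝕜 := ℝ) _).subset)
    rintro _ ⟨y, ⟨hy, hyE⟩, rfl⟩
    have hyu := hsub y hy hyE
    rcases hstrict y hy hyu with h | h
    · have h1 := P.minFace_const hyE hmem
      simp only [dotProduct_add, dotProduct_smul, smul_eq_mul, dotProduct_neg] at h1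
      rw [P.minFace_const hyu hy₀.2] at h1
      nlinarith
    · exact h
  rw [← heq]
  exact P.isFace_minFace _

/-- A functional which is constant on a full-dimensional polytope vanishes. -/
lemma eq_zero_of_const {u : Fin n → ℝ} {c : ℝ} (h : ∀ x ∈ P.body, x ⬝ᵥ u = c) : u = 0 := by
  obtain ⟨p, hp⟩ := P.fullDim
  have hp' : p ∈ interior P.body := hp
  have hcont : Tendsto (fun t : ℝ => p + t • u) (𝓝[>] 0) (𝓝 p) := by
    have : Continuous fun t : ℝ => p + t • u := by fun_prop
    have h := this.tendsto 0
    simp only [zero_smul, add_zero] at h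
    exact h.mono_left nhdsWithin_le_nhds
  obtain ⟨t, ht, ht0⟩ := ((hcont.eventually (mem_interior_iff_mem_nhds.1 hp')).and
    self_mem_nhdsWithin).exists
  have h1 := h _ ht
  rw [add_dotProduct, h _ (interior_subset hp'), smul_dotProduct, smul_eq_mul] at h1
  have h2 : u ⬝ᵥ u = 0 := by
    have : t * (u ⬝ᵥ u) = 0 := by linarith
    exact (mul_eq_zero.1 this).resolve_left (ne_of_gt ht0)
  exact dotProduct_self_eq_zero.1 h2

/-- The normal cones of the faces are pointed. -/
lemma IsFace.eq_zero_of_neg_mem {P : LatticePolytope n} {E : Set (Fin n → ℝ)} (hE : P.IsFace E)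
    {u : Fin n → ℝ} (h1 : u ∈ P.normalCone E) (h2 : -u ∈ P.normalCone E) : u = 0 := by
  obtain ⟨x, hx⟩ := hE.1
  refine P.eq_zero_of_const (c := x ⬝ᵥ u) fun y hy => le_antisymm ?_ (h1 x hx y hy)
  have := h2 x hx y hy
  simpa using this

lemma IsFace.minFace_eq_of_normalCone {P : LatticePolytope n} {E : Set (Fin n → ℝ)}
    (hE : P.IsFace E) : E = {x ∈ P.body | ∀ u ∈ P.normalCone E, ∀ y ∈ P.body, x ⬝ᵥ u ≤ y ⬝ᵥ u} := by
  obtain ⟨u, rfl⟩ := hE.exists_eq_minFace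
  ext x
  exact ⟨fun hx => ⟨hx.1, fun v hv y hy => hv x hx y hy⟩,
    fun hx => ⟨hx.1, hx.2 u (P.mem_normalCone_minFace u)⟩⟩

lemma IsFace.eq_of_normalCone_eq {P : LatticePolytope n} {E F : Set (Fin n → ℝ)}
    (hE : P.IsFace E) (hF : P.IsFace F) (h : P.normalCone E = P.normalCone F) : E = F := by
  rw [hE.minFace_eq_of_normalCone, hF.minFace_eq_of_normalCone, h]

/-- The dot product as a bilinear form. -/
noncomputable abbrev dotForm (n : ℕ) : LinearMap.BilinForm ℝ (Fin n → ℝ) := dotProductBilin ℝ ℝ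

lemma dotForm_nondegenerate : (dotForm n).Nondegenerate := by
  constructor
  · intro x hx
    exact dotProduct_self_eq_zero.1 (hx x)
  · intro x hx
    exact dotProduct_self_eq_zero.1 (hx x)

lemma dotForm_isRefl : (dotForm n).IsRefl := by
  intro x y h
  simpa [dotProduct_comm] using h

lemma IsFace.span_normalCone_eq {P : LatticePolytope n} {E : Set (Fin n → ℝ)} (hE : P.IsFace E) :
    Submodule.span ℝ (P.normalCone E) = (dotForm n).orthogonal (vectorSpan ℝ E) := by
  ext w
  rw [hE.mem_span_normalCone, LinearMap.BilinForm.mem_orthogonal_iff]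
  constructor
  · intro h x hx
    change x ⬝ᵥ w = 0
    rw [vectorSpan_def] at hx
    induction hx using Submodule.span_induction with
    | mem v hv =>
      obtain ⟨a, ha, b, hb, rfl⟩ := hv
      simp [sub_dotProduct, h a ha b hb]
    | zero => simp
    | add a b _ _ ha hb => rw [add_dotProduct, ha, hb, add_zero]
    | smul c a _ ha => rw [smul_dotProduct, ha, smul_zero]
  · intro h x hx y hy
    have := h _ (vsub_mem_vectorSpan ℝ hx hy)
    change (x - y) ⬝ᵥ w = 0 at this
    rw [sub_dotProduct] at this
    linarith

lemma IsFace.finrank_span_normalCone {P : LatticePolytope n} {E : Set (Fin n → ℝ)}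
    (hE : P.IsFace E) : Module.finrank ℝ (Submodule.span ℝ (P.normalCone E)) +
      Module.finrank ℝ (vectorSpan ℝ E) = n := by
  have h1 := LinearMap.BilinForm.finrank_orthogonal (dotForm_nondegenerate (n := n))
    (vectorSpan ℝ E)
  rw [hE.span_normalCone_eq]
  have : Module.finrank ℝ (vectorSpan ℝ E) ≤ n := by
    simpa using Submodule.finrank_le (vectorSpan ℝ E)
  rw [Module.finrank_fintype_fun_eq_card, Fintype.card_fin] at h1
  omega

lemma IsFace.vectorSpan_eq {P : LatticePolytope n} {E : Set (Fin n → ℝ)} (hE : P.IsFace E) :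
    vectorSpan ℝ E = (dotForm n).orthogonal (Submodule.span ℝ (P.normalCone E)) := by
  rw [hE.span_normalCone_eq, LinearMap.BilinForm.orthogonal_orthogonal dotForm_nondegenerate
    dotForm_isRefl]

end LatticePolytope

/-! ### Primitive generators and facet inequalities -/

/-- A system of integral linear equations with a nonzero real solution has a nonzero integral
solution: the kernel of `D` is that of the square matrix `Dᵀ D`, whose determinant is an
integer. -/
lemma exists_int_mulVec_eq_zero {n : ℕ} {ι : Type*} [Fintype ι] (D : Matrix ι (Fin n) ℤ)
    {w : Fin n → ℝ} (hw : w ≠ 0) (h : (D.map (Int.castRingHom ℝ)).mulVec w = 0) :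
    ∃ v : Fin n → ℤ, v ≠ 0 ∧ D.mulVec v = 0 := by
  have h1 : (D.transpose * D).det = 0 := by
    have h2 : ((D.transpose * D).map (Int.castRingHom ℝ)).det = 0 := by
      refine Matrix.exists_mulVec_eq_zero_iff.1 ⟨w, hw, ?_⟩
      rw [Matrix.map_mul, ← Matrix.mulVec_mulVec, h, Matrix.mulVec_zero]
    rw [← RingHom.mapMatrix_apply, ← RingHom.map_det] at h2
    simpa using h2
  obtain ⟨v, hv, hv0⟩ := Matrix.exists_mulVec_eq_zero_iff.2 h1
  refine ⟨v, hv, ?_⟩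
  have h3 : D.mulVec v ⬝ᵥ D.mulVec v = 0 := by
    rw [Matrix.dotProduct_mulVec, Matrix.vecMul_mulVec, ← Matrix.dotProduct_mulVec, hv0,
      dotProduct_zero]
  exact dotProduct_self_eq_zero.1 h3

lemma latticeIncl_apply {n : ℕ} (m : Fin n → ℤ) (i : Fin n) : latticeIncl n m i = (m i : ℝ) := rfl

lemma latticeIncl_injective (n : ℕ) : Function.Injective (latticeIncl n) := by
  intro a b h
  ext i
  exact Int.cast_injective (α := ℝ) (congrFun h i)

lemma latticeIncl_dotProduct {n : ℕ} (a b : Fin n → ℤ) :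
    latticeIncl n a ⬝ᵥ latticeIncl n b = ((a ⬝ᵥ b : ℤ) : ℝ) := by
  simp [dotProduct, latticeIncl_apply]

/-- A nonzero integral vector is a positive multiple of a primitive one. -/
lemma exists_primitive {n : ℕ} {w : Fin n → ℤ} (hw : w ≠ 0) :
    ∃ (d : ℤ) (p a : Fin n → ℤ), 0 < d ∧ w = d • p ∧ a ⬝ᵥ p = 1 := by
  obtain ⟨d, hd⟩ := IsPrincipalIdealRing.principal (Ideal.span (Set.range w))
  have hdvd : ∀ i, d ∣ w i := by
    intro i
    have : w i ∈ Ideal.span (Set.range w) := Ideal.subset_span ⟨i, rfl⟩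
    rw [hd] at this
    exact Ideal.mem_span_singleton.1 this
  have hd0 : d ≠ 0 := by
    rintro rfl
    exact hw (funext fun i => zero_dvd_iff.1 (hdvd i))
  have hmem : d ∈ Ideal.span (Set.range w) := by
    rw [hd]
    exact Ideal.mem_span_singleton_self d
  obtain ⟨a, ha⟩ := (Ideal.mem_span_range_iff_exists_fun).1 hmem
  choose p hp using hdvd
  have h1 : a ⬝ᵥ p = 1 := by
    have : d * (a ⬝ᵥ p) = d * 1 := by
      rw [mul_one, ← smul_eq_mul, ← dotProduct_smul]
      conv_rhs => rw [← ha]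
      refine Finset.sum_congr rfl fun i _ => ?_
      rw [hp i]
      simp
    exact mul_left_cancel₀ hd0 this
  rcases lt_or_gt_of_ne hd0 with hneg | hpos
  · refine ⟨-d, -p, -a, by omega, ?_, by simpa using h1⟩
    ext i
    simp [hp i]
  · refine ⟨d, p, a, hpos, ?_, h1⟩
    ext i
    simp [hp i]

namespace LatticePolytope

variable {n : ℕ} (P : LatticePolytope n)

/-- The facet of the polytope dual to a ray, and a functional exposing it. -/
lemma exists_face_of_ray (ρ : P.Ray) :
    ∃ u : Fin n → ℝ, u ≠ 0 ∧ ρ.1 = P.normalCone (P.minFace u) ∧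
      ∀ v, v ∈ ρ.1 ↔ ∃ t : ℝ, 0 ≤ t ∧ v = t • u := by
  obtain ⟨⟨E, hE, hρ⟩, hdim⟩ := ρ.2
  obtain ⟨u, rfl⟩ := hE.exists_eq_minFace
  have hmem : u ∈ ρ.1 := hρ ▸ P.mem_normalCone_minFace u
  have hne : u ≠ 0 := by
    rintro rfl
    have hbot : Submodule.span ℝ ρ.1 = ⊥ := by
      rw [Submodule.eq_bot_iff]
      intro w hw
      rw [hρ, hE.mem_span_normalCone] at hw
      obtain ⟨x, hx⟩ := hE.1
      refine P.eq_zero_of_const (c := x ⬝ᵥ w) fun y hy => hw y ⟨hy, by simp⟩ x hx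
    rw [hbot] at hdim
    simp at hdim
  refine ⟨u, hne, hρ, fun v => ⟨fun hv => ?_, ?_⟩⟩
  · have hu' : (⟨u, Submodule.subset_span hmem⟩ : Submodule.span ℝ ρ.1) ≠ 0 := by
      simpa [Subtype.ext_iff] using hne
    obtain ⟨t, ht⟩ := (finrank_eq_one_iff_of_nonzero' _ hu').1 hdim ⟨v, Submodule.subset_span hv⟩
    have htv : t • u = v := by simpa [Subtype.ext_iff] using ht
    refine ⟨t, ?_, htv.symm⟩
    by_contra hneg
    push Not at hneg
    apply hne
    rw [hρ] at hv hmem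
    refine hE.eq_zero_of_neg_mem hmem ?_
    have := P.smul_mem_normalCone hv (t := -t⁻¹) (by simp [hneg.le])
    rwa [← htv, smul_smul, neg_mul, inv_mul_cancel₀ hneg.ne, neg_one_smul] at this
  · rintro ⟨t, ht, rfl⟩
    rw [hρ] at hmem ⊢
    exact P.smul_mem_normalCone hmem ht

/-- A ray of the normal fan is rational, so it has a primitive integral generator. -/
lemma exists_primitive_generator (ρ : P.Ray) :
    ∃ p a : Fin n → ℤ, a ⬝ᵥ p = 1 ∧ (∀ v, v ∈ ρ.1 ↔ ∃ t : ℝ, 0 ≤ t ∧ v = t • latticeIncl n p) ∧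
      ∀ v : Fin n → ℤ, latticeIncl n v ∈ ρ.1 ↔ ∃ k : ℕ, v = k • p := by
  classical
  obtain ⟨u, hu, hρ, hmem⟩ := P.exists_face_of_ray ρ
  obtain ⟨y₀, hy₀, hy₀E⟩ := P.exists_point_mem_minFace u
  have hE := P.isFace_minFace u
  let D : Matrix P.points (Fin n) ℤ := fun y =>
    if latticeIncl n y.1 ∈ P.minFace u then y.1 - y₀ else 0
  have hD : ∀ w : Fin n → ℝ, (D.map (Int.castRingHom ℝ)).mulVec w = 0 ↔
      ∀ y ∈ P.points, latticeIncl n y ∈ P.minFace u →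
        latticeIncl n y ⬝ᵥ w = latticeIncl n y₀ ⬝ᵥ w := by
    intro w
    rw [funext_iff]
    simp only [Subtype.forall, Matrix.mulVec, Pi.zero_apply]
    refine forall₂_congr fun y hy => ?_
    by_cases hyE : latticeIncl n y ∈ P.minFace u
    · have : (fun i => (D.map (Int.castRingHom ℝ)) ⟨y, hy⟩ i) =
          latticeIncl n y - latticeIncl n y₀ := by
        ext i; rw [Matrix.map_apply]; simp only [D]; rw [if_pos hyE]; simp [latticeIncl_apply]
      simp only [this, sub_dotProduct, hyE, true_imp_iff, sub_eq_zero]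
    · have : (fun i => (D.map (Int.castRingHom ℝ)) ⟨y, hy⟩ i) = 0 := by
        ext i; rw [Matrix.map_apply]; simp only [D]; rw [if_neg hyE]; simp
      simp only [this, zero_dotProduct, hyE, false_imp_iff]
  obtain ⟨w, hw, hDw⟩ := exists_int_mulVec_eq_zero D hu
    ((hD u).2 fun y _ hyE => P.minFace_const hyE hy₀E)
  have hwspan : latticeIncl n w ∈ Submodule.span ℝ ρ.1 := by
    rw [hρ, hE.mem_span_normalCone]
    have h1 : (D.map (Int.castRingHom ℝ)).mulVec (latticeIncl n w) = 0 := by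
      have : (D.map (Int.castRingHom ℝ)).mulVec (latticeIncl n w) =
          fun i => ((D.mulVec w i : ℤ) : ℝ) := by
        ext i
        simp [Matrix.mulVec, dotProduct, latticeIncl_apply]
      rw [this, hDw]
      ext; simp
    have h2 := (hD _).1 h1
    intro x hx y hy
    rw [hE.const_of_points h2 hx, hE.const_of_points h2 hy]
  have hspan : Submodule.span ℝ ρ.1 ≤ Submodule.span ℝ {u} := by
    refine Submodule.span_le.2 fun v hv => ?_
    obtain ⟨t, -, rfl⟩ := (hmem v).1 hv
    exact Submodule.smul_mem _ _ (Submodule.mem_span_singleton_self u)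
  obtain ⟨t, ht⟩ := Submodule.mem_span_singleton.1 (hspan hwspan)
  have hw' : latticeIncl n w ≠ 0 := fun h => hw (latticeIncl_injective n (by simpa using h))
  have ht0 : t ≠ 0 := by
    rintro rfl
    exact hw' (by rw [← ht, zero_smul])
  -- After a change of sign, the integral solution lies on the ray.
  obtain ⟨w', s, hs, hsw⟩ : ∃ (w' : Fin n → ℤ) (s : ℝ), 0 < s ∧ s • u = latticeIncl n w' := by
    rcases lt_or_gt_of_ne ht0 with h | h
    · exact ⟨-w, -t, by linarith, by rw [map_neg, ← ht, neg_smul]⟩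
    · exact ⟨w, t, h, ht⟩
  have hw'0 : w' ≠ 0 := by
    rintro rfl
    rw [map_zero, smul_eq_zero] at hsw
    exact hsw.elim hs.ne' hu
  obtain ⟨d, p, a, hd, hdp, hap⟩ := exists_primitive hw'0
  have hup : u = (s⁻¹ * d) • latticeIncl n p := by
    have h1 : latticeIncl n w' = (d : ℝ) • latticeIncl n p := by
      rw [hdp]; ext i; simp [latticeIncl_apply]
    rw [mul_smul, ← h1, ← hsw, smul_smul, inv_mul_cancel₀ hs.ne', one_smul]
  have hc : 0 < s⁻¹ * (d : ℝ) := mul_pos (inv_pos.2 hs) (by exact_mod_cast hd)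
  have hmem' : ∀ v, v ∈ ρ.1 ↔ ∃ t : ℝ, 0 ≤ t ∧ v = t • latticeIncl n p := by
    intro v
    rw [hmem]
    constructor
    · rintro ⟨t, ht, rfl⟩
      exact ⟨t * (s⁻¹ * d), mul_nonneg ht hc.le, by rw [hup, smul_smul]⟩
    · rintro ⟨t, ht, rfl⟩
      refine ⟨t * (s⁻¹ * d)⁻¹, mul_nonneg ht (inv_nonneg.2 hc.le), ?_⟩
      rw [hup, smul_smul, mul_assoc, inv_mul_cancel₀ hc.ne', mul_one]
  refine ⟨p, a, hap, hmem', fun v => ⟨fun hv => ?_, ?_⟩⟩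
  · obtain ⟨t, ht, htv⟩ := (hmem' _).1 hv
    have h1 : ((a ⬝ᵥ v : ℤ) : ℝ) = t := by
      rw [← latticeIncl_dotProduct, htv, dotProduct_smul, latticeIncl_dotProduct, hap]
      simp
    have h2 : 0 ≤ a ⬝ᵥ v := by
      have : (0 : ℝ) ≤ ((a ⬝ᵥ v : ℤ) : ℝ) := h1 ▸ ht
      exact_mod_cast this
    obtain ⟨k, hk⟩ := Int.eq_ofNat_of_zero_le h2
    refine ⟨k, latticeIncl_injective n ?_⟩
    rw [htv, ← h1, hk]
    ext i
    simp [latticeIncl_apply]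
  · rintro ⟨k, rfl⟩
    refine (hmem' _).2 ⟨k, by positivity, ?_⟩
    ext i
    simp [latticeIncl_apply]

/-- The defining property of the ray generator. -/
lemma gen_spec (ρ : P.Ray) : ∀ v : Fin n → ℤ, latticeIncl n v ∈ ρ.1 ↔ ∃ k : ℕ, v = k • P.gen ρ := by
  obtain ⟨p, a, -, -, hp⟩ := P.exists_primitive_generator ρ
  exact Classical.epsilon_spec (p := fun u => ∀ v : Fin n → ℤ,
    latticeIncl n v ∈ ρ.1 ↔ ∃ k : ℕ, v = k • u) ⟨p, hp⟩

lemma gen_primitive (ρ : P.Ray) :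
    (∃ a : Fin n → ℤ, a ⬝ᵥ P.gen ρ = 1) ∧
      ∀ v, v ∈ ρ.1 ↔ ∃ t : ℝ, 0 ≤ t ∧ v = t • latticeIncl n (P.gen ρ) := by
  obtain ⟨p, a, hap, hreal, hp⟩ := P.exists_primitive_generator ρ
  have hg := P.gen_spec ρ
  obtain ⟨k, hk⟩ := (hp (P.gen ρ)).1 ((hg _).2 ⟨1, (one_smul _ _).symm⟩)
  obtain ⟨l, hl⟩ := (hg p).1 ((hp _).2 ⟨1, (one_smul _ _).symm⟩)
  have h1 : (k : ℤ) * l = 1 := by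
    have : a ⬝ᵥ p = l * (k * (a ⬝ᵥ p)) := by
      conv_lhs => rw [hl, hk]
      rw [dotProduct_smul, dotProduct_smul, nsmul_eq_mul, nsmul_eq_mul]
    rw [hap] at this
    linarith
  have h2 : k = 1 := by
    have : k * l = 1 := by exact_mod_cast h1
    exact Nat.eq_one_of_mul_eq_one_right this
  rw [h2, one_smul] at hk
  rw [hk]
  exact ⟨⟨a, hap⟩, hreal⟩

/-- The ray generator as a real vector. -/
noncomputable abbrev rgen (ρ : P.Ray) : Fin n → ℝ := latticeIncl n (P.gen ρ)

/-- The left-hand side of the facet inequality `⟨m, u_ρ⟩ + c_ρ ≥ 0`. -/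
noncomputable def slack (ρ : P.Ray) (m : Fin n → ℝ) : ℝ := m ⬝ᵥ P.rgen ρ + P.const ρ

lemma mem_ray_iff (ρ : P.Ray) (v : Fin n → ℝ) :
    v ∈ ρ.1 ↔ ∃ t : ℝ, 0 ≤ t ∧ v = t • P.rgen ρ := (P.gen_primitive ρ).2 v

lemma rgen_mem (ρ : P.Ray) : P.rgen ρ ∈ ρ.1 := (P.mem_ray_iff ρ _).2 ⟨1, zero_le_one, by simp⟩

lemma rgen_ne_zero (ρ : P.Ray) : P.rgen ρ ≠ 0 := by
  intro h
  obtain ⟨a, ha⟩ := (P.gen_primitive ρ).1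
  rw [latticeIncl_injective n (h.trans (map_zero _).symm)] at ha
  simp at ha

/-- A ray is the normal cone of the face exposed by its generator. -/
lemma ray_eq_normalCone (ρ : P.Ray) : ρ.1 = P.normalCone (P.minFace (P.rgen ρ)) := by
  obtain ⟨u, hu, hρ, hmem⟩ := P.exists_face_of_ray ρ
  obtain ⟨t, ht, htu⟩ := (hmem _).1 (P.rgen_mem ρ)
  have ht0 : t ≠ 0 := by
    rintro rfl
    exact P.rgen_ne_zero ρ (by rw [htu, zero_smul])
  have htpos : 0 < t := lt_of_le_of_ne ht ht0.symm
  have : P.minFace (P.rgen ρ) = P.minFace u := by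
    ext x
    simp only [minFace, htu, dotProduct_smul, smul_eq_mul]
    simp only [mul_le_mul_iff_right₀ htpos]
  rw [this]
  exact hρ

lemma isFacet_minFace_rgen (ρ : P.Ray) : P.IsFacet (P.minFace (P.rgen ρ)) := by
  refine ⟨P.isFace_minFace _, ?_⟩
  have h := (P.isFace_minFace (P.rgen ρ)).finrank_span_normalCone
  rw [← P.ray_eq_normalCone, ρ.2.2] at h
  omega

/-- The constants `c_ρ` are the support numbers of the polytope. -/
lemma const_spec (ρ : P.Ray) : (∀ m ∈ P.body, 0 ≤ P.slack ρ m) ∧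
    ∀ m ∈ P.minFace (P.rgen ρ), P.slack ρ m = 0 := by
  obtain ⟨y, hy, hyE⟩ := P.exists_point_mem_minFace (P.rgen ρ)
  have hset : {c : ℤ | ∀ m ∈ P.body, 0 ≤ m ⬝ᵥ latticeIncl n (P.gen ρ) + c} =
      Set.Ici (-(y ⬝ᵥ P.gen ρ)) := by
    ext c
    simp only [Set.mem_ofPred_eq, Set.mem_Ici]
    constructor
    · intro h
      have := h _ hyE.1
      rw [latticeIncl_dotProduct] at this
      have : 0 ≤ y ⬝ᵥ P.gen ρ + c := by exact_mod_cast this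
      linarith
    · intro h m hm
      have h1 := hyE.2 m hm
      rw [latticeIncl_dotProduct] at h1
      have h2 : (-(y ⬝ᵥ P.gen ρ : ℤ) : ℝ) ≤ c := by exact_mod_cast h
      linarith
  have hc : P.const ρ = -(y ⬝ᵥ P.gen ρ) := by rw [const, hset, csInf_Ici]
  have h0 : P.slack ρ (latticeIncl n y) = 0 := by
    rw [slack, hc, latticeIncl_dotProduct]
    push_cast
    ring
  constructor
  · intro m hm
    rw [← h0, slack, slack]
    linarith [hyE.2 m hm]
  · intro m hm
    rw [← h0, slack, slack, P.minFace_const hm hyE]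

lemma slack_nonneg (ρ : P.Ray) {m : Fin n → ℝ} (hm : m ∈ P.body) : 0 ≤ P.slack ρ m :=
  (P.const_spec ρ).1 m hm

lemma rgen_mem_normalCone_iff {E : Set (Fin n → ℝ)} (hE : E ⊆ P.body) (ρ : P.Ray) :
    P.rgen ρ ∈ P.normalCone E ↔ ∀ x ∈ E, P.slack ρ x = 0 := by
  constructor
  · intro h x hx
    exact (P.const_spec ρ).2 x ⟨hE hx, h x hx⟩
  · intro h x hx y hy
    have h1 := h x hx
    have h2 := P.slack_nonneg ρ hy
    rw [slack] at h1 h2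
    linarith

open Classical in
lemma mem_rays {σ : Set (Fin n → ℝ)} {ρ : P.Ray} : ρ ∈ P.rays σ ↔ ρ.1 ⊆ σ := by
  simp [rays]

lemma mem_rays_iff {E : Set (Fin n → ℝ)} (hE : E ⊆ P.body) (ρ : P.Ray) :
    ρ ∈ P.rays (P.normalCone E) ↔ ∀ x ∈ E, P.slack ρ x = 0 := by
  rw [← P.rgen_mem_normalCone_iff hE, mem_rays]
  constructor
  · intro h
    exact h (P.rgen_mem ρ)
  · intro h v hv
    obtain ⟨t, ht, rfl⟩ := (P.mem_ray_iff ρ v).1 hv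
    exact P.smul_mem_normalCone h ht

lemma rgen_mem_of_mem_rays {σ : Set (Fin n → ℝ)} {ρ : P.Ray} (h : ρ ∈ P.rays σ) :
    P.rgen ρ ∈ σ := by
  exact P.mem_rays.1 h (P.rgen_mem ρ)

end LatticePolytope

/-! ### Simple polytopes: maximal cones, vertices and edges -/

namespace LatticePolytope

variable {n : ℕ} (P : LatticePolytope n)

lemma exists_sup_ball_subset : ∃ (p : Fin n → ℝ) (r : ℝ), 0 < r ∧
    ∀ w : Fin n → ℝ, ‖w‖ ≤ r → p + w ∈ P.body := by
  obtain ⟨p, hp⟩ := P.fullDim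
  obtain ⟨r, hr, hball⟩ := Metric.nhds_basis_closedBall.mem_iff.1 (mem_interior_iff_mem_nhds.1 hp)
  exact ⟨p, r, hr, fun w hw => hball (by simpa [Metric.mem_closedBall, dist_eq_norm] using hw)⟩

lemma normalCone_antitone {E F : Set (Fin n → ℝ)} (h : E ⊆ F) :
    P.normalCone F ⊆ P.normalCone E := fun _ hu x hx => hu x (h hx)

/-- The cone over the rays of the fan contained in a given set. -/
def rayCone (σ : Set (Fin n → ℝ)) : Set (Fin n → ℝ) :=
  {u | ∃ c : P.Ray → ℝ, (∀ ρ, 0 ≤ c ρ) ∧ u = ∑ ρ ∈ P.rays σ, c ρ • P.rgen ρ}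

lemma convex_rayCone (σ : Set (Fin n → ℝ)) : Convex ℝ (P.rayCone σ) := by
  rintro a ⟨c, hc, rfl⟩ b ⟨d, hd, rfl⟩ s t hs ht -
  refine ⟨fun ρ => s * c ρ + t * d ρ, fun ρ => by have := hc ρ; have := hd ρ; positivity, ?_⟩
  simp only [Finset.smul_sum, smul_smul, add_smul, Finset.sum_add_distrib]

lemma smul_mem_rayCone {σ : Set (Fin n → ℝ)} {u : Fin n → ℝ} (hu : u ∈ P.rayCone σ) {t : ℝ}
    (ht : 0 ≤ t) : t • u ∈ P.rayCone σ := by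
  obtain ⟨c, hc, rfl⟩ := hu
  exact ⟨fun ρ => t * c ρ, fun ρ => mul_nonneg ht (hc ρ), by simp [Finset.smul_sum, smul_smul]⟩

lemma smul_rgen_mem_rayCone {σ : Set (Fin n → ℝ)} {ρ : P.Ray} (hρ : ρ ∈ P.rays σ) {t : ℝ}
    (ht : 0 ≤ t) : t • P.rgen ρ ∈ P.rayCone σ := by
  refine ⟨Pi.single ρ t, fun ρ' => ?_, ?_⟩
  · by_cases h : ρ' = ρ
    · subst h; simpa using ht
    · simp [h]
  · rw [Finset.sum_eq_single ρ]
    · simp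
    · intro b _ hb; simp [hb]
    · exact fun h => absurd hρ h

/-- If `u` spans the intersection of the linear span of its face with a transversal slice, that is,
if `u` is an extreme point of a slice of a vertex cone, then it lies on a ray of the fan. -/
lemma mem_ray_of_extreme {y : Fin n → ℤ} {q u : Fin n → ℝ}
    (hu : u ∈ Set.extremePoints ℝ {u ∈ P.normalCone {latticeIncl n y} | q ⬝ᵥ u = 1})
    (hy : latticeIncl n y ∈ P.body) :
    ∃ ρ ∈ P.rays (P.normalCone {latticeIncl n y}), u ∈ ρ.1 := by
  have hqu : q ⬝ᵥ u = 1 := hu.1.2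
  have hyE : latticeIncl n y ∈ P.minFace u := ⟨hy, hu.1.1 _ rfl⟩
  have hE := P.isFace_minFace u
  -- Every functional constant on the face of `u` is a multiple of `u`.
  have hdir : ∀ w : Fin n → ℝ, q ⬝ᵥ w = 0 → w ∈ Submodule.span ℝ (P.normalCone (P.minFace u)) →
      w = 0 := by
    intro w hqw hw
    rw [hE.mem_span_normalCone] at hw
    obtain ⟨ε₁, hε₁, h₁, -⟩ := P.exists_perturb u w hyE (fun z _ hz => (hw _ hyE _ hz).le)
    obtain ⟨ε₂, hε₂, h₂, -⟩ := P.exists_perturb u (-w) hyE (fun z _ hz => by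
      rw [dotProduct_neg, dotProduct_neg, hw _ hyE _ hz])
    have hmem : ∀ ε : ℝ, ∀ v, q ⬝ᵥ v = 0 → latticeIncl n y ∈ P.minFace (u + ε • v) →
        u + ε • v ∈ {u ∈ P.normalCone {latticeIncl n y} | q ⬝ᵥ u = 1} := by
      intro ε v hqv hv
      refine ⟨?_, by rw [dotProduct_add, hqu, dotProduct_smul, hqv, smul_zero, add_zero]⟩
      rintro x rfl z hz
      exact hv.2 z hz
    have h := hu.2 (hmem _ _ hqw h₁) (hmem _ _ (by rw [dotProduct_neg, hqw, neg_zero]) h₂)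
      ⟨ε₂ / (ε₁ + ε₂), ε₁ / (ε₁ + ε₂), by positivity, by positivity, by field_simp; ring, by
        ext i
        simp only [Pi.add_apply, Pi.smul_apply, Pi.neg_apply, smul_eq_mul]
        field_simp
        ring⟩
    have h3 : ε₁ • w = 0 := by simpa using h
    exact (smul_eq_zero.1 h3).resolve_left hε₁.ne'
  have hu0 : u ≠ 0 := by
    rintro rfl
    simp at hqu
  have hdim : Module.finrank ℝ (Submodule.span ℝ (P.normalCone (P.minFace u))) = 1 := by
    have hus : u ∈ Submodule.span ℝ (P.normalCone (P.minFace u)) :=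
      Submodule.subset_span (P.mem_normalCone_minFace u)
    refine (finrank_eq_one_iff_of_nonzero' (⟨u, hus⟩ : Submodule.span ℝ _)
      (by simpa [Subtype.ext_iff] using hu0)).2 ?_
    rintro ⟨w, hw⟩
    refine ⟨q ⬝ᵥ w, ?_⟩
    have := hdir (w - (q ⬝ᵥ w) • u) (by rw [dotProduct_sub, dotProduct_smul, hqu]; simp)
      (Submodule.sub_mem _ hw (Submodule.smul_mem _ _ hus))
    ext1
    exact (sub_eq_zero.1 this).symm
  refine ⟨⟨P.normalCone (P.minFace u), ⟨_, hE, rfl⟩, hdim⟩, P.mem_rays.2 ?_,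
    P.mem_normalCone_minFace u⟩
  exact P.normalCone_antitone (by simpa using hyE)

/-- The normal cone of a vertex is generated by its rays: a compact slice of it is the convex hull
of its extreme points. -/
lemma normalCone_vertex_subset {y : Fin n → ℤ} (hy : latticeIncl n y ∈ P.body) :
    P.normalCone {latticeIncl n y} ⊆ P.rayCone (P.normalCone {latticeIncl n y}) := by
  obtain ⟨p, r, hr, hball⟩ := P.exists_sup_ball_subset
  set σ := P.normalCone {latticeIncl n y} with hσ
  set q := p - latticeIncl n y with hq
  have hqw : ∀ u ∈ σ, ∀ w : Fin n → ℝ, ‖w‖ ≤ r → -(w ⬝ᵥ u) ≤ q ⬝ᵥ u := by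
    intro u hu w hw
    have := hu _ rfl _ (hball w hw)
    rw [hq, sub_dotProduct]
    rw [add_dotProduct] at this
    linarith
  have hcoord : ∀ u ∈ σ, ∀ i, |u i| ≤ (q ⬝ᵥ u) / r := by
    intro u hu i
    have hn : ∀ s : ℝ, |s| = r → ‖(Pi.single i s : Fin n → ℝ)‖ ≤ r := by
      intro s hs
      rw [Pi.norm_single, Real.norm_eq_abs, hs]
    have h1 := hqw u hu _ (hn r (abs_of_pos hr))
    have h2 := hqw u hu _ (hn (-r) (by rw [abs_neg, abs_of_pos hr]))
    simp only [single_dotProduct] at h1 h2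
    rw [le_div_iff₀ hr]
    rcases abs_cases (u i) with ⟨h, -⟩ | ⟨h, -⟩ <;> rw [h] <;> linarith
  have hpos : ∀ u ∈ σ, u ≠ 0 → 0 < q ⬝ᵥ u := by
    intro u hu hu0
    by_contra hle
    push Not at hle
    refine hu0 (funext fun i => ?_)
    have := hcoord u hu i
    have h2 : (q ⬝ᵥ u) / r ≤ 0 := div_nonpos_of_nonpos_of_nonneg hle hr.le
    exact abs_nonpos_iff.1 (this.trans h2)
  set Q : Set (Fin n → ℝ) := {u ∈ σ | q ⬝ᵥ u = 1} with hQ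
  have hclosed : IsClosed Q := by
    have hrw : Q = (⋂ z ∈ P.body, {u | latticeIncl n y ⬝ᵥ u ≤ z ⬝ᵥ u}) ∩ {u | q ⬝ᵥ u = 1} := by
      ext u
      simp only [hQ, hσ, normalCone, Set.mem_inter_iff, Set.mem_iInter, Set.mem_ofPred_eq,
        Set.mem_singleton_iff, forall_eq]
    rw [hrw]
    refine IsClosed.inter (isClosed_biInter fun z _ => isClosed_le ?_ ?_) (isClosed_eq ?_ ?_)
    all_goals first | exact continuous_const | (unfold dotProduct; fun_prop)
  have hbdd : Q ⊆ Set.Icc (fun _ => -(1 / r)) (fun _ => 1 / r) := by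
    intro u hu
    have h := fun i => hcoord u hu.1 i
    simp only [hu.2] at h
    exact ⟨fun i => (abs_le.1 (h i)).1, fun i => (abs_le.1 (h i)).2⟩
  have hcompact : IsCompact Q := isCompact_Icc.of_isClosed_subset hclosed hbdd
  have hconv : Convex ℝ Q := by
    intro a ha b hb s t hs ht hst
    refine ⟨?_, ?_⟩
    · intro x hx z hz
      simp only [dotProduct_add, dotProduct_smul, smul_eq_mul]
      exact add_le_add (mul_le_mul_of_nonneg_left (ha.1 x hx z hz) hs)
        (mul_le_mul_of_nonneg_left (hb.1 x hx z hz) ht)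
    · rw [dotProduct_add, dotProduct_smul, dotProduct_smul, ha.2, hb.2]
      simpa using hst
  set S : Set (Fin n → ℝ) := (fun ρ : P.Ray => (q ⬝ᵥ P.rgen ρ)⁻¹ • P.rgen ρ) '' (P.rays σ : Set P.Ray)
  have hS : S.Finite := (Finset.finite_toSet _).image _
  have hext : Q.extremePoints ℝ ⊆ S := by
    intro u hu
    obtain ⟨ρ, hρ, huρ⟩ := P.mem_ray_of_extreme hu hy
    refine ⟨ρ, hρ, ?_⟩
    obtain ⟨t, ht, rfl⟩ := (P.mem_ray_iff ρ u).1 huρ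
    have h1 : q ⬝ᵥ (t • P.rgen ρ) = 1 := hu.1.2
    rw [dotProduct_smul, smul_eq_mul] at h1
    rw [eq_inv_of_mul_eq_one_left h1]
  have hQS : Q ⊆ convexHull ℝ S := by
    calc Q = closure (convexHull ℝ (Q.extremePoints ℝ)) :=
          (closure_convexHull_extremePoints hcompact hconv).symm
      _ ⊆ closure (convexHull ℝ S) := closure_mono (convexHull_mono hext)
      _ = _ := (hS.isClosed_convexHull (𝕜 := ℝ)).closure_eq
  have hSC : convexHull ℝ S ⊆ P.rayCone σ := by
    refine convexHull_min ?_ (P.convex_rayCone σ)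
    rintro _ ⟨ρ, hρ, rfl⟩
    exact P.smul_rgen_mem_rayCone hρ (inv_nonneg.2
      (hpos _ (P.rgen_mem_of_mem_rays hρ) (P.rgen_ne_zero ρ)).le)
  intro u hu
  by_cases hu0 : u = 0
  · exact ⟨0, fun _ => le_rfl, by simp [hu0]⟩
  have hp := hpos u hu hu0
  have h1 : (q ⬝ᵥ u)⁻¹ • u ∈ Q :=
    ⟨P.smul_mem_normalCone hu (inv_nonneg.2 hp.le), by
      rw [dotProduct_smul, smul_eq_mul, inv_mul_cancel₀ hp.ne']⟩
  have h2 := P.smul_mem_rayCone (hSC (hQS h1)) hp.le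
  rwa [smul_smul, mul_inv_cancel₀ hp.ne', one_smul] at h2

lemma IsFace.singleton_mem_extremePoints {P : LatticePolytope n} {v : Fin n → ℝ}
    (h : P.IsFace {v}) : v ∈ P.body.extremePoints ℝ := by
  have := (IsExposed.isExtreme (𝕜 := ℝ) h.2).extremePoints_subset_extremePoints
  exact this (by simp)

/-- In a simple polytope, the normal cone of each vertex has `n` rays. -/
lemma IsSimple.card_rays {P : LatticePolytope n} (hP : P.IsSimple) {v : Fin n → ℝ}
    (hv : P.IsFace {v}) : (P.rays (P.normalCone {v})).card = n := by
  have hvb : v ∈ P.body := hv.subset_body rfl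
  have h := hP v hv.singleton_mem_extremePoints
  have himg : {F | P.IsFacet F ∧ v ∈ F} =
      (fun ρ : P.Ray => P.minFace (P.rgen ρ)) '' (P.rays (P.normalCone {v}) : Set P.Ray) := by
    ext F
    constructor
    · rintro ⟨hF, hvF⟩
      have hdim := hF.1.finrank_span_normalCone
      let ρ : P.Ray := ⟨P.normalCone F, ⟨F, hF.1, rfl⟩, by have := hF.2; omega⟩
      refine ⟨ρ, ?_, ?_⟩
      · rw [Finset.mem_coe, mem_rays]
        exact P.normalCone_antitone (by simpa using hvF)
      · exact (P.isFace_minFace _).eq_of_normalCone_eq hF.1 (P.ray_eq_normalCone ρ).symm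
    · rintro ⟨ρ, hρ, rfl⟩
      refine ⟨P.isFacet_minFace_rgen ρ, hvb, ?_⟩
      have := P.rgen_mem_of_mem_rays hρ
      exact this v rfl
  rw [himg, Set.ncard_image_of_injective, Set.ncard_coe_finset] at h
  · exact h
  · intro ρ ρ' hρ
    apply Subtype.ext
    rw [P.ray_eq_normalCone ρ, P.ray_eq_normalCone ρ']
    exact congrArg P.normalCone hρ

/-- The maximal cones of the fan are the normal cones of the vertices. -/
lemma exists_vertex_of_cone (σ : P.Cone n) : ∃ y ∈ P.points,
    P.IsFace {latticeIncl n y} ∧ σ.1 = P.normalCone {latticeIncl n y} := by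
  obtain ⟨⟨E, hE, hσ⟩, hdim⟩ := σ.2
  obtain ⟨y, hy, hyE, hface⟩ := hE.exists_vertex
  refine ⟨y, hy, hface, ?_⟩
  rw [hσ] at hdim ⊢
  have h := hE.finrank_span_normalCone
  have h0 : vectorSpan ℝ E = ⊥ := by
    apply Submodule.finrank_eq_zero.1
    omega
  rw [vectorSpan_eq_bot_iff_subsingleton] at h0
  rw [h0.eq_singleton_of_mem hyE]

lemma exists_cone_of_vertex {v : Fin n → ℝ} (hv : P.IsFace {v}) :
    ∃ σ : P.Cone n, σ.1 = P.normalCone {v} := by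
  refine ⟨⟨P.normalCone {v}, ⟨_, hv, rfl⟩, ?_⟩, rfl⟩
  have h := hv.finrank_span_normalCone
  rw [vectorSpan_singleton, finrank_bot] at h
  omega

/-- The vertex of the polytope whose normal cone is `σ`. -/
noncomputable def vertex (σ : P.Cone n) : Fin n → ℤ := (P.exists_vertex_of_cone σ).choose

/-- The vertex as a real vector. -/
noncomputable abbrev rvertex (σ : P.Cone n) : Fin n → ℝ := latticeIncl n (P.vertex σ)

lemma isFace_vertex (σ : P.Cone n) : P.IsFace {P.rvertex σ} :=
  (P.exists_vertex_of_cone σ).choose_spec.2.1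

lemma cone_eq_normalCone (σ : P.Cone n) : σ.1 = P.normalCone {P.rvertex σ} :=
  (P.exists_vertex_of_cone σ).choose_spec.2.2

lemma vertex_mem_body (σ : P.Cone n) : P.rvertex σ ∈ P.body := (P.isFace_vertex σ).subset_body rfl

lemma mem_rays_cone_iff (σ : P.Cone n) (ρ : P.Ray) :
    ρ ∈ P.rays σ.1 ↔ P.slack ρ (P.rvertex σ) = 0 := by
  rw [P.cone_eq_normalCone σ, P.mem_rays_iff (P.isFace_vertex σ).subset_body]
  simp

lemma cone_subset_rayCone (σ : P.Cone n) : σ.1 ⊆ P.rayCone σ.1 := by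
  rw [P.cone_eq_normalCone]
  exact P.normalCone_vertex_subset (P.vertex_mem_body σ)

lemma rayCone_subset_cone (σ : P.Cone n) : P.rayCone σ.1 ⊆ σ.1 := by
  rintro _ ⟨c, hc, rfl⟩
  rw [P.cone_eq_normalCone]
  intro x hx y hy
  simp only [dotProduct_sum, dotProduct_smul, smul_eq_mul]
  refine Finset.sum_le_sum fun ρ hρ => mul_le_mul_of_nonneg_left ?_ (hc ρ)
  exact P.rgen_mem_of_mem_rays hρ x hx y hy

lemma rays_cone_injective : Function.Injective fun σ : P.Cone n => P.rays σ.1 := by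
  intro σ τ h
  apply Subtype.ext
  have h' : P.rays σ.1 = P.rays τ.1 := h
  have hr : P.rayCone σ.1 = P.rayCone τ.1 := by rw [rayCone, h', rayCone]
  exact (P.cone_subset_rayCone σ).antisymm (P.rayCone_subset_cone σ) |>.trans
    (hr.trans ((P.rayCone_subset_cone τ).antisymm (P.cone_subset_rayCone τ)))

variable {P}

lemma IsSimple.card_rays_cone (hP : P.IsSimple) (σ : P.Cone n) : (P.rays σ.1).card = n := by
  rw [P.cone_eq_normalCone σ]
  exact hP.card_rays (P.isFace_vertex σ)

/-- The dual basis of the ray generators of a maximal cone: the primitive edge directions up to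
scaling. -/
lemma IsSimple.exists_edge (hP : P.IsSimple) (σ : P.Cone n) :
    ∃ e : P.Ray → Fin n → ℝ, (∀ ρ ∉ P.rays σ.1, e ρ = 0) ∧
      (∀ ρ ∈ P.rays σ.1, ∀ ρ' ∈ P.rays σ.1, e ρ ⬝ᵥ P.rgen ρ' = if ρ = ρ' then 1 else 0) ∧
      ∀ x : Fin n → ℝ, x = ∑ ρ ∈ P.rays σ.1, (x ⬝ᵥ P.rgen ρ) • e ρ := by
  have hspan : ⊤ ≤ Submodule.span ℝ (Set.range fun ρ : P.rays σ.1 => P.rgen ρ.1) := by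
    have h1 : Submodule.span ℝ σ.1 = ⊤ := by
      apply Submodule.eq_top_of_finrank_eq
      rw [σ.2.2]
      simp
    rw [← h1]
    refine Submodule.span_le.2 fun u hu => ?_
    obtain ⟨c, -, rfl⟩ := P.cone_subset_rayCone σ hu
    exact Submodule.sum_mem _ fun ρ hρ => Submodule.smul_mem _ _
      (Submodule.subset_span ⟨⟨ρ, hρ⟩, rfl⟩)
  have hcard : Fintype.card (P.rays σ.1) = Module.finrank ℝ (Fin n → ℝ) := by
    simp [hP.card_rays_cone σ]
  let b := basisOfTopLeSpanOfCardEqFinrank _ hspan hcard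
  have hb : ∀ ρ : P.rays σ.1, b ρ = P.rgen ρ.1 := fun ρ => by simp [b]
  let e : P.Ray → Fin n → ℝ := fun ρ => if h : ρ ∈ P.rays σ.1 then
    (dotProductEquiv ℝ (Fin n)).symm (b.coord ⟨ρ, h⟩) else 0
  have he : ∀ ρ (h : ρ ∈ P.rays σ.1) x, e ρ ⬝ᵥ x = b.coord ⟨ρ, h⟩ x := by
    intro ρ h x
    simp only [e, dif_pos h]
    rw [← dotProductEquiv_apply_apply, LinearEquiv.apply_symm_apply]
  have hdual : ∀ ρ ∈ P.rays σ.1, ∀ ρ' ∈ P.rays σ.1,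
      e ρ ⬝ᵥ P.rgen ρ' = if ρ = ρ' then 1 else 0 := by
    intro ρ h ρ' h'
    rw [he ρ h, ← hb ⟨ρ', h'⟩, Module.Basis.coord_apply, Module.Basis.repr_self,
      Finsupp.single_apply]
    simp [Subtype.ext_iff, eq_comm]
  refine ⟨e, fun ρ h => dif_neg h, hdual, fun x => ?_⟩
  set d := x - ∑ ρ ∈ P.rays σ.1, (x ⬝ᵥ P.rgen ρ) • e ρ with hd
  have hd0 : ∀ ρ ∈ P.rays σ.1, d ⬝ᵥ P.rgen ρ = 0 := by
    intro ρ hρ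
    rw [hd, sub_dotProduct, sum_dotProduct, sub_eq_zero, Finset.sum_eq_single ρ]
    · rw [smul_dotProduct, hdual ρ hρ ρ hρ]; simp
    · intro ρ' hρ' hne
      rw [smul_dotProduct, hdual ρ' hρ' ρ hρ, if_neg hne, smul_zero]
    · exact fun h => absurd hρ h
  have hdd : d ⬝ᵥ d = 0 := by
    have hmem : d ∈ Submodule.span ℝ (Set.range fun ρ : P.rays σ.1 => P.rgen ρ.1) := hspan trivial
    obtain ⟨c, hc⟩ := (Submodule.mem_span_range_iff_exists_fun ℝ).1 hmem
    have hdc : d ⬝ᵥ d = (∑ ρ, c ρ • P.rgen ρ.1) ⬝ᵥ d := by rw [hc]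
    rw [hdc, sum_dotProduct]
    refine Finset.sum_eq_zero fun ρ _ => ?_
    rw [smul_dotProduct, dotProduct_comm, hd0 ρ.1 ρ.2, smul_zero]
  exact sub_eq_zero.1 (dotProduct_self_eq_zero.1 hdd)

variable (P)

open Classical in
/-- The vectors `e_ρ`, `ρ ∈ σ(1)`, dual to the generators of the rays of a maximal cone `σ`, and
zero for the other rays. -/
noncomputable def edge (σ : P.Cone n) : P.Ray → Fin n → ℝ :=
  if h : P.IsSimple then (h.exists_edge σ).choose else 0

variable {P}

/-- The edge vectors at a vertex form the basis dual to the ray generators of its normal cone. -/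
lemma IsSimple.edge_spec (hP : P.IsSimple) (σ : P.Cone n) :
    (∀ ρ ∉ P.rays σ.1, P.edge σ ρ = 0) ∧
      (∀ ρ ∈ P.rays σ.1, ∀ ρ' ∈ P.rays σ.1,
        P.edge σ ρ ⬝ᵥ P.rgen ρ' = if ρ = ρ' then 1 else 0) ∧
      ∀ x : Fin n → ℝ, x = ∑ ρ ∈ P.rays σ.1, (x ⬝ᵥ P.rgen ρ) • P.edge σ ρ := by
  simp only [edge, dif_pos hP]
  exact (hP.exists_edge σ).choose_spec

/-- The polytope is cut out by its facet inequalities. -/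
lemma mem_body_iff {m : Fin n → ℝ} : m ∈ P.body ↔ ∀ ρ, 0 ≤ P.slack ρ m := by
  refine ⟨fun hm ρ => P.slack_nonneg ρ hm, fun hm => ?_⟩
  by_contra hmem
  obtain ⟨f, c, hf1, hf2⟩ := geometric_hahn_banach_point_closed P.convex_body
    P.isCompact_body.isClosed hmem
  set u := (dotProductEquiv ℝ (Fin n)).symm f.toLinearMap with hu
  have hfu : ∀ x, f x = x ⬝ᵥ u := by
    intro x
    rw [dotProduct_comm, ← dotProductEquiv_apply_apply, hu, LinearEquiv.apply_symm_apply]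
    rfl
  obtain ⟨y, hy, hyE, hface⟩ := (P.isFace_minFace u).exists_vertex
  have huσ : u ∈ P.normalCone {latticeIncl n y} :=
    P.normalCone_antitone (by simpa using hyE) (P.mem_normalCone_minFace u)
  obtain ⟨k, hk, hsum⟩ := P.normalCone_vertex_subset hyE.1 huσ
  have hle : latticeIncl n y ⬝ᵥ u ≤ m ⬝ᵥ u := by
    rw [hsum]
    simp only [dotProduct_sum, dotProduct_smul, smul_eq_mul]
    refine Finset.sum_le_sum fun ρ hρ => mul_le_mul_of_nonneg_left ?_ (hk ρ)
    have h1 := (P.mem_rays_iff (by simpa using hyE.1) ρ).1 hρ _ rfl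
    have h2 := hm ρ
    rw [slack] at h1 h2
    linarith
  have h1 := hf2 _ hyE.1
  rw [hfu] at hf1 h1
  linarith

/-- Rays whose facets have a common point belong to a common maximal cone. -/
lemma exists_cone_of_slack_eq_zero {A : Finset P.Ray} {m : Fin n → ℝ} (hm : m ∈ P.body)
    (h : ∀ ρ ∈ A, P.slack ρ m = 0) : ∃ σ : P.Cone n, A ⊆ P.rays σ.1 := by
  have hsl : ∀ x : Fin n → ℝ, ∑ ρ ∈ A, P.slack ρ x =
      x ⬝ᵥ (∑ ρ ∈ A, P.rgen ρ) + ∑ ρ ∈ A, (P.const ρ : ℝ) := by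
    intro x
    simp [slack, dotProduct_sum, Finset.sum_add_distrib]
  have hmE : m ∈ P.minFace (∑ ρ ∈ A, P.rgen ρ) := by
    refine ⟨hm, fun y hy => ?_⟩
    have h1 := hsl m
    have h2 := hsl y
    rw [Finset.sum_eq_zero h] at h1
    have h3 : 0 ≤ ∑ ρ ∈ A, P.slack ρ y := Finset.sum_nonneg fun ρ _ => P.slack_nonneg ρ hy
    linarith
  obtain ⟨y, hy, hyE, hface⟩ := (P.isFace_minFace _).exists_vertex
  obtain ⟨σ, hσ⟩ := P.exists_cone_of_vertex hface
  refine ⟨σ, fun ρ hρ => ?_⟩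
  rw [hσ, P.mem_rays_iff (by simpa using hyE.1)]
  rintro x rfl
  have h0 : ∑ ρ ∈ A, P.slack ρ (latticeIncl n y) = 0 := by
    rw [hsl, P.minFace_const hyE hmE, ← hsl, Finset.sum_eq_zero h]
  exact (Finset.sum_eq_zero_iff_of_nonneg fun ρ _ => P.slack_nonneg ρ hyE.1).1 h0 ρ hρ

lemma IsFace.exists_cone_rays_subset {E : Set (Fin n → ℝ)} (hE : P.IsFace E) :
    ∃ σ : P.Cone n, P.rays (P.normalCone E) ⊆ P.rays σ.1 := by
  obtain ⟨x, hx⟩ := hE.1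
  exact exists_cone_of_slack_eq_zero (hE.subset_body hx) fun ρ hρ =>
    (P.mem_rays_iff hE.subset_body ρ).1 hρ x hx

/-- The direction space of a face is cut out by the generators of the rays of its normal cone. -/
lemma IsFace.mem_vectorSpan_iff {E : Set (Fin n → ℝ)} (hE : P.IsFace E) {w : Fin n → ℝ} :
    w ∈ vectorSpan ℝ E ↔ ∀ ρ ∈ P.rays (P.normalCone E), w ⬝ᵥ P.rgen ρ = 0 := by
  rw [hE.vectorSpan_eq, LinearMap.BilinForm.mem_orthogonal_iff]
  constructor
  · intro h ρ hρ
    rw [dotProduct_comm]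
    exact h _ (Submodule.subset_span (P.rgen_mem_of_mem_rays hρ))
  · intro h u hu
    change u ⬝ᵥ w = 0
    rw [dotProduct_comm]
    induction hu using Submodule.span_induction with
    | zero => simp
    | add a b _ _ ha hb => rw [dotProduct_add, ha, hb, add_zero]
    | smul c a _ ha => rw [dotProduct_smul, ha, smul_zero]
    | mem u hu =>
      obtain ⟨y, hy, hyE, hface⟩ := hE.exists_vertex
      have hyb := hE.subset_body hyE
      have huy : u ∈ P.normalCone {latticeIncl n y} :=
        P.normalCone_antitone (by simpa using hyE) hu
      obtain ⟨c, hc, hsum⟩ := P.normalCone_vertex_subset hyb huy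
      -- Only the rays whose facet contains all of `E` contribute to `u`.
      have hsl : ∀ x : Fin n → ℝ, x ⬝ᵥ u - latticeIncl n y ⬝ᵥ u =
          ∑ ρ ∈ P.rays (P.normalCone {latticeIncl n y}), c ρ * P.slack ρ x := by
        intro x
        rw [← sub_dotProduct, hsum, dotProduct_sum]
        refine Finset.sum_congr rfl fun ρ hρ => ?_
        have h1 := (P.mem_rays_iff (by simpa using hyb) ρ).1 hρ _ rfl
        rw [slack] at h1 ⊢
        rw [dotProduct_smul, smul_eq_mul, sub_dotProduct]
        congr 1
        linarith
      rw [hsum, dotProduct_sum]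
      refine Finset.sum_eq_zero fun ρ hρ => ?_
      rw [dotProduct_smul, smul_eq_mul]
      by_cases hρE : ρ ∈ P.rays (P.normalCone E)
      · rw [h ρ hρE, mul_zero]
      · have hcz : c ρ = 0 := by
          by_contra hcne
          apply hρE
          rw [P.mem_rays_iff hE.subset_body]
          intro x hx
          have h0 := hsl x
          rw [P.normalCone_const hE.subset_body hu hx hyE, sub_self] at h0
          have := (Finset.sum_eq_zero_iff_of_nonneg fun ρ _ =>
            mul_nonneg (hc ρ) (P.slack_nonneg ρ (hE.subset_body hx))).1 h0.symm ρ hρ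
          exact (mul_eq_zero.1 this).resolve_left hcne
        rw [hcz, zero_mul]

end LatticePolytope

/-! ### Stability of the combinatorics under small displacements of the facets -/

namespace LatticePolytope

variable {n : ℕ} {P : LatticePolytope n}

lemma exists_slack_pos (P : LatticePolytope n) :
    ∃ (p : Fin n → ℝ) (r : ℝ), 0 < r ∧ p ∈ P.body ∧ ∀ ρ, r ≤ P.slack ρ p := by
  obtain ⟨p, r, hr, hball⟩ := P.exists_sup_ball_subset
  have hpos : ∀ ρ, 0 < P.slack ρ p := by
    intro ρ
    have hu := P.rgen_ne_zero ρ
    have hn : 0 < ‖P.rgen ρ‖ := norm_pos_iff.2 hu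
    have hmem : p + (-(r / ‖P.rgen ρ‖)) • P.rgen ρ ∈ P.body := by
      apply hball
      rw [norm_smul, norm_neg, Real.norm_eq_abs, abs_of_pos (div_pos hr hn), div_mul_cancel₀ _ hn.ne']
    have h1 := P.slack_nonneg ρ hmem
    rw [slack, add_dotProduct, smul_dotProduct, smul_eq_mul] at h1
    have h2 : 0 < P.rgen ρ ⬝ᵥ P.rgen ρ := by
      refine lt_of_le_of_ne (Finset.sum_nonneg fun i _ => mul_self_nonneg _) fun h => hu ?_
      exact dotProduct_self_eq_zero.1 h.symm
    have h3 := mul_pos (div_pos hr hn) h2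
    rw [slack]
    linarith
  have hev : ∀ᶠ s : ℝ in 𝓝[>] 0, ∀ ρ, s ≤ P.slack ρ p := by
    rw [eventually_all]
    exact fun ρ => (Iic_mem_nhds (hpos ρ)) |> mem_nhdsWithin_of_mem_nhds
  obtain ⟨s, hs, hs0⟩ := (hev.and self_mem_nhdsWithin).exists
  refine ⟨p, s, hs0, ?_, hs⟩
  simpa using hball 0 (by simpa using hr.le)

lemma slack_combo (ρ : P.Ray) (p m : Fin n → ℝ) (t : ℝ) :
    P.slack ρ ((1 - t) • p + t • m) = (1 - t) * P.slack ρ p + t * P.slack ρ m := by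
  simp only [slack, add_dotProduct, smul_dotProduct, smul_eq_mul]
  ring

lemma slack_add (ρ : P.Ray) (m w : Fin n → ℝ) :
    P.slack ρ (m + w) = P.slack ρ m + w ⬝ᵥ P.rgen ρ := by
  simp only [slack, add_dotProduct]
  ring

lemma continuous_slack (ρ : P.Ray) : Continuous (P.slack ρ) := by
  unfold slack dotProduct
  fun_prop

/-- A point that nearly satisfies the facet inequalities becomes a point of the polytope when moved
slightly towards an interior point. -/
lemma combo_mem_body {p m : Fin n → ℝ} {r δ : ℝ} (hr : 0 < r) (hδ : 0 ≤ δ)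
    (hp : ∀ ρ, r ≤ P.slack ρ p) (hm : ∀ ρ, -δ ≤ P.slack ρ m) :
    (1 - r / (r + δ)) • p + (r / (r + δ)) • m ∈ P.body := by
  rw [mem_body_iff]
  intro ρ
  rw [slack_combo]
  have h1 : 1 - r / (r + δ) = δ / (r + δ) := by field_simp; ring
  rw [h1]
  have h2 : δ / (r + δ) * r ≤ δ / (r + δ) * P.slack ρ p :=
    mul_le_mul_of_nonneg_left (hp ρ) (by positivity)
  have h3 : r / (r + δ) * (-δ) ≤ r / (r + δ) * P.slack ρ m :=
    mul_le_mul_of_nonneg_left (hm ρ) (by positivity)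
  have h4 : δ / (r + δ) * r = -(r / (r + δ) * (-δ)) := by ring
  linarith

/-- A region cut out by displaced facets is bounded, since shrinking it towards an interior point
moves it into the polytope. -/
lemma exists_norm_le (P : LatticePolytope n) (δ : ℝ) (hδ : 0 ≤ δ) :
    ∃ C : ℝ, ∀ m : Fin n → ℝ, (∀ ρ, -δ ≤ P.slack ρ m) → ‖m‖ ≤ C := by
  obtain ⟨p, r, hr, -, hslack⟩ := P.exists_slack_pos
  obtain ⟨B, hB⟩ := P.isCompact_body.isBounded.exists_norm_le
  refine ⟨(r / (r + δ))⁻¹ * (B + |1 - r / (r + δ)| * ‖p‖), fun m hm => ?_⟩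
  set t := r / (r + δ) with ht
  have ht0 : 0 < t := by positivity
  have h1 := hB _ (combo_mem_body hr hδ hslack hm)
  have h2 : m = t⁻¹ • (((1 - t) • p + t • m) - (1 - t) • p) := by
    rw [add_sub_cancel_left, smul_smul, inv_mul_cancel₀ ht0.ne', one_smul]
  rw [h2, norm_smul, Real.norm_eq_abs, abs_of_pos (inv_pos.2 ht0)]
  refine mul_le_mul_of_nonneg_left ?_ (inv_pos.2 ht0).le
  refine (norm_sub_le _ _).trans (add_le_add h1 ?_)
  rw [norm_smul, Real.norm_eq_abs]

/-- Facets without a common vertex have no common point, so by compactness no point is close to all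
of them. -/
lemma eventually_exists_slack_gt (A : Finset P.Ray) (hA : ∀ σ : P.Cone n, ¬ A ⊆ P.rays σ.1) :
    ∀ᶠ δ : ℝ in 𝓝[>] 0, ∀ m : Fin n → ℝ, (∀ ρ, -δ ≤ P.slack ρ m) → ∃ ρ ∈ A, δ < P.slack ρ m := by
  obtain ⟨p, r, hr, hpb, hslack⟩ := P.exists_slack_pos
  have hcont : Continuous fun x => ∑ ρ ∈ A, P.slack ρ x :=
    continuous_finsetSum _ fun ρ _ => continuous_slack ρ
  obtain ⟨x₀, hx₀, hmin⟩ := P.isCompact_body.exists_isMinOn ⟨p, hpb⟩ hcont.continuousOn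
  set η := ∑ ρ ∈ A, P.slack ρ x₀ with hη
  have hηpos : 0 < η := by
    refine lt_of_le_of_ne (Finset.sum_nonneg fun ρ _ => P.slack_nonneg ρ hx₀) fun h => ?_
    obtain ⟨σ, hσ⟩ := exists_cone_of_slack_eq_zero hx₀ (A := A)
      ((Finset.sum_eq_zero_iff_of_nonneg fun ρ _ => P.slack_nonneg ρ hx₀).1 h.symm)
    exact hA σ hσ
  set g := ∑ ρ ∈ A, P.slack ρ p with hg
  have hg0 : 0 ≤ g := Finset.sum_nonneg fun ρ _ => P.slack_nonneg ρ hpb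
  have hlim : Tendsto (fun δ : ℝ => δ * (g / r + A.card)) (𝓝[>] 0) (𝓝 0) := by
    have : Continuous fun δ : ℝ => δ * (g / r + A.card) := by fun_prop
    have h := this.tendsto 0
    rw [zero_mul] at h
    exact h.mono_left nhdsWithin_le_nhds
  filter_upwards [hlim.eventually (Iio_mem_nhds hηpos), self_mem_nhdsWithin] with δ hδ hδ0 m hm
  have hδ0' : 0 < δ := hδ0
  by_contra hcon
  push Not at hcon
  have h1 : η ≤ _ := hmin (combo_mem_body hr hδ0'.le hslack hm)
  simp only [slack_combo, Finset.sum_add_distrib, ← Finset.mul_sum] at h1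
  rw [← hg] at h1
  have h2 : ∑ ρ ∈ A, P.slack ρ m ≤ A.card * δ := by
    simpa using Finset.sum_le_sum hcon
  have h3 : r / (r + δ) ≤ 1 := by
    rw [div_le_one (by positivity)]; linarith
  have h4 : 1 - r / (r + δ) ≤ δ / r := by
    have : 1 - r / (r + δ) = δ / (r + δ) := by field_simp; ring
    rw [this]
    exact div_le_div_of_nonneg_left hδ0'.le hr (by linarith)
  have h5 : (1 - r / (r + δ)) * g ≤ δ / r * g := mul_le_mul_of_nonneg_right h4 hg0
  have h6 : r / (r + δ) * ∑ ρ ∈ A, P.slack ρ m ≤ A.card * δ := by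
    calc r / (r + δ) * ∑ ρ ∈ A, P.slack ρ m ≤ r / (r + δ) * (A.card * δ) :=
          mul_le_mul_of_nonneg_left h2 (by positivity)
      _ ≤ 1 * (A.card * δ) := mul_le_mul_of_nonneg_right h3 (by positivity)
      _ = _ := one_mul _
  have h7 : δ * (g / r + A.card) = δ / r * g + A.card * δ := by ring
  have hδ' : δ * (g / r + A.card) < η := hδ
  linarith

lemma IsSimple.eq_vertex_add (hP : P.IsSimple) (σ : P.Cone n) (m : Fin n → ℝ) :
    m = P.rvertex σ + ∑ ρ ∈ P.rays σ.1, P.slack ρ m • P.edge σ ρ := by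
  have h1 := (hP.edge_spec σ).2.2 (m - P.rvertex σ)
  rw [← sub_eq_iff_eq_add', h1]
  refine Finset.sum_congr rfl fun ρ hρ => ?_
  have h2 := (P.mem_rays_cone_iff σ ρ).1 hρ
  rw [slack] at h2 ⊢
  congr 1
  rw [sub_dotProduct]
  linarith

/-- The points close to all facets at a vertex are close to the vertex. -/
lemma IsSimple.eventually_slack_gt (hP : P.IsSimple) (σ : P.Cone n) (ρ' : P.Ray)
    (hρ' : ρ' ∉ P.rays σ.1) : ∀ᶠ δ : ℝ in 𝓝[>] 0, ∀ m : Fin n → ℝ,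
      (∀ ρ ∈ P.rays σ.1, |P.slack ρ m| ≤ δ) → δ < P.slack ρ' m := by
  have hpos : 0 < P.slack ρ' (P.rvertex σ) :=
    lt_of_le_of_ne (P.slack_nonneg ρ' (P.vertex_mem_body σ))
      fun h => hρ' ((P.mem_rays_cone_iff σ ρ').2 h.symm)
  set K := ∑ ρ ∈ P.rays σ.1, |P.edge σ ρ ⬝ᵥ P.rgen ρ'| with hK
  have hlim : Tendsto (fun δ : ℝ => δ * (1 + K)) (𝓝[>] 0) (𝓝 0) := by
    have : Continuous fun δ : ℝ => δ * (1 + K) := by fun_prop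
    have h := this.tendsto 0
    rw [zero_mul] at h
    exact h.mono_left nhdsWithin_le_nhds
  filter_upwards [hlim.eventually (Iio_mem_nhds hpos)] with δ hδ m hm
  have hδ' : δ * (1 + K) < P.slack ρ' (P.rvertex σ) := hδ
  rw [hP.eq_vertex_add σ m, slack_add, sum_dotProduct]
  have h1 : |∑ ρ ∈ P.rays σ.1, (P.slack ρ m • P.edge σ ρ) ⬝ᵥ P.rgen ρ'| ≤ δ * K := by
    rw [hK, Finset.mul_sum]
    refine (Finset.abs_sum_le_sum_abs _ _).trans (Finset.sum_le_sum fun ρ hρ => ?_)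
    rw [smul_dotProduct, smul_eq_mul, abs_mul]
    exact mul_le_mul_of_nonneg_right (hm ρ hρ) (abs_nonneg _)
  have h2 := neg_le_of_abs_le h1
  linarith

/-- A tolerance `δ` within which the combinatorics of the facet inequalities does not change: points
violating the inequalities by at most `δ` can only be `δ`-close to facets that meet in a vertex,
and points `δ`-close to all facets at a vertex satisfy the remaining inequalities strictly. -/
structure IsTolerance (P : LatticePolytope n) (δ : ℝ) : Prop where
  pos : 0 < δ
  not_close : ∀ A : Finset P.Ray, (∀ σ : P.Cone n, ¬ A ⊆ P.rays σ.1) → ∀ m : Fin n → ℝ,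
    (∀ ρ, -δ ≤ P.slack ρ m) → ∃ ρ ∈ A, δ < P.slack ρ m
  near_vertex : ∀ (σ : P.Cone n) (m : Fin n → ℝ), (∀ ρ ∈ P.rays σ.1, |P.slack ρ m| ≤ δ) →
    ∀ ρ ∉ P.rays σ.1, δ < P.slack ρ m

lemma IsSimple.exists_isTolerance (hP : P.IsSimple) : ∃ δ, P.IsTolerance δ := by
  have h1 : ∀ᶠ δ : ℝ in 𝓝[>] 0, ∀ A : Finset P.Ray, (∀ σ : P.Cone n, ¬ A ⊆ P.rays σ.1) →
      ∀ m : Fin n → ℝ, (∀ ρ, -δ ≤ P.slack ρ m) → ∃ ρ ∈ A, δ < P.slack ρ m := by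
    rw [eventually_all]
    intro A
    by_cases hA : ∀ σ : P.Cone n, ¬ A ⊆ P.rays σ.1
    · filter_upwards [eventually_exists_slack_gt A hA] with δ h _ using h
    · exact Eventually.of_forall fun _ h => absurd h hA
  have h2 : ∀ᶠ δ : ℝ in 𝓝[>] 0, ∀ (σ : P.Cone n) (ρ : P.Ray), ρ ∉ P.rays σ.1 →
      ∀ (m : Fin n → ℝ), (∀ ρ ∈ P.rays σ.1, |P.slack ρ m| ≤ δ) → δ < P.slack ρ m := by
    rw [eventually_all]
    intro σ
    rw [eventually_all]
    intro ρ
    by_cases hρ : ρ ∈ P.rays σ.1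
    · exact Eventually.of_forall fun _ h => absurd hρ h
    · filter_upwards [hP.eventually_slack_gt σ ρ hρ] with δ h _ using h
  obtain ⟨δ, ⟨h1, h2⟩, h3⟩ := ((h1.and h2).and self_mem_nhdsWithin).exists
  exact ⟨δ, h3, h1, fun σ m hm ρ hρ => h2 σ ρ hρ m hm⟩

end LatticePolytope

/-! ### Lattice coordinates and Lebesgue measure -/

section LatticeCoordinates

variable {n : ℕ} {A : Type*}

/-- The map `M → ℤ^A` given by pairing with a family of vectors of `N`. -/
def pairHom (u : A → Fin n → ℤ) : (Fin n → ℤ) →+ (A → ℤ) where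
  toFun m a := m ⬝ᵥ u a
  map_zero' := by ext; simp
  map_add' x y := by ext; simp [add_dotProduct]

@[simp] lemma pairHom_apply (u : A → Fin n → ℤ) (m : Fin n → ℤ) (a : A) :
    pairHom u m a = m ⬝ᵥ u a := rfl

variable [Fintype A] [DecidableEq A]

/-- An independent family of integral vectors has an integral dual family, up to a common
denominator: the rows of the adjugate of the Gram matrix give one. -/
lemma exists_int_dual {u : A → Fin n → ℤ} (hu : LinearIndependent ℤ u) :
    ∃ k : ℕ, 0 < k ∧ ∃ m : A → Fin n → ℤ, ∀ a a', m a ⬝ᵥ u a' = if a = a' then (k : ℤ) else 0 := by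
  let G : Matrix A A ℤ := fun a a' => u a ⬝ᵥ u a'
  have hG : G.det ≠ 0 := by
    intro h0
    obtain ⟨v, hv, hGv⟩ := Matrix.exists_mulVec_eq_zero_iff.2 h0
    have h1 : (∑ a, v a • u a) ⬝ᵥ (∑ a, v a • u a) = 0 := by
      rw [sum_dotProduct]
      refine Finset.sum_eq_zero fun a _ => ?_
      have h2 : u a ⬝ᵥ (∑ a', v a' • u a') = G.mulVec v a := by
        simp only [dotProduct_sum, dotProduct_smul, Matrix.mulVec, smul_eq_mul]
        refine Finset.sum_congr rfl fun a' _ => ?_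
        simp only [G]
        ring
      rw [smul_dotProduct, h2, hGv]
      simp
    have h2 := dotProduct_self_eq_zero.1 h1
    exact hv (funext (Fintype.linearIndependent_iff.1 hu v h2))
  have hadj : ∀ a a', (∑ c, G.adjugate a c • u c) ⬝ᵥ u a' = if a = a' then G.det else 0 := by
    intro a a'
    have h1 : (G.adjugate * G) a a' = if a = a' then G.det else 0 := by
      rw [Matrix.adjugate_mul, Matrix.smul_apply, Matrix.one_apply]
      split_ifs <;> simp
    rw [← h1, sum_dotProduct, Matrix.mul_apply]
    simp only [smul_dotProduct, smul_eq_mul, G]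
  refine ⟨G.det.natAbs, Int.natAbs_pos.2 hG, ?_⟩
  rcases Int.natAbs_eq G.det with h | h
  · refine ⟨fun a => ∑ c, G.adjugate a c • u c, fun a a' => ?_⟩
    rw [hadj, ← h]
  · refine ⟨fun a => -∑ c, G.adjugate a c • u c, fun a a' => ?_⟩
    rw [neg_dotProduct, hadj]
    split_ifs <;> omega

/-- The image of `M` in `ℤ^A` contains a multiple of `ℤ^A`, so its index is positive. -/
lemma pairHom_index_ne_zero {u : A → Fin n → ℤ} (hu : LinearIndependent ℤ u) :
    (pairHom u).range.index ≠ 0 := by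
  obtain ⟨k, hk, m, hm⟩ := exists_int_dual hu
  have hle : (nsmulAddMonoidHom (α := A → ℤ) k).range ≤ (pairHom u).range := by
    rintro _ ⟨y, rfl⟩
    refine ⟨∑ a, y a • m a, ?_⟩
    ext a'
    simp only [pairHom_apply, sum_dotProduct, smul_dotProduct, hm, smul_eq_mul,
      nsmulAddMonoidHom_apply, Pi.smul_apply]
    simp [mul_comm]
  have h := AddSubgroup.relIndex_mul_index hle
  rw [AddSubgroup.index_range_nsmul] at h
  intro h0
  rw [h0, mul_zero] at h
  exact (pow_pos hk _).ne h

/-- Coordinates on `M_ℝ` adapted to an independent family `u` of vectors of `N`: a basis `b` of the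
sublattice of `M` orthogonal to the family, together with vectors `e` dual to the family.  In these
coordinates Lebesgue measure is multiplied by the index of the image of `M` in `ℤ^A`. -/
theorem exists_lattice_coordinates {u : A → Fin n → ℤ} (hu : LinearIndependent ℤ u)
    {L : Submodule ℤ (Fin n → ℤ)} (hL : ∀ m, m ∈ L ↔ ∀ a, m ⬝ᵥ u a = 0)
    {I : Type*} [Fintype I] (b : Module.Basis I ℤ L) :
    ∃ (e : A → Fin n → ℝ) (Φ : ((I → ℝ) × (A → ℝ)) →ₗ[ℝ] (Fin n → ℝ)),
      (∀ a a', e a ⬝ᵥ latticeIncl n (u a') = if a = a' then 1 else 0) ∧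
      (∀ x, Φ x = ∑ i, x.1 i • latticeIncl n (b i) + ∑ a, x.2 a • e a) ∧
      Function.Injective Φ ∧
      Measure.map Φ volume = ((pairHom u).range.index : ENNReal) • volume := by
  classical
  obtain ⟨k, hk, m, hm⟩ := exists_int_dual hu
  have hkR : (0 : ℝ) < k := by exact_mod_cast hk
  -- the sublattice of `M` spanned by `b` and by the multiples `m` of the dual vectors
  let N' : AddSubgroup (Fin n → ℤ) := (nsmulAddMonoidHom (α := A → ℤ) k).range.comap (pairHom u)
  have hN' : ∀ x, x ∈ N' ↔ ∃ y : A → ℤ, k • y = pairHom u x := fun x => Iff.rfl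
  have hle : (nsmulAddMonoidHom (α := A → ℤ) k).range ≤ (pairHom u).range := by
    rintro _ ⟨y, rfl⟩
    refine ⟨∑ a, y a • m a, ?_⟩
    ext a'
    simp only [pairHom_apply, sum_dotProduct, smul_dotProduct, hm, smul_eq_mul,
      nsmulAddMonoidHom_apply, Pi.smul_apply]
    simp [mul_comm]
  have hindex : N'.index * (pairHom u).range.index = k ^ Fintype.card A := by
    rw [AddSubgroup.index_comap, AddSubgroup.relIndex_mul_index hle,
      AddSubgroup.index_range_nsmul, Module.finrank_fintype_fun_eq_card]
  let c : I ⊕ A → Fin n → ℤ := Sum.elim (fun i => (b i : Fin n → ℤ)) m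
  have hcN : ∀ j, c j ∈ N' := by
    rintro (i | a)
    · refine (hN' _).2 ⟨0, ?_⟩
      ext a
      simpa [c] using ((hL _).1 (b i).2 a).symm
    · refine (hN' _).2 ⟨Pi.single a 1, ?_⟩
      ext a'
      simp only [c, Sum.elim_inr, pairHom_apply, hm, Pi.smul_apply, Pi.single_apply, eq_comm]
      split_ifs <;> simp
  have hdot : ∀ (x : I ⊕ A → ℤ) a, (∑ j, x j • c j) ⬝ᵥ u a = k * x (Sum.inr a) := by
    intro x a
    rw [sum_dotProduct, Fintype.sum_sum_type, Finset.sum_eq_zero, zero_add]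
    · simp only [c, Sum.elim_inr, smul_dotProduct, hm]
      simp [mul_comm]
    · intro i _
      rw [smul_dotProduct]
      simp only [c, Sum.elim_inl]
      rw [(hL _).1 (b i).2 a, smul_zero]
  have hli : LinearIndependent ℤ (fun j => (⟨c j, hcN j⟩ : N')) := by
    rw [Fintype.linearIndependent_iff]
    intro x hx
    have hx' : ∑ j, x j • c j = 0 := by
      have := congrArg (Subtype.val) hx
      simpa [AddSubgroup.val_finsetSum] using this
    have h1 : ∀ a, x (Sum.inr a) = 0 := by
      intro a
      have := hdot x a
      rw [hx', zero_dotProduct] at this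
      have hk' : (k : ℤ) ≠ 0 := by exact_mod_cast hk.ne'
      exact (mul_eq_zero.1 this.symm).resolve_left hk'
    have h2 : ∑ i, x (Sum.inl i) • b i = 0 := by
      rw [Fintype.sum_sum_type] at hx'
      simp only [h1, zero_smul, Finset.sum_const_zero, add_zero] at hx'
      apply Subtype.ext
      simpa [c] using hx'
    have h3 := Fintype.linearIndependent_iff.1 b.linearIndependent _ h2
    rintro (i | a)
    · exact h3 i
    · exact h1 a
  have hsp : ⊤ ≤ Submodule.span ℤ (Set.range fun j => (⟨c j, hcN j⟩ : N')) := by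
    rintro ⟨x, hx⟩ -
    obtain ⟨y, hy⟩ := (hN' x).1 hx
    have hmem : x - ∑ a, y a • m a ∈ L := by
      rw [hL]
      intro a
      have h1 := congrFun hy a
      rw [sub_dotProduct, sum_dotProduct]
      simp only [smul_dotProduct, hm, pairHom_apply, Pi.smul_apply] at h1 ⊢
      rw [← h1]
      simp [mul_comm]
    rw [Submodule.mem_span_range_iff_exists_fun]
    refine ⟨Sum.elim (fun i => b.repr ⟨_, hmem⟩ i) y, ?_⟩
    apply Subtype.ext
    have h2 := congrArg L.subtype (b.sum_repr ⟨_, hmem⟩)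
    have h3 : ∑ i, b.repr ⟨_, hmem⟩ i • (b i : Fin n → ℤ) = x - ∑ a, y a • m a := by
      simpa only [map_sum, map_smul, Submodule.subtype_apply] using h2
    rw [AddSubgroup.val_finsetSum, Fintype.sum_sum_type]
    simp only [Sum.elim_inl, Sum.elim_inr, c]
    change ∑ i, b.repr ⟨_, hmem⟩ i • (b i : Fin n → ℤ) + ∑ a, y a • m a = x
    rw [h3, sub_add_cancel]
  let bN : Module.Basis (I ⊕ A) ℤ N' := Module.Basis.mk hli hsp
  have hidx0 : N'.index ≠ 0 := by
    intro h0
    rw [h0, zero_mul] at hindex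
    exact (pow_pos hk _).ne hindex
  have : N'.FiniteIndex := ⟨hidx0⟩
  have hcard : Fintype.card (I ⊕ A) = n := by
    rw [← Module.finrank_eq_card_basis bN, AddSubgroup.finrank_eq_of_finiteIndex]
    simp
  let ε : I ⊕ A ≃ Fin n := Fintype.equivFinOfCardEq hcard
  let Mz : Matrix (Fin n) (Fin n) ℤ := fun i j => c (ε.symm j) i
  have hdet : N'.index = Mz.det.natAbs := by
    rw [AddSubgroup.index_eq_natAbs_det (Pi.basisFun ℤ (Fin n)) N' (bN.reindex ε),
      Module.Basis.det_apply]
    congr 2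
    ext i j
    simp [Module.Basis.toMatrix_apply, Mz, bN]
  let w : Fin n → ℝ := fun j => Sum.elim (fun _ => 1) (fun _ => (k : ℝ)⁻¹) (ε.symm j)
  let Mr : Matrix (Fin n) (Fin n) ℝ := fun i j => w j * (Mz i j : ℝ)
  have hw : ∏ j, w j = ((k : ℝ) ^ Fintype.card A)⁻¹ := by
    simp only [w]
    rw [ε.symm.prod_comp (fun j => (Sum.elim (fun _ => (1 : ℝ)) (fun _ => (k : ℝ)⁻¹) j))]
    simp [Fintype.prod_sum_type]
  have hMr : Mr.det = ((k : ℝ) ^ Fintype.card A)⁻¹ * (Mz.det : ℝ) := by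
    have h1 : ((Mz.map (Int.castRingHom ℝ)).det) = (Mz.det : ℝ) := by
      rw [← RingHom.mapMatrix_apply, ← RingHom.map_det]
      simp
    have h2 := Matrix.det_mul_row w (Mz.map (Int.castRingHom ℝ))
    rw [hw, h1] at h2
    rw [← h2]
    rfl
  have hMr0 : Mr.det ≠ 0 := by
    rw [hMr]
    refine mul_ne_zero (inv_ne_zero (by positivity)) ?_
    have : Mz.det ≠ 0 := by
      intro h0
      rw [h0] at hdet
      exact hidx0 hdet
    exact_mod_cast this
  have habs : |Mr.det⁻¹| = ((pairHom u).range.index : ℝ) := by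
    rw [hMr, abs_inv, abs_mul, abs_inv, abs_of_pos (show (0 : ℝ) < (k : ℝ) ^ Fintype.card A by
      positivity)]
    have h1 : |(Mz.det : ℝ)| = (N'.index : ℝ) := by
      rw [hdet, Nat.cast_natAbs]
      push_cast
      rfl
    have h2 : (k : ℝ) ^ Fintype.card A = N'.index * (pairHom u).range.index := by
      rw [← Nat.cast_mul, hindex]
      push_cast
      rfl
    have h3 : (N'.index : ℝ) ≠ 0 := by exact_mod_cast hidx0
    rw [h1, h2]
    have h4 : ((pairHom u).range.index : ℝ) ≠ 0 := by
      exact_mod_cast pairHom_index_ne_zero hu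
    field_simp
  -- assemble the coordinate map from the reindexing equivalences and the matrix
  let e : A → Fin n → ℝ := fun a => (k : ℝ)⁻¹ • latticeIncl n (m a)
  let Φ : ((I → ℝ) × (A → ℝ)) →ₗ[ℝ] (Fin n → ℝ) :=
    (LinearMap.coprod (∑ i, (LinearMap.proj i).smulRight (latticeIncl n (b i)))
      (∑ a, (LinearMap.proj a).smulRight (e a)))
  have hΦ : ∀ x, Φ x = ∑ i, x.1 i • latticeIncl n (b i) + ∑ a, x.2 a • e a := by
    intro x
    simp [Φ]
  have hcomp : (Φ : ((I → ℝ) × (A → ℝ)) → (Fin n → ℝ)) = Matrix.toLin' Mr ∘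
      (MeasurableEquiv.piCongrLeft (fun _ => ℝ) ε) ∘
        (MeasurableEquiv.sumPiEquivProdPi (fun _ : I ⊕ A => ℝ)).symm := by
    ext x i
    rw [hΦ]
    have h1 : ∀ y : I ⊕ A → ℝ, ∀ j, (MeasurableEquiv.piCongrLeft (fun _ => ℝ) ε) y j
        = y (ε.symm j) := by
      intro y j
      have := Equiv.piCongrLeft_apply_apply (fun _ => ℝ) ε y (ε.symm j)
      rwa [Equiv.apply_symm_apply] at this
    have h2 : ∀ y i, Matrix.toLin' Mr y i = ∑ j, w j * (Mz i j : ℝ) * y j := by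
      intro y i
      rw [Matrix.toLin'_apply]
      rfl
    rw [Function.comp_apply, Function.comp_apply, h2]
    simp only [h1, w, Mz]
    rw [ε.symm.sum_comp (fun j => (Sum.elim (fun _ => (1 : ℝ)) (fun _ => (k : ℝ)⁻¹) j) *
      ((c j i : ℤ) : ℝ) * (MeasurableEquiv.sumPiEquivProdPi (fun _ : I ⊕ A => ℝ)).symm x j),
      Fintype.sum_sum_type]
    simp only [Pi.add_apply, Finset.sum_apply, Pi.smul_apply, latticeIncl_apply, smul_eq_mul, e, c,
      Sum.elim_inl, Sum.elim_inr, one_mul]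
    congr 1
    · refine Finset.sum_congr rfl fun i _ => ?_
      rw [mul_comm]
      rfl
    · refine Finset.sum_congr rfl fun i _ => ?_
      rw [mul_comm]
      rfl
  refine ⟨e, Φ, ?_, hΦ, ?_, ?_⟩
  · intro a a'
    simp only [e, smul_dotProduct, latticeIncl_dotProduct, hm, smul_eq_mul]
    split_ifs
    · rw [Int.cast_natCast, inv_mul_cancel₀ hkR.ne']
    · simp
  · rw [hcomp]
    refine Function.Injective.comp ?_ ((MeasurableEquiv.injective _).comp
      (MeasurableEquiv.injective _))
    exact Matrix.mulVec_injective_iff_isUnit.2 ((Matrix.isUnit_iff_isUnit_det _).2 hMr0.isUnit)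
  · have hmeas : Measurable (Matrix.toLin' Mr : (Fin n → ℝ) → (Fin n → ℝ)) :=
      (LinearMap.continuous_of_finiteDimensional _).measurable
    rw [hcomp, ← Measure.map_map hmeas ((MeasurableEquiv.measurable _).comp
      (MeasurableEquiv.measurable _)), ← Measure.map_map (MeasurableEquiv.measurable _)
      (MeasurableEquiv.measurable _),
      (volume_measurePreserving_sumPiEquivProdPi_symm (fun _ : I ⊕ A => ℝ)).map_eq,
      (volume_measurePreserving_piCongrLeft (fun _ => ℝ) ε).map_eq,
      Real.map_matrix_volume_pi_eq_smul_volume_pi hMr0, habs]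
    simp

end LatticeCoordinates

/-! ### The multiplicity of a cone as a lattice index -/

section Multiplicity

variable {n : ℕ} {A : Type*} [Fintype A]

/-- The character of `ℤ^A` with values `t` on the standard basis. -/
def powHom (t : A → ℂˣ) : (A → ℤ) →+ Additive ℂˣ where
  toFun y := Additive.ofMul (∏ a, t a ^ y a)
  map_zero' := by simp
  map_add' x y := by
    rw [← ofMul_mul, ← Finset.prod_mul_distrib]
    simp [zpow_add]

lemma powHom_apply (t : A → ℂˣ) (y : A → ℤ) : (powHom t y).toMul = ∏ a, t a ^ y a := rfl

lemma powHom_single [DecidableEq A] (t : A → ℂˣ) (a : A) : (powHom t (Pi.single a 1)).toMul = t a := by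
  rw [powHom_apply, Finset.prod_eq_single a]
  · simp
  · intro b _ hb; simp [hb]
  · simp

lemma range_le_ker_powHom {u : A → Fin n → ℤ} {t : A → ℂˣ} (ht : ∀ i, ∏ a, t a ^ u a i = 1) :
    (pairHom u).range ≤ (powHom t).ker := by
  rintro _ ⟨m, rfl⟩
  rw [AddMonoidHom.mem_ker]
  apply Additive.toMul.injective
  rw [powHom_apply, toMul_zero]
  have h1 : ∀ a, t a ^ pairHom u m a = ∏ i, (t a ^ u a i) ^ m i := by
    intro a
    rw [pairHom_apply, dotProduct]
    have h2 : ∀ s : Finset (Fin n), t a ^ (∑ i ∈ s, m i * u a i) = ∏ i ∈ s, (t a ^ u a i) ^ m i := by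
      intro s
      induction s using Finset.induction_on with
      | empty => simp
      | insert i s hi ih =>
        rw [Finset.sum_insert hi, Finset.prod_insert hi, zpow_add, ih, mul_comm (m i), zpow_mul]
    exact h2 Finset.univ
  simp only [h1]
  rw [Finset.prod_comm]
  refine Finset.prod_eq_one fun i _ => ?_
  rw [Finset.prod_zpow, ht i, one_zpow]

/-- The kernel of the homomorphism of tori given by `u` is the group of characters of the cokernel of
the transposed map of lattices, so it has as many elements as this cokernel. -/
theorem card_torus_ker [DecidableEq A] {u : A → Fin n → ℤ} (hu : LinearIndependent ℤ u) :
    Nat.card {t : A → ℂˣ // ∀ i, ∏ a, t a ^ u a i = 1} = (pairHom u).range.index := by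
  have hfin : Finite ((A → ℤ) ⧸ (pairHom u).range) :=
    have : (pairHom u).range.FiniteIndex := ⟨pairHom_index_ne_zero hu⟩
    AddSubgroup.finite_quotient_of_finiteIndex
  have := Fintype.ofFinite ((A → ℤ) ⧸ (pairHom u).range)
  let F : {t : A → ℂˣ // ∀ i, ∏ a, t a ^ u a i = 1} → AddChar ((A → ℤ) ⧸ (pairHom u).range) ℂ :=
    fun t => 
      { toFun := fun q =>
          ((QuotientAddGroup.lift _ (powHom t.1) (range_le_ker_powHom t.2) q).toMul : ℂˣ)
        map_zero_eq_one' := by simp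
        map_add_eq_mul' := fun x y => by simp }
  have hF : ∀ t y, F t (QuotientAddGroup.mk y) = ((∏ a, t.1 a ^ y a : ℂˣ) : ℂ) := fun t y => rfl
  have hbij : Function.Bijective F := by
    constructor
    · intro t s hts
      apply Subtype.ext
      funext a
      have h1 := DFunLike.congr_fun hts (QuotientAddGroup.mk (Pi.single a 1))
      rw [hF, hF] at h1
      have h2 := Units.ext h1
      rwa [← powHom_apply, ← powHom_apply, powHom_single, powHom_single] at h2
    · intro ψ
      have hne : ∀ q, ψ q ≠ 0 := by
        intro q h0
        have h1 := ψ.map_add_eq_mul q (-q)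
        rw [add_neg_cancel, ψ.map_zero_eq_one, h0, zero_mul] at h1
        exact one_ne_zero h1
      let t : A → ℂˣ := fun a => Units.mk0 _ (hne (QuotientAddGroup.mk (Pi.single a 1)))
      have ht : ∀ y : A → ℤ, ((∏ a, t a ^ y a : ℂˣ) : ℂ) = ψ (QuotientAddGroup.mk y) := by
        intro y
        have h1 : y = ∑ a, y a • (Pi.single a 1 : A → ℤ) := by
          ext b
          simp [Finset.sum_apply, Pi.single_apply]
        conv_rhs => rw [h1]
        have h2 : (QuotientAddGroup.mk (∑ a, y a • (Pi.single a 1 : A → ℤ)) :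
            (A → ℤ) ⧸ (pairHom u).range) =
            ∑ a, y a • QuotientAddGroup.mk (Pi.single a 1 : A → ℤ) := by
          rw [← QuotientAddGroup.mk'_apply, map_sum]
          simp
        have h3 : ∀ (s : Finset A) (f : A → (A → ℤ) ⧸ (pairHom u).range),
            ψ (∑ a ∈ s, f a) = ∏ a ∈ s, ψ (f a) := by
          intro s f
          induction s using Finset.induction_on with
          | empty => simp
          | insert a s ha ih =>
            rw [Finset.sum_insert ha, Finset.prod_insert ha, ψ.map_add_eq_mul, ih]
        rw [h2, h3]
        simp [t, AddChar.map_zsmul_eq_zpow]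
      refine ⟨⟨t, fun i => ?_⟩, ?_⟩
      · apply Units.ext
        have h1 := ht (pairHom u (Pi.single i 1))
        have h2 : (QuotientAddGroup.mk (pairHom u (Pi.single i 1)) :
            (A → ℤ) ⧸ (pairHom u).range) = 0 :=
          (QuotientAddGroup.eq_zero_iff _).2 ⟨_, rfl⟩
        rw [h2, ψ.map_zero_eq_one] at h1
        simpa using h1
      · ext q
        induction q using QuotientAddGroup.induction_on with
        | H y => rw [hF, ht]
  rw [Nat.card_congr (Equiv.ofBijective F hbij), Nat.card_eq_fintype_card, AddChar.card_eq,
    AddSubgroup.index_eq_card, Nat.card_eq_fintype_card]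

end Multiplicity

namespace LatticePolytope

variable {n : ℕ} {P : LatticePolytope n}

/-- The generators of the rays in a set, as a family indexed by these rays. -/
noncomputable abbrev genFamily (P : LatticePolytope n) (A : Finset P.Ray) : A → Fin n → ℤ :=
  fun ρ => P.gen ρ.1

/-- The multiplicity is the index of the image of `M` in `ℤ^{σ(1)}`: the torus kernel is the
character group of the cokernel. -/
lemma mult_eq_index {σ : Set (Fin n → ℝ)} (h : LinearIndependent ℤ (P.genFamily (P.rays σ))) :
    P.mult σ = (pairHom (P.genFamily (P.rays σ))).range.index := by
  classical
  rw [← card_torus_ker h, mult]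
  refine Nat.card_congr (Equiv.subtypeEquivRight fun t => ?_)
  rw [MonoidHom.mem_ker, funext_iff]
  rfl

lemma IsSimple.linearIndependent_gen (hP : P.IsSimple) {σ : P.Cone n} {A : Finset P.Ray}
    (hA : A ⊆ P.rays σ.1) : LinearIndependent ℤ (P.genFamily A) := by
  classical
  rw [Fintype.linearIndependent_iff]
  intro c hc ρ
  have h1 : ∑ ρ' : A, (c ρ' : ℝ) • P.rgen ρ'.1 = 0 := by
    have := congrArg (latticeIncl n) hc
    rw [map_sum, map_zero] at this
    rw [← this]
    refine Finset.sum_congr rfl fun ρ' _ => ?_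
    rw [map_smul]
    ext i
    simp
  have h2 := congrArg (fun x => P.edge σ ρ.1 ⬝ᵥ x) h1
  simp only [dotProduct_sum, dotProduct_smul, dotProduct_zero] at h2
  rw [Finset.sum_eq_single ρ] at h2
  · rw [(hP.edge_spec σ).2.1 _ (hA ρ.2) _ (hA ρ.2)] at h2
    simpa using h2
  · intro ρ' _ hne
    rw [(hP.edge_spec σ).2.1 _ (hA ρ.2) _ (hA ρ'.2), if_neg, smul_zero]
    exact fun h => hne (Subtype.ext h.symm)
  · simp

lemma IsSimple.mult_ne_zero (hP : P.IsSimple) {σ : P.Cone n} {τ : Set (Fin n → ℝ)}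
    (h : P.rays τ ⊆ P.rays σ.1) : P.mult τ ≠ 0 := by
  classical
  rw [mult_eq_index (hP.linearIndependent_gen h)]
  exact pairHom_index_ne_zero (hP.linearIndependent_gen h)

end LatticePolytope

/-! ### Mixed differences of the exponential integral -/

section Pairing

variable {n : ℕ}

lemma cpair_add (a b : Fin n → ℝ) (z : Fin n → ℂ) : cpair (a + b) z = cpair a z + cpair b z := by
  simp [cpair, add_mul, Finset.sum_add_distrib]

lemma cpair_smul (c : ℝ) (a : Fin n → ℝ) (z : Fin n → ℂ) : cpair (c • a) z = c * cpair a z := by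
  simp [cpair, Finset.mul_sum, mul_assoc]

lemma cpair_zero (z : Fin n → ℂ) : cpair 0 z = 0 := by simp [cpair]

lemma cpair_sum {ι : Type*} (s : Finset ι) (f : ι → Fin n → ℝ) (z : Fin n → ℂ) :
    cpair (∑ i ∈ s, f i) z = ∑ i ∈ s, cpair (f i) z := by
  classical
  induction s using Finset.induction_on with
  | empty => simp [cpair_zero]
  | insert a s ha ih => rw [Finset.sum_insert ha, Finset.sum_insert ha, cpair_add, ih]

lemma continuous_cpair (z : Fin n → ℂ) : Continuous fun m : Fin n → ℝ => cpair m z := by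
  unfold cpair
  fun_prop

lemma integral_comp_of_map_eq {I A : Type*} [Fintype I] [Fintype A]
    {Φ : ((I → ℝ) × (A → ℝ)) →ₗ[ℝ] (Fin n → ℝ)} (hΦ : Function.Injective Φ) {c : ℕ}
    (hmap : Measure.map Φ volume = (c : ENNReal) • volume) (p : Fin n → ℝ) (g : (Fin n → ℝ) → ℂ) :
    ∫ x, g (p + Φ x) = c * ∫ m, g m := by
  have hcont : Continuous Φ := LinearMap.continuous_of_finiteDimensional Φ
  have hemb : MeasurableEmbedding Φ := hcont.measurableEmbedding hΦ
  have h1 := hemb.integral_map (μ := volume) (fun m => g (p + m))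
  rw [← h1, hmap, integral_smul_measure, integral_add_left_eq_self]
  simp

end Pairing

namespace LatticePolytope

variable {n : ℕ} (P : LatticePolytope n)

/-- The weight `⟨i_σ^* F_ρ, z⟩`, expressed through the basis dual to the ray generators. -/
noncomputable def weight (σ : P.Cone n) (ρ : P.Ray) (z : Fin n → ℂ) : ℂ := -cpair (P.edge σ ρ) z

/-- The coefficient of the contribution of a vertex to the exponential integral. -/
noncomputable def vertexCoeff (σ : P.Cone n) (z : Fin n → ℂ) : ℂ :=
  Complex.exp (cpair (P.rvertex σ) z) / (P.mult σ.1 * ∏ ρ ∈ P.rays σ.1, P.weight σ ρ z)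

/-- The parameter `z` is generic if none of the weights at the fixed points vanishes. -/
def IsGeneric (z : Fin n → ℂ) : Prop :=
  ∀ σ : P.Cone n, ∀ ρ ∈ P.rays σ.1, P.weight σ ρ z ≠ 0

/-- The region swept out by `P(h)` under mixed differences in the directions of `A`: a slab of
thickness `ε_ρ` outside the facet of each `ρ ∈ A`, cut off by the remaining facet inequalities. -/
def mixedRegion (A : Finset P.Ray) (h ε : P.Ray → ℝ) : Set (Fin n → ℝ) :=
  {m | (∀ ρ ∈ A, -ε ρ ≤ P.slack ρ m + h ρ ∧ P.slack ρ m + h ρ < 0) ∧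
    ∀ ρ ∉ A, 0 ≤ P.slack ρ m + h ρ}

/-- The mixed difference, with step `ε_ρ` in the direction `ρ ∈ A`, of the sum of the contributions
of the vertices. -/
noncomputable def mixedSum (A : Finset P.Ray) (h ε : P.Ray → ℝ) (z : Fin n → ℂ) : ℂ :=
  ∑ σ : P.Cone n, P.vertexCoeff σ z * ∏ ρ, if ρ ∈ A then
    Complex.exp (((h ρ + ε ρ : ℝ) : ℂ) * P.weight σ ρ z) - Complex.exp ((h ρ : ℂ) * P.weight σ ρ z)
    else Complex.exp ((h ρ : ℂ) * P.weight σ ρ z)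

variable {P}

lemma IsSimple.weight_eq_zero (hP : P.IsSimple) {σ : P.Cone n} {ρ : P.Ray} (h : ρ ∉ P.rays σ.1)
    (z : Fin n → ℂ) : P.weight σ ρ z = 0 := by
  rw [weight, (hP.edge_spec σ).1 ρ h, cpair_zero, neg_zero]

lemma measurableSet_mixedRegion (A : Finset P.Ray) (h ε : P.Ray → ℝ) :
    MeasurableSet (P.mixedRegion A h ε) := by
  have hm : ∀ ρ, Measurable fun m => P.slack ρ m + h ρ := fun ρ =>
    ((continuous_slack ρ).add continuous_const).measurable
  have : P.mixedRegion A h ε =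
      (⋂ ρ ∈ A, {m | -ε ρ ≤ P.slack ρ m + h ρ} ∩ {m | P.slack ρ m + h ρ < 0}) ∩
        ⋂ ρ ∈ {ρ | ρ ∉ A}, {m | 0 ≤ P.slack ρ m + h ρ} := by
    ext m
    simp [mixedRegion]
  rw [this]
  refine MeasurableSet.inter ?_ ?_
  · exact Finset.measurableSet_biInter _ fun ρ _ =>
      (measurableSet_le measurable_const (hm ρ)).inter (measurableSet_lt (hm ρ) measurable_const)
  · exact MeasurableSet.biInter (Set.to_countable _) fun ρ _ =>
      measurableSet_le measurable_const (hm ρ)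

lemma neg_le_slack_of_mem {δ : ℝ} {A : Finset P.Ray} {h ε : P.Ray → ℝ} (hh : ∀ ρ, |h ρ| < δ)
    (hε : ∀ ρ ∈ A, h ρ + ε ρ < δ) {m : Fin n → ℝ} (hm : m ∈ P.mixedRegion A h ε) (ρ : P.Ray) :
    -δ ≤ P.slack ρ m := by
  by_cases hρ : ρ ∈ A
  · have := (hm.1 ρ hρ).1
    have := hε ρ hρ
    linarith
  · have := hm.2 ρ hρ
    have := (abs_lt.1 (hh ρ)).2
    linarith

lemma integrableOn_mixedRegion {δ : ℝ} (hδ : 0 ≤ δ) {A : Finset P.Ray} {h ε : P.Ray → ℝ}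
    (hh : ∀ ρ, |h ρ| < δ) (hε : ∀ ρ ∈ A, h ρ + ε ρ < δ) {g : (Fin n → ℝ) → ℂ} (hg : Continuous g) :
    IntegrableOn g (P.mixedRegion A h ε) := by
  obtain ⟨C, hC⟩ := P.exists_norm_le δ hδ
  refine (hg.continuousOn.integrableOn_compact (isCompact_closedBall 0 C)).mono_set ?_
  intro m hm
  rw [mem_closedBall_zero_iff]
  exact hC m fun ρ => neg_le_slack_of_mem hh hε hm ρ

/-- Increasing one parameter outside `A` changes the integral over the mixed region by the one with
one more difference. -/
lemma integral_mixedRegion_update {δ : ℝ} (hδ : 0 ≤ δ) {A : Finset P.Ray} {h ε : P.Ray → ℝ}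
    {ρ : P.Ray} {t : ℝ} (hρ : ρ ∉ A) (ht : h ρ ≤ t) (ht' : |t| < δ)
    (hh : ∀ ρ, |h ρ| < δ) (hε : ∀ ρ ∈ A, h ρ + ε ρ < δ) {g : (Fin n → ℝ) → ℂ} (hg : Continuous g) :
    ∫ m in P.mixedRegion A (Function.update h ρ t) ε, g m =
      (∫ m in P.mixedRegion A h ε, g m) +
        ∫ m in P.mixedRegion (insert ρ A) h (Function.update ε ρ (t - h ρ)), g m := by
  have hne : ∀ ρ' ∈ A, ρ' ≠ ρ := fun ρ' h1 h2 => hρ (h2 ▸ h1)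
  have hunion : P.mixedRegion A (Function.update h ρ t) ε = P.mixedRegion A h ε ∪
      P.mixedRegion (insert ρ A) h (Function.update ε ρ (t - h ρ)) := by
    ext m
    simp only [mixedRegion, Set.mem_union, Set.mem_ofPred_eq, Finset.mem_insert, not_or]
    constructor
    · rintro ⟨h1, h2⟩
      have h1' : ∀ ρ' ∈ A, -ε ρ' ≤ P.slack ρ' m + h ρ' ∧ P.slack ρ' m + h ρ' < 0 := by
        intro ρ' hρ'
        have := h1 ρ' hρ'
        rwa [Function.update_of_ne (hne ρ' hρ')] at this
      have h2' : ∀ ρ' ∉ A, ρ' ≠ ρ → 0 ≤ P.slack ρ' m + h ρ' := by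
        intro ρ' hρ' hne'
        have := h2 ρ' hρ'
        rwa [Function.update_of_ne hne'] at this
      have h3 := h2 ρ hρ
      rw [Function.update_self] at h3
      by_cases hc : 0 ≤ P.slack ρ m + h ρ
      · left
        refine ⟨h1', fun ρ' hρ' => ?_⟩
        by_cases hne' : ρ' = ρ
        · rw [hne']; exact hc
        · exact h2' ρ' hρ' hne'
      · right
        refine ⟨?_, fun ρ' hρ' => h2' ρ' hρ'.2 hρ'.1⟩
        rintro ρ' (rfl | hρ')
        · rw [Function.update_self]
          exact ⟨by linarith, not_le.1 hc⟩
        · rw [Function.update_of_ne (hne ρ' hρ')]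
          exact h1' ρ' hρ'
    · rintro (⟨h1, h2⟩ | ⟨h1, h2⟩)
      · refine ⟨fun ρ' hρ' => ?_, fun ρ' hρ' => ?_⟩
        · rw [Function.update_of_ne (hne ρ' hρ')]
          exact h1 ρ' hρ'
        · by_cases hne' : ρ' = ρ
          · rw [hne', Function.update_self]
            have := h2 ρ hρ
            linarith
          · rw [Function.update_of_ne hne']
            exact h2 ρ' hρ'
      · refine ⟨fun ρ' hρ' => ?_, fun ρ' hρ' => ?_⟩
        · have := h1 ρ' (Or.inr hρ')
          rw [Function.update_of_ne (hne ρ' hρ')] at this ⊢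
          exact this
        · by_cases hne' : ρ' = ρ
          · rw [hne', Function.update_self]
            have := (h1 ρ (Or.inl rfl)).1
            rw [Function.update_self] at this
            linarith
          · rw [Function.update_of_ne hne']
            exact h2 ρ' ⟨hne', hρ'⟩
  have hdisj : Disjoint (P.mixedRegion A h ε)
      (P.mixedRegion (insert ρ A) h (Function.update ε ρ (t - h ρ))) := by
    rw [Set.disjoint_left]
    intro m h1 h2
    have h3 := h1.2 ρ hρ
    have h4 := (h2.1 ρ (Finset.mem_insert_self _ _)).2
    linarith
  rw [hunion, setIntegral_union hdisj (measurableSet_mixedRegion _ _ _)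
    (integrableOn_mixedRegion hδ hh hε hg)
    (integrableOn_mixedRegion hδ hh ?_ hg)]
  intro ρ' hρ'
  rw [Finset.mem_insert] at hρ'
  rcases hρ' with rfl | hρ'
  · rw [Function.update_self]
    have := (abs_lt.1 ht').2
    linarith
  · rw [Function.update_of_ne (hne ρ' hρ')]
    exact hε ρ' hρ'

/-- The counterpart of `integral_mixedRegion_update` for the sum over the vertices. -/
lemma mixedSum_update {A : Finset P.Ray} {h ε : P.Ray → ℝ} {ρ : P.Ray} {t : ℝ} (hρ : ρ ∉ A)
    (z : Fin n → ℂ) :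
    P.mixedSum A (Function.update h ρ t) ε z =
      P.mixedSum A h ε z + P.mixedSum (insert ρ A) h (Function.update ε ρ (t - h ρ)) z := by
  rw [mixedSum, mixedSum, mixedSum, ← Finset.sum_add_distrib]
  refine Finset.sum_congr rfl fun σ _ => ?_
  rw [← mul_add]
  congr 1
  rw [← Finset.mul_prod_erase _ _ (Finset.mem_univ ρ),
    ← Finset.mul_prod_erase _ (fun ρ' => if ρ' ∈ A then _ else _) (Finset.mem_univ ρ),
    ← Finset.mul_prod_erase _ (fun ρ' => if ρ' ∈ insert ρ A then _ else _) (Finset.mem_univ ρ)]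
  rw [if_neg hρ, if_neg hρ, if_pos (Finset.mem_insert_self _ _), Function.update_self,
    Function.update_self]
  have h1 : ∀ f g : P.Ray → ℂ, (∀ ρ' ≠ ρ, f ρ' = g ρ') →
      ∏ ρ' ∈ Finset.univ.erase ρ, f ρ' = ∏ ρ' ∈ Finset.univ.erase ρ, g ρ' :=
    fun f g hfg => Finset.prod_congr rfl fun ρ' hρ' => hfg ρ' (Finset.ne_of_mem_erase hρ')
  rw [h1 _ (fun ρ' => if ρ' ∈ A then
    Complex.exp (((h ρ' + ε ρ' : ℝ) : ℂ) * P.weight σ ρ' z) -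
      Complex.exp ((h ρ' : ℂ) * P.weight σ ρ' z)
    else Complex.exp ((h ρ' : ℂ) * P.weight σ ρ' z)) (fun ρ' hne => by
      simp only [Function.update_of_ne hne]),
    h1 (fun ρ' => if ρ' ∈ insert ρ A then _ else _) (fun ρ' => if ρ' ∈ A then
    Complex.exp (((h ρ' + ε ρ' : ℝ) : ℂ) * P.weight σ ρ' z) -
      Complex.exp ((h ρ' : ℂ) * P.weight σ ρ' z)
    else Complex.exp ((h ρ' : ℂ) * P.weight σ ρ' z)) (fun ρ' hne => by
      simp only [Function.update_of_ne hne, Finset.mem_insert, hne, false_or])]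
  rw [add_sub_cancel]
  ring

/-- Translating `P(h)` by `v` amounts to changing the parameters. -/
lemma integral_mixedRegion_translate (A : Finset P.Ray) (h ε : P.Ray → ℝ) (v : Fin n → ℝ)
    (z : Fin n → ℂ) :
    ∫ m in P.mixedRegion A (fun ρ => h ρ - v ⬝ᵥ P.rgen ρ) ε, Complex.exp (cpair m z) =
      Complex.exp (cpair v z) * ∫ m in P.mixedRegion A h ε, Complex.exp (cpair m z) := by
  rw [← integral_indicator (measurableSet_mixedRegion _ _ _),
    ← integral_indicator (measurableSet_mixedRegion _ _ _), ← integral_const_mul,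
    ← integral_add_right_eq_self _ v]
  congr 1
  ext m
  have hmem : m + v ∈ P.mixedRegion A (fun ρ => h ρ - v ⬝ᵥ P.rgen ρ) ε ↔
      m ∈ P.mixedRegion A h ε := by
    simp only [mixedRegion, Set.mem_ofPred_eq, slack_add, add_add_sub_cancel]
  by_cases hm : m ∈ P.mixedRegion A h ε
  · rw [Set.indicator_of_mem hm, Set.indicator_of_mem (hmem.2 hm), cpair_add, Complex.exp_add,
      mul_comm]
  · rw [Set.indicator_of_notMem hm, Set.indicator_of_notMem (fun h' => hm (hmem.1 h')), mul_zero]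

/-- The expansion of `v` in the basis dual to the ray generators, paired with `z`. -/
lemma IsSimple.sum_weight (hP : P.IsSimple) (σ : P.Cone n) (v : Fin n → ℝ) (z : Fin n → ℂ) :
    ∑ ρ, ((v ⬝ᵥ P.rgen ρ : ℝ) : ℂ) * P.weight σ ρ z = -cpair v z := by
  have h1 := congrArg (fun x => cpair x z) ((hP.edge_spec σ).2.2 v)
  simp only [cpair_sum, cpair_smul] at h1
  rw [h1, ← Finset.sum_neg_distrib]
  symm
  have : ∀ ρ ∈ P.rays σ.1, -(((v ⬝ᵥ P.rgen ρ : ℝ) : ℂ) * cpair (P.edge σ ρ) z) =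
      ((v ⬝ᵥ P.rgen ρ : ℝ) : ℂ) * P.weight σ ρ z := fun ρ _ => by rw [weight]; ring
  rw [Finset.sum_congr rfl this]
  refine Finset.sum_subset (Finset.subset_univ _) fun ρ _ hρ => ?_
  rw [hP.weight_eq_zero hρ, mul_zero]

/-- The counterpart of `integral_mixedRegion_translate` for the sum over the vertices. -/
lemma IsSimple.mixedSum_translate (hP : P.IsSimple) (A : Finset P.Ray) (h ε : P.Ray → ℝ)
    (v : Fin n → ℝ) (z : Fin n → ℂ) :
    P.mixedSum A (fun ρ => h ρ - v ⬝ᵥ P.rgen ρ) ε z =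
      Complex.exp (cpair v z) * P.mixedSum A h ε z := by
  rw [mixedSum, mixedSum, Finset.mul_sum]
  refine Finset.sum_congr rfl fun σ _ => ?_
  have h1 : Complex.exp (cpair v z) =
      ∏ ρ, Complex.exp (-((v ⬝ᵥ P.rgen ρ : ℝ) : ℂ) * P.weight σ ρ z) := by
    rw [← Complex.exp_sum]
    congr 1
    have := hP.sum_weight σ v z
    simp only [neg_mul, Finset.sum_neg_distrib, this, neg_neg]
  rw [mul_left_comm, h1, ← Finset.prod_mul_distrib]
  congr 1
  refine Finset.prod_congr rfl fun ρ _ => ?_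
  split_ifs
  · rw [mul_sub, ← Complex.exp_add, ← Complex.exp_add]
    push_cast
    ring_nf
  · rw [← Complex.exp_add]
    push_cast
    ring_nf

/-- A mixed difference in a direction outside `σ(1)` kills the contribution of `σ`. -/
lemma IsSimple.mixedSum_term_eq_zero (hP : P.IsSimple) {A : Finset P.Ray} {σ : P.Cone n}
    (hA : ¬ A ⊆ P.rays σ.1) (h ε : P.Ray → ℝ) (z : Fin n → ℂ) :
    (P.vertexCoeff σ z * ∏ ρ, if ρ ∈ A then
      Complex.exp (((h ρ + ε ρ : ℝ) : ℂ) * P.weight σ ρ z) - Complex.exp ((h ρ : ℂ) * P.weight σ ρ z)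
      else Complex.exp ((h ρ : ℂ) * P.weight σ ρ z)) = 0 := by
  obtain ⟨ρ, hρA, hρ⟩ := Finset.not_subset.1 hA
  rw [Finset.prod_eq_zero (Finset.mem_univ ρ), mul_zero]
  rw [if_pos hρA, hP.weight_eq_zero hρ]
  simp

end LatticePolytope

/-! ### The vertex formula for mixed regions -/

namespace LatticePolytope

variable {n : ℕ} {P : LatticePolytope n}

lemma setIntegral_Ico_exp {a b : ℝ} (hab : a ≤ b) {w : ℂ} (hw : w ≠ 0) :
    ∫ s in Set.Ico (-b) (-a), Complex.exp (-(s : ℂ) * w) =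
      (Complex.exp ((b : ℂ) * w) - Complex.exp ((a : ℂ) * w)) / w := by
  rw [integral_Ico_eq_integral_Ioc, ← intervalIntegral.integral_of_le (by linarith)]
  have h := integral_exp_mul_complex (a := -b) (b := -a) (neg_ne_zero.2 hw)
  have h1 : ∀ s : ℝ, Complex.exp (-(s : ℂ) * w) = Complex.exp (-w * s) := fun s => by
    congr 1; ring
  simp only [h1]
  rw [h, ← neg_div_neg_eq]
  simp only [neg_neg, neg_sub]
  push_cast
  congr 2 <;> congr 1 <;> ring

/-- The mixed region for all the rays of a maximal cone is a parallelepiped at the vertex. -/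
theorem IsSimple.integral_mixedRegion_vertex (hP : P.IsSimple) {δ : ℝ} (hδ : P.IsTolerance δ)
    {z : Fin n → ℂ} (hz : P.IsGeneric z) (σ : P.Cone n) {h ε : P.Ray → ℝ}
    (hh : ∀ ρ, |h ρ| < δ) (hε0 : ∀ ρ ∈ P.rays σ.1, 0 ≤ ε ρ)
    (hε : ∀ ρ ∈ P.rays σ.1, h ρ + ε ρ < δ) :
    ∫ m in P.mixedRegion (P.rays σ.1) h ε, Complex.exp (cpair m z) =
      P.vertexCoeff σ z * ∏ ρ ∈ P.rays σ.1, (Complex.exp (((h ρ + ε ρ : ℝ) : ℂ) * P.weight σ ρ z) -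
        Complex.exp ((h ρ : ℂ) * P.weight σ ρ z)) := by
  classical
  set A := P.rays σ.1 with hA
  have hli := hP.linearIndependent_gen (σ := σ) (A := A) subset_rfl
  have hzero : ∀ w : Fin n → ℝ, (∀ ρ ∈ A, w ⬝ᵥ P.rgen ρ = 0) → w = 0 := by
    intro w hw
    rw [(hP.edge_spec σ).2.2 w]
    exact Finset.sum_eq_zero fun ρ hρ => by rw [hw ρ hρ, zero_smul]
  have hL : ∀ m : Fin n → ℤ, m ∈ (⊥ : Submodule ℤ (Fin n → ℤ)) ↔
      ∀ a : A, m ⬝ᵥ P.genFamily A a = 0 := by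
    intro m
    rw [Submodule.mem_bot]
    constructor
    · rintro rfl; simp
    · intro hm
      apply latticeIncl_injective n
      rw [map_zero]
      apply hzero
      intro ρ hρ
      rw [latticeIncl_dotProduct]
      exact_mod_cast hm ⟨ρ, hρ⟩
  obtain ⟨e, Φ, he, hΦ, hinj, hmap⟩ := exists_lattice_coordinates hli hL
    (Module.Basis.empty (⊥ : Submodule ℤ (Fin n → ℤ)) (ι := Empty))
  have hee : ∀ a : A, e a = P.edge σ a.1 := by
    intro a
    rw [(hP.edge_spec σ).2.2 (e a), Finset.sum_eq_single a.1]
    · have := he a a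
      rw [if_pos rfl] at this
      rw [this, one_smul]
    · intro ρ hρ hne
      have := he a ⟨ρ, hρ⟩
      rw [if_neg (fun h => hne (by rw [h]))] at this
      rw [this, zero_smul]
    · exact fun h => absurd a.2 h
  have hΦ' : ∀ x, Φ x = ∑ a : A, x.2 a • P.edge σ a.1 := by
    intro x
    rw [hΦ]
    simp [hee]
  have hmult : ((pairHom (P.genFamily A)).range.index : ℂ) = P.mult σ.1 := by
    rw [mult_eq_index hli]
  have hmult0 : (P.mult σ.1 : ℂ) ≠ 0 := by
    exact_mod_cast hP.mult_ne_zero (σ := σ) subset_rfl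
  -- the region in the coordinates centred at the vertex
  have hslack : ∀ x (a : A), P.slack a.1 (P.rvertex σ + Φ x) = x.2 a := by
    intro x a
    rw [slack_add, (P.mem_rays_cone_iff σ a.1).1 a.2, hΦ', sum_dotProduct, zero_add,
      Finset.sum_eq_single a]
    · rw [smul_dotProduct, (hP.edge_spec σ).2.1 _ a.2 _ a.2, if_pos rfl]; simp
    · intro b _ hb
      rw [smul_dotProduct, (hP.edge_spec σ).2.1 _ b.2 _ a.2, if_neg, smul_zero]
      exact fun h => hb (Subtype.ext h)
    · simp
  have hmem : ∀ x, P.rvertex σ + Φ x ∈ P.mixedRegion A h ε ↔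
      ∀ a : A, x.2 a ∈ Set.Ico (-(h a.1 + ε a.1)) (-h a.1) := by
    intro x
    constructor
    · intro hx a
      have := hx.1 a.1 a.2
      rw [hslack] at this
      exact ⟨by linarith [this.1], by linarith [this.2]⟩
    · intro hx
      have hx' : ∀ ρ ∈ A, -(h ρ + ε ρ) ≤ P.slack ρ (P.rvertex σ + Φ x) ∧
          P.slack ρ (P.rvertex σ + Φ x) < -h ρ := by
        intro ρ hρ
        have := hx ⟨ρ, hρ⟩
        rw [← hslack] at this
        exact this
      refine ⟨fun ρ hρ => ?_, fun ρ hρ => ?_⟩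
      · have := hx' ρ hρ
        exact ⟨by linarith [this.1], by linarith [this.2]⟩
      · have h1 := hδ.near_vertex σ (P.rvertex σ + Φ x) (fun ρ' hρ' => by
          have h2 := hx' ρ' hρ'
          have h3 := hε ρ' hρ'
          have h4 := abs_lt.1 (hh ρ')
          rw [abs_le]
          exact ⟨by linarith [h2.1], by linarith [h2.2, h4.1]⟩) ρ hρ
        have h4 := abs_lt.1 (hh ρ)
        linarith [h4.1]
  have hint := integral_comp_of_map_eq hinj hmap (P.rvertex σ)
    ((P.mixedRegion A h ε).indicator fun m => Complex.exp (cpair m z))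
  rw [integral_indicator (measurableSet_mixedRegion _ _ _), hmult] at hint
  -- the integrand is a product of functions of one variable
  have hprod : ∀ x : (Empty → ℝ) × (A → ℝ),
      (P.mixedRegion A h ε).indicator (fun m => Complex.exp (cpair m z)) (P.rvertex σ + Φ x) =
        (fun _ => Complex.exp (cpair (P.rvertex σ) z)) x.1 *
          (fun y : A → ℝ => ∏ a : A, (Set.Ico (-(h a.1 + ε a.1)) (-h a.1)).indicator
            (fun s : ℝ => Complex.exp (-(s : ℂ) * P.weight σ a.1 z)) (y a)) x.2 := by
    intro x
    by_cases hx : P.rvertex σ + Φ x ∈ P.mixedRegion A h ε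
    · rw [Set.indicator_of_mem hx, cpair_add, Complex.exp_add]
      congr 1
      have hx' := (hmem x).1 hx
      simp only [Set.indicator_of_mem (hx' _)]
      rw [← Complex.exp_sum, hΦ', cpair_sum]
      congr 1
      refine Finset.sum_congr rfl fun a _ => ?_
      rw [cpair_smul, weight]
      ring
    · rw [Set.indicator_of_notMem hx]
      rw [hmem] at hx
      push Not at hx
      obtain ⟨a, ha⟩ := hx
      symm
      apply mul_eq_zero_of_right
      exact Finset.prod_eq_zero (Finset.mem_univ a) (Set.indicator_of_notMem ha _)
  have hfub := integral_prod_mul (μ := (volume : Measure (Empty → ℝ)))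
    (ν := (volume : Measure (A → ℝ))) (fun _ => Complex.exp (cpair (P.rvertex σ) z))
    (fun y : A → ℝ => ∏ a : A, (Set.Ico (-(h a.1 + ε a.1)) (-h a.1)).indicator
      (fun s : ℝ => Complex.exp (-(s : ℂ) * P.weight σ a.1 z)) (y a))
  rw [integral_congr_ae (Eventually.of_forall hprod), Measure.volume_eq_prod, hfub,
    integral_fintype_prod_volume_eq_prod] at hint
  have h1d : ∀ a : A, ∫ s : ℝ, (Set.Ico (-(h a.1 + ε a.1)) (-h a.1)).indicator
      (fun s : ℝ => Complex.exp (-(s : ℂ) * P.weight σ a.1 z)) s =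
      (Complex.exp (((h a.1 + ε a.1 : ℝ) : ℂ) * P.weight σ a.1 z) -
        Complex.exp ((h a.1 : ℂ) * P.weight σ a.1 z)) / P.weight σ a.1 z := by
    intro a
    rw [integral_indicator measurableSet_Ico, setIntegral_Ico_exp (by linarith [hε0 a.1 a.2])
      (hz σ a.1 a.2)]
  have hdirac : ∫ _ : Empty → ℝ, Complex.exp (cpair (P.rvertex σ) z) =
      Complex.exp (cpair (P.rvertex σ) z) := by
    rw [integral_const]
    simp [Measure.real, volume_pi]
  rw [hdirac] at hint
  simp only [h1d] at hint
  rw [Finset.prod_div_distrib] at hint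
  have hA1 : ∏ a : A, (Complex.exp (((h a.1 + ε a.1 : ℝ) : ℂ) * P.weight σ a.1 z) -
        Complex.exp ((h a.1 : ℂ) * P.weight σ a.1 z)) =
      ∏ ρ ∈ A, (Complex.exp (((h ρ + ε ρ : ℝ) : ℂ) * P.weight σ ρ z) -
        Complex.exp ((h ρ : ℂ) * P.weight σ ρ z)) :=
    Finset.prod_coe_sort A (fun ρ => Complex.exp (((h ρ + ε ρ : ℝ) : ℂ) * P.weight σ ρ z) -
        Complex.exp ((h ρ : ℂ) * P.weight σ ρ z))
  have hA2 : ∏ a : A, P.weight σ a.1 z = ∏ ρ ∈ A, P.weight σ ρ z :=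
    Finset.prod_coe_sort A (fun ρ => P.weight σ ρ z)
  rw [hA1, hA2] at hint
  have hw0 : ∏ ρ ∈ A, P.weight σ ρ z ≠ 0 := Finset.prod_ne_zero_iff.2 fun ρ hρ => hz σ ρ hρ
  rw [vertexCoeff, ← hA]
  have := (eq_div_iff_mul_eq hmult0).2 ((mul_comm _ _).trans hint.symm)
  rw [this]
  field_simp

/-- A function of the parameters that does not change under changes of one parameter outside `A`
takes the same value at parameters that agree on `A`. -/
lemma eq_of_forall_update {ι : Type*} [Finite ι] [DecidableEq ι] {δ : ℝ} {A : Finset ι}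
    {K : (ι → ℝ) → ℂ} {h h' : ι → ℝ}
    (hK : ∀ (g : ι → ℝ) (i : ι) (t : ℝ), i ∉ A → (∀ j, |g j| < δ) → (∀ j ∈ A, g j = h j) →
      |t| < δ → g i ≤ t → K (Function.update g i t) = K g)
    (hh : ∀ j, |h j| < δ) (hh' : ∀ j, |h' j| < δ) (hA : ∀ i ∈ A, h i = h' i) :
    K h = K h' := by
  have := Fintype.ofFinite ι
  have hK' : ∀ (g : ι → ℝ) (i : ι) (t : ℝ), i ∉ A → (∀ j, |g j| < δ) →
      (∀ j ∈ A, g j = h j) → |t| < δ → K (Function.update g i t) = K g := by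
    intro g i t hi hg hgA ht
    rcases le_total (g i) t with hle | hle
    · exact hK g i t hi hg hgA ht hle
    · have h1 := hK (Function.update g i t) i (g i) hi (fun j => by
        by_cases hj : j = i
        · rw [hj, Function.update_self]; exact ht
        · rw [Function.update_of_ne hj]; exact hg j)
        (fun j hj => by
          have hji : j ≠ i := fun hji => hi (hji ▸ hj)
          rw [Function.update_of_ne hji]
          exact hgA j hj) (hg i) (by rwa [Function.update_self])
      rw [Function.update_idem, Function.update_eq_self] at h1
      exact h1.symm
  have hS : ∀ S : Finset ι, K (S.piecewise h' h) = K h := by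
    intro S
    induction S using Finset.induction_on with
    | empty => rw [Finset.piecewise_empty]
    | insert i S hi ih =>
      rw [Finset.piecewise_insert]
      by_cases hiA : i ∈ A
      · rw [← hA i hiA]
        have : Function.update (S.piecewise h' h) i (h i) = S.piecewise h' h := by
          rw [Function.update_eq_self_iff]
          exact (Finset.piecewise_eq_of_notMem S h' h hi).symm
        rw [this, ih]
      · rw [hK' _ i _ hiA (fun j => ?_) (fun j hjA => ?_) (hh' i), ih]
        · by_cases hj : j ∈ S
          · rw [Finset.piecewise_eq_of_mem _ _ _ hj]; exact hh' j
          · rw [Finset.piecewise_eq_of_notMem _ _ _ hj]; exact hh j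
        · by_cases hj : j ∈ S
          · rw [Finset.piecewise_eq_of_mem _ _ _ hj]; exact (hA j hjA).symm
          · rw [Finset.piecewise_eq_of_notMem _ _ _ hj]
  have := hS Finset.univ
  rw [Finset.piecewise_univ] at this
  exact this.symm

/-- The integral of an exponential over a mixed region is the mixed difference of the sum of the
contributions of the vertices.  By downward induction on `A`, the difference of the two sides does
not depend on the parameters outside `A`; but a translation along an edge direction orthogonal to
`A` multiplies it by a factor different from one. -/
theorem IsSimple.integral_mixedRegion (hP : P.IsSimple) {δ : ℝ} (hδ : P.IsTolerance δ)
    {z : Fin n → ℂ} (hz : P.IsGeneric z) (A : Finset P.Ray) {h ε : P.Ray → ℝ}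
    (hh : ∀ ρ, |h ρ| < δ) (hε0 : ∀ ρ ∈ A, 0 ≤ ε ρ) (hε : ∀ ρ ∈ A, h ρ + ε ρ < δ) :
    ∫ m in P.mixedRegion A h ε, Complex.exp (cpair m z) = P.mixedSum A h ε z := by
  have hcont : Continuous fun m : Fin n → ℝ => Complex.exp (cpair m z) :=
    Complex.continuous_exp.comp (continuous_cpair z)
  induction hk : (Finset.univ \ A).card using Nat.strong_induction_on generalizing A h ε with
  | _ k ih =>
  by_cases hA : ∃ σ : P.Cone n, A ⊆ P.rays σ.1
  swap
  -- the facets in `A` have no common vertex: both sides vanish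
  · push Not at hA
    have hempty : P.mixedRegion A h ε = ∅ := by
      rw [Set.eq_empty_iff_forall_notMem]
      intro m hm
      obtain ⟨ρ, hρ, hlt⟩ := hδ.not_close A hA m fun ρ => neg_le_slack_of_mem hh hε hm ρ
      have h1 := (hm.1 ρ hρ).2
      have h2 := (abs_lt.1 (hh ρ)).1
      linarith
    rw [hempty, setIntegral_empty, mixedSum]
    exact (Finset.sum_eq_zero fun σ _ => hP.mixedSum_term_eq_zero (hA σ) h ε z).symm
  obtain ⟨σ, hσ⟩ := hA
  by_cases hAσ : A = P.rays σ.1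
  · subst hAσ
    rw [hP.integral_mixedRegion_vertex hδ hz σ hh hε0 hε, mixedSum, Finset.sum_eq_single σ]
    · congr 1
      rw [Finset.prod_ite, Finset.filter_mem_eq_inter, Finset.univ_inter]
      have : ∏ ρ ∈ Finset.univ.filter (fun ρ => ρ ∉ P.rays σ.1),
          Complex.exp ((h ρ : ℂ) * P.weight σ ρ z) = 1 := by
        refine Finset.prod_eq_one fun ρ hρ => ?_
        rw [hP.weight_eq_zero (Finset.mem_filter.1 hρ).2, mul_zero, Complex.exp_zero]
      rw [this, mul_one]
    · intro τ _ hτ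
      apply hP.mixedSum_term_eq_zero
      intro hsub
      apply hτ
      apply P.rays_cone_injective
      exact (Finset.eq_of_subset_of_card_le hsub
        (by rw [hP.card_rays_cone, hP.card_rays_cone])).symm
    · simp
  obtain ⟨ρ₀, hρ₀, hρ₀A⟩ := Finset.exists_of_ssubset (Finset.ssubset_iff_subset_ne.2 ⟨hσ, hAσ⟩)
  -- the difference `K` of the two sides depends only on the parameters in `A`, which a translation
  -- along `v` does not change
  set K : (P.Ray → ℝ) → ℂ := fun h' =>
    (∫ m in P.mixedRegion A h' ε, Complex.exp (cpair m z)) - P.mixedSum A h' ε z with hKdef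
  set v := P.edge σ ρ₀ with hv
  have hvA : ∀ ρ ∈ A, v ⬝ᵥ P.rgen ρ = 0 := by
    intro ρ hρ
    rw [hv, (hP.edge_spec σ).2.1 _ hρ₀ _ (hσ hρ), if_neg]
    rintro rfl
    exact hρ₀A hρ
  have hvz : cpair v z ≠ 0 := fun h0 => hz σ ρ₀ hρ₀ (by rw [weight, ← hv, h0, neg_zero])
  -- a small translation along `v` with a nontrivial factor
  obtain ⟨s, hs1, hs2⟩ : ∃ s : ℝ, (∀ ρ, |h ρ - (s • v) ⬝ᵥ P.rgen ρ| < δ) ∧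
      Complex.exp (cpair (s • v) z) ≠ 1 := by
    have h1 : ∀ᶠ s : ℝ in 𝓝[>] 0, ∀ ρ, |h ρ - (s • v) ⬝ᵥ P.rgen ρ| < δ := by
      rw [eventually_all]
      intro ρ
      have hc : Continuous fun s : ℝ => |h ρ - (s • v) ⬝ᵥ P.rgen ρ| := by
        simp only [smul_dotProduct, smul_eq_mul]; fun_prop
      have h2 := hc.tendsto 0
      simp only [zero_smul, zero_dotProduct, sub_zero] at h2
      exact (h2.mono_left nhdsWithin_le_nhds).eventually (Iio_mem_nhds (hh ρ))
    have h2 : ∀ᶠ s : ℝ in 𝓝[>] 0, ‖(s : ℂ) * cpair v z‖ < 2 * Real.pi := by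
      have hc : Continuous fun s : ℝ => ‖(s : ℂ) * cpair v z‖ := by fun_prop
      have h3 := hc.tendsto 0
      simp only [Complex.ofReal_zero, zero_mul, norm_zero] at h3
      exact (h3.mono_left nhdsWithin_le_nhds).eventually (Iio_mem_nhds (by positivity))
    obtain ⟨s, ⟨hs1, hs2⟩, hs0⟩ := ((h1.and h2).and self_mem_nhdsWithin).exists
    refine ⟨s, hs1, fun hexp => ?_⟩
    rw [cpair_smul] at hexp
    obtain ⟨j, hj⟩ := Complex.exp_eq_one_iff.1 hexp
    have hs0' : (s : ℂ) ≠ 0 := by exact_mod_cast (ne_of_gt hs0)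
    have hj0 : j ≠ 0 := by
      rintro rfl
      rw [Int.cast_zero, zero_mul] at hj
      exact (mul_ne_zero hs0' hvz) hj
    rw [hj, norm_mul, Complex.norm_intCast] at hs2
    have h3 : ‖2 * (Real.pi : ℂ) * Complex.I‖ = 2 * Real.pi := by
      simp [abs_of_pos Real.pi_pos]
    rw [h3] at hs2
    have h4 : (1 : ℝ) ≤ |(j : ℝ)| := by
      exact_mod_cast Int.one_le_abs hj0
    have := Real.pi_pos
    nlinarith
  have hKconst : K h = K (fun ρ => h ρ - (s • v) ⬝ᵥ P.rgen ρ) := by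
    refine eq_of_forall_update (δ := δ) (A := A) ?_ hh hs1 ?_
    · intro g ρ t hρ hg hgA ht hle
      have hgε : ∀ ρ ∈ A, g ρ + ε ρ < δ := fun ρ hρ => by rw [hgA ρ hρ]; exact hε ρ hρ
      have h1 := integral_mixedRegion_update hδ.pos.le hρ hle ht hg hgε hcont
      have h2 := mixedSum_update (P := P) (A := A) (h := g) (ε := ε) (t := t) hρ z
      have hlt : (Finset.univ \ insert ρ A).card < k := by
        rw [← hk]
        refine Finset.card_lt_card (Finset.ssubset_iff_subset_ne.2 ⟨?_, fun heq => ?_⟩)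
        · exact Finset.sdiff_subset_sdiff subset_rfl (Finset.subset_insert _ _)
        · have h3 : ρ ∈ Finset.univ \ A := by simp [hρ]
          rw [← heq] at h3
          simp at h3
      have hne : ∀ ρ' ∈ A, ρ' ≠ ρ := fun ρ' h1 h2 => hρ (h2 ▸ h1)
      have h3 := ih _ hlt (insert ρ A) (h := g) (ε := Function.update ε ρ (t - g ρ)) hg
        (fun ρ' hρ' => by
          rcases Finset.mem_insert.1 hρ' with rfl | hρ'
          · rw [Function.update_self]; linarith
          · rw [Function.update_of_ne (hne _ hρ')]; exact hε0 ρ' hρ')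
        (fun ρ' hρ' => by
          rcases Finset.mem_insert.1 hρ' with rfl | hρ'
          · rw [Function.update_self]; linarith [(abs_lt.1 ht).2]
          · rw [Function.update_of_ne (hne _ hρ')]; exact hgε ρ' hρ') rfl
      simp only [hKdef]
      rw [h1, h2, h3]
      ring
    · intro ρ hρ
      rw [smul_dotProduct, hvA ρ hρ, smul_zero, sub_zero]
  have hKtrans : K (fun ρ => h ρ - (s • v) ⬝ᵥ P.rgen ρ) = Complex.exp (cpair (s • v) z) * K h := by
    simp only [hKdef]
    rw [integral_mixedRegion_translate, hP.mixedSum_translate]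
    ring
  rw [hKtrans] at hKconst
  have h5 : (Complex.exp (cpair (s • v) z) - 1) * K h = 0 := by
    rw [sub_mul, one_mul, ← hKconst, sub_self]
  have h6 : K h = 0 := (mul_eq_zero.1 h5).resolve_left (sub_ne_zero.2 hs2)
  exact sub_eq_zero.1 h6

end LatticePolytope

/-! ### Restrictions of equivariant divisor classes to fixed points -/

section Characters

variable {n : ℕ}

lemma chi_mul (a b : Fin n → ℤ) : chi a * chi b = chi (a + b) := by
  simp [chi, AddMonoidAlgebra.single_mul_single]

lemma torusAct_chi (t : Fin n → ℂˣ) (m : Fin n → ℤ) :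
    torusAct t (chi m) = ((torusChar m t⁻¹ : ℂˣ) : ℂ) • chi m := by
  rw [torusAct, chi, AddMonoidAlgebra.lift_single, one_smul]
  rfl

lemma coeff_eq_zero_of_mem_span {S : Set (Fin n → ℤ)} {m : Fin n → ℤ} (hm : m ∉ S)
    {f : AddMonoidAlgebra ℂ (Fin n → ℤ)} (hf : f ∈ Submodule.span ℂ (chi '' S)) :
    f.coeff m = 0 := by
  induction hf using Submodule.span_induction with
  | mem x hx =>
    obtain ⟨m', hm', rfl⟩ := hx
    rw [chi, AddMonoidAlgebra.coeff_single, Finsupp.single_apply, if_neg]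
    rintro rfl
    exact hm hm'
  | zero => simp
  | add a b _ _ ha hb => rw [AddMonoidAlgebra.coeff_add, Finsupp.add_apply, ha, hb, add_zero]
  | smul c a _ ha => rw [AddMonoidAlgebra.coeff_smul_apply, ha, smul_zero]

lemma span_chi_mul_span_chi (S T : Set (Fin n → ℤ)) :
    Submodule.span ℂ (chi '' S) * Submodule.span ℂ (chi '' T) =
      Submodule.span ℂ (chi '' Set.image2 (· + ·) S T) := by
  rw [Submodule.span_mul_span]
  congr 1
  ext f
  simp only [Set.mem_mul, Set.mem_image, Set.mem_image2]
  constructor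
  · rintro ⟨_, ⟨a, ha, rfl⟩, _, ⟨b, hb, rfl⟩, rfl⟩
    exact ⟨a + b, ⟨a, ha, b, hb, rfl⟩, (chi_mul a b).symm⟩
  · rintro ⟨_, ⟨a, ha, b, hb, rfl⟩, rfl⟩
    exact ⟨_, ⟨a, ha, rfl⟩, _, ⟨b, hb, rfl⟩, chi_mul a b⟩

/-- A character of the torus determines its exponent. -/
lemma eq_neg_of_torusChar_eq {m w : Fin n → ℤ}
    (h : ∀ t : Fin n → ℂˣ, torusChar m t⁻¹ = torusChar w t) : m = -w := by
  funext i
  have h2 : (2 : ℂ) ≠ 0 := two_ne_zero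
  have hval : ∀ (v : Fin n → ℤ) (s : ℂˣ), torusChar v (Pi.mulSingle i s) = s ^ v i := by
    intro v s
    rw [torusChar, Finset.prod_eq_single i]
    · simp
    · intro j _ hj
      rw [Pi.mulSingle_eq_of_ne hj, one_zpow]
    · simp
  have h1 := h (Pi.mulSingle i (Units.mk0 2 h2))
  rw [← Pi.mulSingle_inv, hval, hval] at h1
  have h3 : ((2 : ℂ)⁻¹) ^ m i = 2 ^ w i := by simpa [Units.ext_iff] using h1
  have h4 := congrArg norm h3
  rw [norm_zpow, norm_zpow, norm_inv, inv_zpow, ← zpow_neg] at h4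
  have h5 : ‖(2 : ℂ)‖ = 2 := by simp
  rw [h5] at h4
  have h6 := zpow_right_injective₀ (by norm_num) (by norm_num) h4
  simp only [Pi.neg_apply]
  omega

lemma ptEval_ptChern (z : Fin n → ℂ) (w : Fin n → ℤ) :
    ptEval z (ptChern w) = -cpair (latticeIncl n w) z := by
  simp [ptEval, ptChern, cpair, latticeIncl_apply]

end Characters

namespace LatticePolytope

variable {n : ℕ} {P : LatticePolytope n}

/-- The dual of a maximal cone is described by the ray generators. -/
lemma dual_cone_iff (σ : P.Cone n) (m : Fin n → ℤ) :
    (∀ u ∈ σ.1, 0 ≤ latticeIncl n m ⬝ᵥ u) ↔ ∀ ρ ∈ P.rays σ.1, 0 ≤ m ⬝ᵥ P.gen ρ := by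
  constructor
  · intro h ρ hρ
    have := h _ (P.rgen_mem_of_mem_rays hρ)
    rw [latticeIncl_dotProduct] at this
    exact_mod_cast this
  · intro h u hu
    obtain ⟨c, hc, rfl⟩ := P.cone_subset_rayCone σ hu
    rw [dotProduct_sum]
    refine Finset.sum_nonneg fun ρ hρ => ?_
    rw [dotProduct_smul, smul_eq_mul, latticeIncl_dotProduct]
    exact mul_nonneg (hc ρ) (by exact_mod_cast h ρ hρ)

lemma IsSimple.eq_zero_of_dotProduct (hP : P.IsSimple) (σ : P.Cone n) {m : Fin n → ℤ}
    (h : ∀ ρ ∈ P.rays σ.1, m ⬝ᵥ P.gen ρ = 0) : m = 0 := by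
  apply latticeIncl_injective n
  rw [(hP.edge_spec σ).2.2 (latticeIncl n m), map_zero]
  refine Finset.sum_eq_zero fun ρ hρ => ?_
  rw [latticeIncl_dotProduct, h ρ hρ]
  simp

lemma IsSimple.exists_int_dual_rays (hP : P.IsSimple) (σ : P.Cone n) :
    ∃ k : ℕ, 0 < k ∧ ∃ d : P.Ray → Fin n → ℤ, ∀ ρ ∈ P.rays σ.1, ∀ ρ' ∈ P.rays σ.1,
      d ρ ⬝ᵥ P.gen ρ' = if ρ = ρ' then (k : ℤ) else 0 := by
  obtain ⟨k, hk, m, hm⟩ := exists_int_dual (hP.linearIndependent_gen (σ := σ) subset_rfl)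
  refine ⟨k, hk, fun ρ => if h : ρ ∈ P.rays σ.1 then m ⟨ρ, h⟩ else 0, fun ρ hρ ρ' hρ' => ?_⟩
  have := hm ⟨ρ, hρ⟩ ⟨ρ', hρ'⟩
  simp only [dif_pos hρ, Subtype.mk.injEq] at this ⊢
  exact this

/-- There is a section whose character vanishes on a given divisor to the minimal order, and has
large order along the other divisors through the fixed point. -/
lemma IsSimple.exists_section (hP : P.IsSimple) (σ : P.Cone n) (a : P.Ray → ℤ) {ρ : P.Ray}
    (hρ : ρ ∈ P.rays σ.1) : ∃ m : Fin n → ℤ, m ⬝ᵥ P.gen ρ + a ρ = 0 ∧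
      ∀ ρ' ∈ P.rays σ.1, 0 ≤ m ⬝ᵥ P.gen ρ' + a ρ' := by
  obtain ⟨k, hk, d, hd⟩ := hP.exists_int_dual_rays σ
  obtain ⟨t, ht⟩ := (P.gen_primitive ρ).1
  let N : P.Ray → ℤ := fun ρ' => |(-a ρ) * (t ⬝ᵥ P.gen ρ') + a ρ'|
  have key : ∀ ρ' ∈ P.rays σ.1, (-a ρ • t + ∑ τ ∈ (P.rays σ.1).erase ρ, N τ • d τ) ⬝ᵥ P.gen ρ' =
      (-a ρ) * (t ⬝ᵥ P.gen ρ') + if ρ' = ρ then 0 else N ρ' * k := by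
    intro ρ' hρ'
    rw [add_dotProduct, smul_dotProduct, smul_eq_mul, sum_dotProduct]
    congr 1
    by_cases h : ρ' = ρ
    · rw [if_pos h]
      refine Finset.sum_eq_zero fun τ hτ => ?_
      rw [smul_dotProduct, hd τ (Finset.mem_of_mem_erase hτ) ρ' hρ', if_neg, smul_zero]
      rw [h]
      exact Finset.ne_of_mem_erase hτ
    · rw [if_neg h, Finset.sum_eq_single ρ']
      · rw [smul_dotProduct, hd ρ' hρ' ρ' hρ', if_pos rfl, smul_eq_mul]
      · intro τ hτ hne
        rw [smul_dotProduct, hd τ (Finset.mem_of_mem_erase hτ) ρ' hρ', if_neg hne, smul_zero]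
      · exact fun h' => absurd (Finset.mem_erase.2 ⟨h, hρ'⟩) h'
  refine ⟨-a ρ • t + ∑ τ ∈ (P.rays σ.1).erase ρ, N τ • d τ, ?_, fun ρ' hρ' => ?_⟩
  · rw [key ρ hρ, if_pos rfl, ht]; ring
  · rw [key ρ' hρ']
    by_cases h : ρ' = ρ
    · rw [if_pos h, h, ht]; linarith
    · rw [if_neg h]
      have h1 : N ρ' * 1 ≤ N ρ' * k :=
        mul_le_mul_of_nonneg_left (by exact_mod_cast hk) (abs_nonneg _)
      have h2 : -N ρ' ≤ (-a ρ) * (t ⬝ᵥ P.gen ρ') + a ρ' := neg_abs_le _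
      linarith

/-- The torus acts on the fibre of `𝒪_X(D)` at a fixed point by the weight `w` only if `-w` is the
exponent of a local generator: the sections form a module generated by minimal characters, and each
of them contributes its weight to the fibre. -/
lemma IsSimple.eq_of_hasFibreWeight (hP : P.IsSimple) (σ : P.Cone n) {a : P.Ray → ℤ}
    {w : Fin n → ℤ} (hw : P.HasFibreWeight σ.1 a w) : ∀ ρ ∈ P.rays σ.1, w ⬝ᵥ P.gen ρ = a ρ := by
  set S : Set (Fin n → ℤ) := {m | m ≠ 0 ∧ ∀ u ∈ σ.1, 0 ≤ latticeIncl n m ⬝ᵥ u} with hS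
  set C : Set (Fin n → ℤ) := {m | ∀ ρ ∈ P.rays σ.1, 0 ≤ m ⬝ᵥ P.gen ρ + a ρ} with hC
  have hmin : ∀ m ∈ C, m ∉ Set.image2 (· + ·) S C → m = -w := by
    intro m hm hmS
    apply eq_neg_of_torusChar_eq
    intro t
    have h1 := hw t (chi m) (Submodule.subset_span ⟨m, hm, rfl⟩)
    rw [fixedPointIdeal, divSections, span_chi_mul_span_chi, torusAct_chi, ← sub_smul] at h1
    have h2 := coeff_eq_zero_of_mem_span hmS h1
    rw [AddMonoidAlgebra.coeff_smul_apply, chi, AddMonoidAlgebra.coeff_single,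
      Finsupp.single_eq_same, smul_eq_mul, mul_one, sub_eq_zero] at h2
    exact Units.ext h2
  have hind : ∀ (k : ℕ) (m : Fin n → ℤ), m ∈ C → ∑ ρ ∈ P.rays σ.1, (m ⬝ᵥ P.gen ρ + a ρ) ≤ k →
      -w ∈ C ∧ ∀ ρ ∈ P.rays σ.1, 0 ≤ (m + w) ⬝ᵥ P.gen ρ := by
    intro k
    induction k with
    | zero =>
      intro m hm hk
      have hz := (Finset.sum_eq_zero_iff_of_nonneg hm).1
        (le_antisymm (by simpa using hk) (Finset.sum_nonneg hm))
      have := hmin m hm (by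
        rintro ⟨s, hs, c, hc, rfl⟩
        apply hs.1
        refine hP.eq_zero_of_dotProduct σ fun ρ hρ => ?_
        have h1 := hz ρ hρ
        have h2 := hc ρ hρ
        have h3 := (dual_cone_iff σ s).1 hs.2 ρ hρ
        rw [add_dotProduct] at h1
        linarith)
      subst this
      exact ⟨hm, by simp⟩
    | succ k ih =>
      intro m hm hk
      by_cases hmS : m ∈ Set.image2 (· + ·) S C
      · obtain ⟨s, hs, c, hc, rfl⟩ := hmS
        have hs3 := (dual_cone_iff σ s).1 hs.2
        have hpos : 0 < ∑ ρ ∈ P.rays σ.1, s ⬝ᵥ P.gen ρ := by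
          refine lt_of_le_of_ne (Finset.sum_nonneg hs3) fun h0 => hs.1 ?_
          exact hP.eq_zero_of_dotProduct σ
            ((Finset.sum_eq_zero_iff_of_nonneg hs3).1 h0.symm)
        have hsum : ∑ ρ ∈ P.rays σ.1, ((s + c) ⬝ᵥ P.gen ρ + a ρ) =
            ∑ ρ ∈ P.rays σ.1, s ⬝ᵥ P.gen ρ + ∑ ρ ∈ P.rays σ.1, (c ⬝ᵥ P.gen ρ + a ρ) := by
          rw [← Finset.sum_add_distrib]
          exact Finset.sum_congr rfl fun ρ _ => by rw [add_dotProduct]; ring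
        have hk' : ∑ ρ ∈ P.rays σ.1, ((s + c) ⬝ᵥ P.gen ρ + a ρ) ≤ k + 1 := by
          exact_mod_cast hk
        obtain ⟨h1, h2⟩ := ih c hc (by omega)
        refine ⟨h1, fun ρ hρ => ?_⟩
        have h3 := h2 ρ hρ
        have h4 := hs3 ρ hρ
        simp only [add_dotProduct] at h3 ⊢
        linarith
      · have := hmin m hm hmS
        subst this
        exact ⟨hm, by simp⟩
  intro ρ hρ
  obtain ⟨m, hm0, hm⟩ := hP.exists_section σ a hρ
  obtain ⟨k, hk⟩ := Int.eq_ofNat_of_zero_le (Finset.sum_nonneg hm)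
  obtain ⟨h1, h2⟩ := hind k m hm hk.le
  have h3 := h1 ρ hρ
  have h4 := h2 ρ hρ
  rw [neg_dotProduct] at h3
  rw [add_dotProduct] at h4
  linarith

/-- A divisor with an integral local equation is Cartier, and the torus acts on the fibre by the
corresponding weight. -/
lemma isCartierOn_and_hasFibreWeight (σ : P.Cone n) {a : P.Ray → ℤ}
    {m : Fin n → ℤ} (hm : ∀ ρ ∈ P.rays σ.1, m ⬝ᵥ P.gen ρ = -a ρ) :
    P.IsCartierOn σ.1 a ∧ P.HasFibreWeight σ.1 a (-m) := by
  have hC : {m' : Fin n → ℤ | ∀ ρ ∈ P.rays σ.1, 0 ≤ m' ⬝ᵥ P.gen ρ + a ρ} =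
      Set.image2 (· + ·) {s | ∀ u ∈ σ.1, 0 ≤ latticeIncl n s ⬝ᵥ u} {m} := by
    ext m'
    simp only [Set.image2_singleton_right, Set.mem_image, Set.mem_ofPred_eq]
    constructor
    · intro h
      refine ⟨m' - m, (dual_cone_iff σ _).2 fun ρ hρ => ?_, sub_add_cancel _ _⟩
      rw [sub_dotProduct, hm ρ hρ]
      linarith [h ρ hρ]
    · rintro ⟨s, hs, rfl⟩ ρ hρ
      have := (dual_cone_iff σ s).1 hs ρ hρ
      rw [add_dotProduct, hm ρ hρ]
      linarith
  constructor
  · refine ⟨chi m, ?_⟩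
    have h := span_chi_mul_span_chi {s | ∀ u ∈ σ.1, 0 ≤ latticeIncl n s ⬝ᵥ u} {m}
    rw [← hC, Set.image_singleton] at h
    rw [divSections, coordRing]
    exact h.symm
  · intro t s hs
    rw [divSections] at hs
    induction hs using Submodule.span_induction with
    | mem x hx =>
      obtain ⟨m', hm', rfl⟩ := hx
      rw [torusAct_chi, ← sub_smul]
      by_cases h : m' = m
      · have h1 : torusChar m' t⁻¹ = torusChar (-m) t := by
          rw [h, torusChar, torusChar]
          exact Finset.prod_congr rfl fun i _ => by simp
        rw [h1, sub_self, zero_smul]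
        exact Submodule.zero_mem _
      · apply Submodule.smul_mem
        rw [fixedPointIdeal, divSections, span_chi_mul_span_chi]
        have hm'' := hm'
        rw [hC] at hm''
        obtain ⟨s, hs, m₀, rfl, hsum⟩ := hm''
        refine Submodule.subset_span ⟨m', ⟨s, ⟨?_, hs⟩, m₀, fun ρ hρ => ?_, hsum⟩, rfl⟩
        · rintro rfl
          exact h (by simpa using hsum.symm)
        · rw [hm ρ hρ]; simp
    | zero => simp
    | add x y _ _ hx hy =>
      rw [map_add, smul_add, add_sub_add_comm]
      exact Submodule.add_mem _ hx hy
    | smul c x _ hx =>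
      rw [map_smul, smul_comm, ← smul_sub]
      exact Submodule.smul_mem _ _ hx

/-- The restriction of a torus invariant divisor class to a fixed point, evaluated at `z`, is the
pairing of `z` with the rational local equation of the divisor. -/
theorem IsSimple.ptEval_restrictClass (hP : P.IsSimple) (σ : P.Cone n) {a : P.Ray → ℤ}
    {x : Fin n → ℝ} (hx : ∀ ρ ∈ P.rays σ.1, x ⬝ᵥ P.rgen ρ = -(a ρ : ℝ)) (z : Fin n → ℂ) :
    ptEval z (P.restrictClass σ.1 a) = cpair x z := by
  have hex : ∃ α : PtCohomology n, ∃ k : ℕ, 0 < k ∧ ∃ w : Fin n → ℤ,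
      P.IsCartierOn σ.1 (k • a) ∧ P.HasFibreWeight σ.1 (k • a) w ∧
        (k : PtCohomology n) * α = ptChern w := by
    obtain ⟨k, hk, d, hd⟩ := hP.exists_int_dual_rays σ
    have hm : ∀ ρ ∈ P.rays σ.1, (-∑ τ ∈ P.rays σ.1, a τ • d τ) ⬝ᵥ P.gen ρ = -(k • a) ρ := by
      intro ρ hρ
      rw [neg_dotProduct, sum_dotProduct, Finset.sum_eq_single ρ]
      · rw [smul_dotProduct, hd ρ hρ ρ hρ, if_pos rfl]
        simp [mul_comm]
      · intro τ hτ hne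
        rw [smul_dotProduct, hd τ hτ ρ hρ, if_neg hne, smul_zero]
      · exact fun h => absurd hρ h
    obtain ⟨h1, h2⟩ := isCartierOn_and_hasFibreWeight σ hm
    refine ⟨MvPolynomial.C ((k : ℚ)⁻¹) * ptChern (- -∑ τ ∈ P.rays σ.1, a τ • d τ), k, hk, _, h1, h2,
      ?_⟩
    rw [← mul_assoc, ← map_natCast (MvPolynomial.C (R := ℚ) (σ := Fin n)) k, ← map_mul,
      mul_inv_cancel₀ (by exact_mod_cast hk.ne'), map_one, one_mul]
  obtain ⟨k, hk, w, -, hw, hkw⟩ := Classical.epsilon_spec (p := fun α : PtCohomology n =>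
    ∃ k : ℕ, 0 < k ∧ ∃ w : Fin n → ℤ, P.IsCartierOn σ.1 (k • a) ∧
      P.HasFibreWeight σ.1 (k • a) w ∧ (k : PtCohomology n) * α = ptChern w) hex
  change (k : PtCohomology n) * P.restrictClass σ.1 a = ptChern w at hkw
  have h1 := congrArg (ptEval z) hkw
  rw [map_mul, map_natCast, ptEval_ptChern] at h1
  have h2 : latticeIncl n w = (-(k : ℝ)) • x := by
    rw [(hP.edge_spec σ).2.2 (latticeIncl n w), (hP.edge_spec σ).2.2 ((-(k : ℝ)) • x)]
    refine Finset.sum_congr rfl fun ρ hρ => ?_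
    rw [latticeIncl_dotProduct, hP.eq_of_hasFibreWeight σ hw ρ hρ, smul_dotProduct, hx ρ hρ]
    simp
  rw [h2, cpair_smul] at h1
  have hk0 : (k : ℂ) ≠ 0 := by exact_mod_cast hk.ne'
  apply mul_left_cancel₀ hk0
  rw [h1]
  push_cast
  ring

/-- The weights are the values of the restricted classes of the divisors `D_ρ`. -/
lemma IsSimple.ptEval_restrictF (hP : P.IsSimple) (σ : P.Cone n) (ρ : P.Ray) (z : Fin n → ℂ) :
    ptEval z (P.restrictF σ.1 ρ) = P.weight σ ρ z := by
  rw [restrictF, hP.ptEval_restrictClass σ (x := -P.edge σ ρ), weight]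
  · have := cpair_smul (-1) (P.edge σ ρ) z
    rw [neg_one_smul] at this
    rw [this]
    simp
  · intro ρ' hρ'
    rw [neg_dotProduct]
    congr 1
    by_cases hρ : ρ ∈ P.rays σ.1
    · rw [(hP.edge_spec σ).2.1 ρ hρ ρ' hρ', Pi.single_apply]
      simp [eq_comm]
    · rw [(hP.edge_spec σ).1 ρ hρ, Pi.single_apply, if_neg]
      · simp
      · rintro rfl; exact hρ hρ'

/-- The ample divisor `D_P` restricts at a fixed point to the class of the corresponding vertex. -/
lemma IsSimple.ptEval_restrictClass_const (hP : P.IsSimple) (σ : P.Cone n) (z : Fin n → ℂ) :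
    ptEval z (P.restrictClass σ.1 P.const) = cpair (P.rvertex σ) z := by
  apply hP.ptEval_restrictClass
  intro ρ hρ
  have := (P.mem_rays_cone_iff σ ρ).1 hρ
  rw [slack] at this
  linarith

lemma IsSimple.ptEval_eulerClass (hP : P.IsSimple) (σ : P.Cone n) (z : Fin n → ℂ) :
    ptEval z (P.eulerClass σ.1) = P.mult σ.1 * ∏ ρ ∈ P.rays σ.1, P.weight σ ρ z := by
  rw [eulerClass, map_mul, map_natCast, map_prod]
  simp only [hP.ptEval_restrictF]

end LatticePolytope

/-! ### Polynomials as superpositions of exponentials -/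

section TorusIntegral

variable {n : ℕ}

/-- The box of angles parametrizing a product of circles. -/
def phaseBox (n : ℕ) : Set (Fin n → ℝ) := Set.univ.pi fun _ => Set.Icc 0 (2 * Real.pi)

/-- The point of the product of circles of radii `r` about the origin with angles `θ`. -/
noncomputable def torusPoint (r θ : Fin n → ℝ) : Fin n → ℂ := fun i => circleMap 0 (r i) (θ i)

lemma isCompact_phaseBox (n : ℕ) : IsCompact (phaseBox n) :=
  isCompact_univ_pi fun _ => isCompact_Icc

lemma continuous_torusPoint (r : Fin n → ℝ) : Continuous (torusPoint r) :=
  continuous_pi fun i => (continuous_circleMap 0 (r i)).comp (continuous_apply i)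

lemma continuous_cpair_uncurry : Continuous fun x : (Fin n → ℝ) × (Fin n → ℂ) => cpair x.1 x.2 := by
  unfold cpair
  fun_prop

/-- Cauchy's integral formula for the coefficients of the exponential function. -/
lemma setIntegral_circleMap_pow_inv_mul_exp {R : ℝ} (hR : 0 < R) (a : ℕ) (x : ℂ) :
    ∫ θ in Set.Icc 0 (2 * Real.pi), (circleMap 0 R θ ^ a)⁻¹ * Complex.exp (x * circleMap 0 R θ) =
      2 * Real.pi * x ^ a / a.factorial := by
  have hd : DiffContOnCl ℂ (fun z => Complex.exp (x * z)) (Metric.ball 0 R) :=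
    Differentiable.diffContOnCl (by fun_prop)
  have h := hd.circleIntegral_one_div_sub_center_pow_smul hR a
  rw [iteratedDeriv_cexp_const_mul, circleIntegral] at h
  simp only [mul_zero, Complex.exp_zero, mul_one, deriv_circleMap, sub_zero, smul_eq_mul] at h
  rw [integral_Icc_eq_integral_Ioc, ← intervalIntegral.integral_of_le Real.two_pi_pos.le]
  have h2 : ∀ θ : ℝ, circleMap 0 R θ * Complex.I *
      (1 / circleMap 0 R θ ^ (a + 1) * Complex.exp (x * circleMap 0 R θ)) =
      Complex.I * ((circleMap 0 R θ ^ a)⁻¹ * Complex.exp (x * circleMap 0 R θ)) := fun θ => by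
    have h0 : circleMap 0 R θ ≠ 0 := circleMap_ne_center hR.ne'
    field_simp
    ring
  simp only [h2, intervalIntegral.integral_const_mul] at h
  refine mul_left_cancel₀ Complex.I_ne_zero (h.trans ?_)
  ring

/-- A polynomial is a superposition of exponentials, with frequencies on a product of circles of
arbitrary radii. -/
lemma exists_eval_eq_setIntegral_exp {r : Fin n → ℝ} (hr : ∀ i, 0 < r i)
    (f : MvPolynomial (Fin n) ℂ) :
    ∃ w : (Fin n → ℝ) → ℂ, Continuous w ∧ ∀ m : Fin n → ℝ,
      MvPolynomial.eval (fun i => (m i : ℂ)) f =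
        ∫ θ in phaseBox n, w θ * Complex.exp (cpair m (torusPoint r θ)) := by
  have hne : ∀ (i : Fin n) (t : ℝ), circleMap 0 (r i) t ≠ 0 := fun i t =>
    circleMap_ne_center (hr i).ne'
  induction f using MvPolynomial.induction_on' with
  | monomial a c =>
    refine ⟨fun θ => c * ∏ i, ((a i).factorial / (2 * Real.pi) * (torusPoint r θ i ^ a i)⁻¹), ?_,
      fun m => ?_⟩
    · refine continuous_const.mul (continuous_finsetProd _ fun i _ => continuous_const.mul ?_)
      refine Continuous.inv₀ ?_ fun θ => pow_ne_zero _ (hne i _)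
      exact ((continuous_apply i).comp (continuous_torusPoint r)).pow _
    · let g : Fin n → ℝ → ℂ := fun i t => ((a i).factorial : ℂ) / (2 * Real.pi) *
        ((circleMap 0 (r i) t ^ a i)⁻¹ * Complex.exp (m i * circleMap 0 (r i) t))
      have h1 : ∀ θ : Fin n → ℝ,
          c * (∏ i, ((a i).factorial / (2 * Real.pi) * (torusPoint r θ i ^ a i)⁻¹)) *
            Complex.exp (cpair m (torusPoint r θ)) = c * ∏ i, g i (θ i) := by
        intro θ
        rw [cpair, Complex.exp_sum, mul_assoc, ← Finset.prod_mul_distrib]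
        simp only [g, torusPoint, mul_assoc]
      have h2 := integral_fintype_prod_eq_prod g
        (μ := fun _ => (volume : Measure ℝ).restrict (Set.Icc 0 (2 * Real.pi)))
      simp only [h1]
      rw [integral_const_mul, phaseBox, volume_pi, Measure.restrict_pi_pi, h2,
        MvPolynomial.eval_monomial, Finsupp.prod_fintype _ _ (by simp)]
      simp only [g]
      congr 1
      refine Finset.prod_congr rfl fun i _ => ?_
      rw [integral_const_mul, setIntegral_circleMap_pow_inv_mul_exp (hr i)]
      have h2 : (Real.pi : ℂ) ≠ 0 := by exact_mod_cast Real.pi_ne_zero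
      have h3 : ((a i).factorial : ℂ) ≠ 0 := by exact_mod_cast (a i).factorial_ne_zero
      field_simp
  | add p q hp hq =>
    obtain ⟨w, hw, hw'⟩ := hp
    obtain ⟨v, hv, hv'⟩ := hq
    refine ⟨fun θ => w θ + v θ, hw.add hv, fun m => ?_⟩
    have hc : Continuous fun θ => Complex.exp (cpair m (torusPoint r θ)) :=
      Complex.continuous_exp.comp ((continuous_cpair_uncurry.comp
        (continuous_const.prodMk (continuous_torusPoint r))))
    rw [map_add, hw' m, hv' m, ← integral_add]
    · simp only [add_mul]
    · exact (hw.mul hc).continuousOn.integrableOn_compact (isCompact_phaseBox n)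
    · exact (hv.mul hc).continuousOn.integrableOn_compact (isCompact_phaseBox n)

lemma cpair_add_right (m : Fin n → ℝ) (z ζ : Fin n → ℂ) :
    cpair m (z + ζ) = cpair m z + cpair m ζ := by
  simp [cpair, mul_add, Finset.sum_add_distrib]

/-- Integrals of a polynomial times an exponential are superpositions of integrals of
exponentials. -/
lemma integral_eval_mul_exp {r : Fin n → ℝ} {f : MvPolynomial (Fin n) ℂ} {w : (Fin n → ℝ) → ℂ}
    (hw : Continuous w) (hwf : ∀ m : Fin n → ℝ, MvPolynomial.eval (fun i => (m i : ℂ)) f =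
        ∫ θ in phaseBox n, w θ * Complex.exp (cpair m (torusPoint r θ)))
    {μ : Measure (Fin n → ℝ)} [IsFiniteMeasure μ] {C : ℝ} (hμ : ∀ᵐ m ∂μ, ‖m‖ ≤ C)
    (z : Fin n → ℂ) :
    ∫ m, MvPolynomial.eval (fun i => (m i : ℂ)) f * Complex.exp (cpair m z) ∂μ =
      ∫ θ in phaseBox n, w θ * ∫ m, Complex.exp (cpair m (z + torusPoint r θ)) ∂μ := by
  have hcont : Continuous (Function.uncurry fun (m θ : Fin n → ℝ) =>
      w θ * Complex.exp (cpair m (z + torusPoint r θ))) := by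
    refine (hw.comp continuous_snd).mul (Complex.continuous_exp.comp
      (continuous_cpair_uncurry.comp (continuous_fst.prodMk ?_)))
    exact continuous_const.add ((continuous_torusPoint r).comp continuous_snd)
  have hint : Integrable (Function.uncurry fun (m θ : Fin n → ℝ) =>
      w θ * Complex.exp (cpair m (z + torusPoint r θ)))
      (μ.prod (volume.restrict (phaseBox n))) := by
    have h1 : μ.restrict (Metric.closedBall 0 C) = μ :=
      Measure.restrict_eq_self_of_ae_mem (by simpa using hμ)
    rw [← h1, Measure.prod_restrict]
    exact hcont.continuousOn.integrableOn_compact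
      ((isCompact_closedBall _ _).prod (isCompact_phaseBox n))
  have h1 : ∀ m : Fin n → ℝ, MvPolynomial.eval (fun i => (m i : ℂ)) f * Complex.exp (cpair m z) =
      ∫ θ in phaseBox n, w θ * Complex.exp (cpair m (z + torusPoint r θ)) := by
    intro m
    rw [hwf, ← integral_mul_const]
    simp only [cpair_add_right, Complex.exp_add]
    congr 1
    ext θ
    ring
  simp only [h1]
  rw [integral_integral_swap hint]
  simp only [integral_const_mul]

/-- On a product of circles whose radii grow fast enough, a nonzero real linear form does not take
a given value: the term with the largest radius dominates. -/
lemma eventually_cpair_add_ne_zero {e : Fin n → ℝ} (he : e ≠ 0) (z : Fin n → ℂ) :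
    ∀ᶠ R : ℝ in atTop, ∀ θ : Fin n → ℝ,
      cpair e (z + torusPoint (fun i => R ^ ((i : ℕ) + 1)) θ) ≠ 0 := by
  classical
  have hs : (Finset.univ.filter fun i => e i ≠ 0).Nonempty := by
    obtain ⟨i, hi⟩ := Function.ne_iff.1 he
    exact ⟨i, by simpa using hi⟩
  obtain ⟨i₀, hi₀, hmax⟩ := Finset.exists_max_image _ (fun i : Fin n => (i : ℕ)) hs
  have hi₀' : 0 < |e i₀| := abs_pos.2 (by simpa using hi₀)
  have hzero : ∀ i, i₀ < i → e i = 0 := by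
    intro i hi
    by_contra h
    exact absurd (hmax i (by simpa using h)) (not_le.2 hi)
  have hlim : Tendsto (fun R : ℝ => |e i₀| * R) atTop atTop :=
    tendsto_id.const_mul_atTop hi₀'
  filter_upwards [hlim.eventually_gt_atTop (‖cpair e z‖ + ∑ i, |e i|), eventually_ge_atTop 1]
    with R hR hR1 θ h0
  set ζ := torusPoint (fun i : Fin n => R ^ ((i : ℕ) + 1)) θ with hζ
  have hnorm : ∀ i, ‖ζ i‖ = R ^ ((i : ℕ) + 1) := fun i => by
    rw [hζ, torusPoint, norm_circleMap_zero, abs_of_pos (by positivity)]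
  rw [cpair_add_right] at h0
  have h1 : (e i₀ : ℂ) * ζ i₀ = -(cpair e z + ∑ i ∈ Finset.univ.erase i₀, (e i : ℂ) * ζ i) := by
    have h2 : cpair e ζ = _ := (Finset.add_sum_erase _ _ (Finset.mem_univ i₀)).symm
    rw [h2] at h0
    linear_combination h0
  have hRp : 0 < R ^ (i₀ : ℕ) := by positivity
  have h3 : |e i₀| * R * R ^ (i₀ : ℕ) ≤ (‖cpair e z‖ + ∑ i, |e i|) * R ^ (i₀ : ℕ) := by
    calc |e i₀| * R * R ^ (i₀ : ℕ) = ‖(e i₀ : ℂ) * ζ i₀‖ := by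
          rw [norm_mul, hnorm, Complex.norm_real, Real.norm_eq_abs, pow_succ]; ring
      _ ≤ ‖cpair e z‖ + ∑ i ∈ Finset.univ.erase i₀, ‖(e i : ℂ) * ζ i‖ := by
          rw [h1, norm_neg]
          exact (norm_add_le _ _).trans (add_le_add le_rfl (norm_sum_le _ _))
      _ ≤ ‖cpair e z‖ * R ^ (i₀ : ℕ) + ∑ i, |e i| * R ^ (i₀ : ℕ) := by
          refine add_le_add (le_mul_of_one_le_right (norm_nonneg _) (one_le_pow₀ hR1)) ?_
          refine (Finset.sum_le_sum fun i hi => ?_).trans (Finset.sum_le_sum_of_subset_of_nonneg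
            (Finset.subset_univ (Finset.univ.erase i₀)) fun _ _ _ => by positivity)
          rw [norm_mul, hnorm, Complex.norm_real, Real.norm_eq_abs]
          rcases lt_or_ge i₀ i with h | h
          · rw [hzero i h]; simp
          · have hne : i ≠ i₀ := Finset.ne_of_mem_erase hi
            have hlt : (i : ℕ) < i₀ := lt_of_le_of_ne h fun h' => hne (Fin.ext h')
            exact mul_le_mul_of_nonneg_left (pow_le_pow_right₀ hR1 hlt) (abs_nonneg _)
      _ = _ := by rw [← Finset.sum_mul]; ring
  exact absurd (le_of_mul_le_mul_right h3 hRp) (not_le.2 hR)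

end TorusIntegral

namespace LatticePolytope

variable {n : ℕ} {P : LatticePolytope n}

lemma IsSimple.edge_ne_zero (hP : P.IsSimple) {σ : P.Cone n} {ρ : P.Ray} (hρ : ρ ∈ P.rays σ.1) :
    P.edge σ ρ ≠ 0 := by
  intro h
  have := (hP.edge_spec σ).2.1 ρ hρ ρ hρ
  simp [h] at this

/-- Every parameter is the centre of a product of circles of generic parameters. -/
lemma IsSimple.exists_isGeneric_torusPoint (hP : P.IsSimple) (z : Fin n → ℂ) :
    ∃ r : Fin n → ℝ, (∀ i, 0 < r i) ∧ ∀ θ, P.IsGeneric (z + torusPoint r θ) := by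
  have h : ∀ᶠ R : ℝ in atTop, ∀ (σ : P.Cone n) (ρ : P.Ray), ρ ∈ P.rays σ.1 → ∀ θ : Fin n → ℝ,
      cpair (P.edge σ ρ) (z + torusPoint (fun i => R ^ ((i : ℕ) + 1)) θ) ≠ 0 := by
    rw [eventually_all]
    intro σ
    rw [eventually_all]
    intro ρ
    by_cases hρ : ρ ∈ P.rays σ.1
    · filter_upwards [eventually_cpair_add_ne_zero (hP.edge_ne_zero hρ) z] with R hR _ θ
      exact hR θ
    · exact Eventually.of_forall fun _ h => absurd h hρ
  obtain ⟨R, hR, hR0⟩ := (h.and (eventually_gt_atTop 0)).exists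
  exact ⟨_, fun i => by positivity, fun θ σ ρ hρ => neg_ne_zero.2 (hR σ ρ hρ θ)⟩

end LatticePolytope

/-! ### Analyticity and partial derivatives of the exponential integral -/

section ExponentialSum

variable {𝔸 : Type*} [NormedCommRing 𝔸] [NormedAlgebra ℝ 𝔸] [CompleteSpace 𝔸]
  {S R : Type*} [Fintype S] [Fintype R]

/-- A sum of exponentials of linear forms in `h`, with coefficients and frequencies in a commutative
Banach algebra, followed by a continuous linear functional. -/
noncomputable def expSum (L : 𝔸 →L[ℝ] ℂ) (c : S → 𝔸) (a : S → R → 𝔸) (h : R → ℝ) : ℂ :=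
  L (∑ s, c s * NormedSpace.exp (∑ ρ, h ρ • a s ρ))

lemma analyticAt_expSum (L : 𝔸 →L[ℝ] ℂ) (c : S → 𝔸) (a : S → R → 𝔸) (h : R → ℝ) :
    AnalyticAt ℝ (expSum L c a) h := by
  unfold expSum
  refine (L.analyticAt _).comp ?_
  refine Finset.analyticAt_fun_sum _ fun s _ => analyticAt_const.mul ?_
  refine AnalyticAt.comp (g := NormedSpace.exp) (NormedSpace.exp_analytic _) ?_
  refine Finset.analyticAt_fun_sum _ fun ρ _ => AnalyticAt.fun_smul ?_ analyticAt_const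
  exact (ContinuousLinearMap.proj (R := ℝ) (φ := fun _ : R => ℝ) ρ).analyticAt h

/-- A partial derivative multiplies the coefficients by the corresponding frequencies. -/
lemma hasLineDerivAt_expSum [DecidableEq R] (L : 𝔸 →L[ℝ] ℂ) (c : S → 𝔸) (a : S → R → 𝔸)
    (h : R → ℝ) (ρ : R) :
    HasLineDerivAt ℝ (expSum L c a) (expSum L (fun s => c s * a s ρ) a h) h (Pi.single ρ 1) := by
  let _ : NormedAlgebra ℚ 𝔸 := NormedAlgebra.restrictScalars ℚ ℝ 𝔸
  unfold HasLineDerivAt expSum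
  have h1 : ∀ t : ℝ, L (∑ s, c s * NormedSpace.exp
      (∑ ρ', (h + t • (Pi.single ρ (1 : ℝ) : R → ℝ)) ρ' • a s ρ')) =
      L (∑ s, c s * NormedSpace.exp (∑ ρ', h ρ' • a s ρ') * NormedSpace.exp (t • a s ρ)) := by
    intro t
    congr 1
    refine Finset.sum_congr rfl fun s _ => ?_
    rw [mul_assoc, ← NormedSpace.exp_add]
    congr 2
    simp only [Pi.add_apply, Pi.smul_apply, add_smul, Finset.sum_add_distrib, smul_eq_mul]
    congr 1
    rw [Finset.sum_eq_single ρ]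
    · simp
    · intro b _ hb
      simp [hb]
    · simp
  simp only [h1]
  refine HasDerivAt.congr_deriv (f' := L (∑ s, c s * NormedSpace.exp (∑ ρ', h ρ' • a s ρ') *
    (NormedSpace.exp ((0 : ℝ) • a s ρ) * a s ρ))) ?_ ?_
  · refine L.hasFDerivAt.comp_hasDerivAt (0 : ℝ) (HasDerivAt.fun_sum fun s _ => ?_)
    exact (hasDerivAt_exp_smul_const (a s ρ) (0 : ℝ)).const_mul _
  · congr 1
    refine Finset.sum_congr rfl fun s _ => ?_
    rw [zero_smul, NormedSpace.exp_zero]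
    ring

variable {T : Type*} [TopologicalSpace T] [CompactSpace T] [MeasurableSpace T] [BorelSpace T]
  (μ : Measure T) [IsFiniteMeasure μ]

/-- Integration against a finite measure, as a continuous linear functional on continuous
functions. -/
noncomputable def continuousIntegral : C(T, ℂ) →L[ℝ] ℂ :=
  (L1.integralCLM' ℝ).comp (ContinuousMap.toLp 1 μ ℝ)

lemma continuousIntegral_apply (φ : C(T, ℂ)) : continuousIntegral μ φ = ∫ x, φ x ∂μ := by
  rw [continuousIntegral, ContinuousLinearMap.comp_apply]
  have h := integral_congr_ae (ContinuousMap.coeFn_toLp (p := 1) (𝕜 := ℝ) μ φ)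
  rw [← h, ← L1.integral_eq_integral]
  exact (L1.integral_eq' ℝ _).symm

lemma expSum_continuousIntegral (c : S → C(T, ℂ)) (a : S → R → C(T, ℂ)) (h : R → ℝ) :
    expSum (continuousIntegral μ) c a h =
      ∫ x, ∑ s, c s x * Complex.exp (∑ ρ, (h ρ : ℂ) * a s ρ x) ∂μ := by
  let _ : NormedAlgebra ℚ C(T, ℂ) := NormedAlgebra.restrictScalars ℚ ℝ C(T, ℂ)
  rw [expSum, continuousIntegral_apply]
  congr 1
  ext x
  have hev : ∀ φ : C(T, ℂ), (NormedSpace.exp φ) x = Complex.exp (φ x) := fun φ => by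
    have := NormedSpace.map_exp (ContinuousMap.evalAlgHom ℝ ℂ x) (continuous_eval_const x) φ
    rw [Complex.exp_eq_exp_ℂ]
    exact this
  rw [ContinuousMap.sum_apply]
  refine Finset.sum_congr rfl fun s _ => ?_
  rw [ContinuousMap.mul_apply, hev, ContinuousMap.sum_apply]
  simp

end ExponentialSum

namespace LatticePolytope

variable {n : ℕ} {P : LatticePolytope n}

lemma iterPartial_congr (l : List P.Ray) {F G : (P.Ray → ℝ) → ℂ} {h : P.Ray → ℝ}
    (hFG : F =ᶠ[𝓝 h] G) : P.iterPartial l F =ᶠ[𝓝 h] P.iterPartial l G := by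
  induction l with
  | nil => exact hFG
  | cons ρ l ih =>
    filter_upwards [eventually_eventually_nhds.2 ih] with h' hh'
    exact Filter.EventuallyEq.lineDeriv_eq hh'

lemma iterPartial_expSum {𝔸 : Type*} [NormedCommRing 𝔸] [NormedAlgebra ℝ 𝔸] [CompleteSpace 𝔸]
    {S : Type*} [Fintype S] (l : List P.Ray) (L : 𝔸 →L[ℝ] ℂ) (c : S → 𝔸) (a : S → P.Ray → 𝔸) :
    P.iterPartial l (expSum L c a) = expSum L (fun s => c s * (l.map (a s)).prod) a := by
  induction l with
  | nil => simp [iterPartial]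
  | cons ρ l ih =>
    ext h
    have h1 : P.iterPartial (ρ :: l) (expSum L c a) h =
        lineDeriv ℝ (P.iterPartial l (expSum L c a)) h (Pi.single ρ 1) := rfl
    rw [h1, ih, (hasLineDerivAt_expSum L _ a h ρ).lineDeriv]
    congr 1
    ext s
    rw [List.map_cons, List.prod_cons]
    ring

/-- The sum of the contributions of the vertices to the exponential integral over the face of `P(h)`
lying on the facets of `A`, before multiplication by the multiplicity of the normal cone. -/
noncomputable def vertexSum (P : LatticePolytope n) (A : Finset P.Ray) (h : P.Ray → ℝ)
    (z : Fin n → ℂ) : ℂ :=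
  ∑ σ : P.Cone n, P.vertexCoeff σ z * (∏ ρ ∈ A, P.weight σ ρ z) *
    Complex.exp (∑ ρ, (h ρ : ℂ) * P.weight σ ρ z)

lemma mixedSum_empty (h ε : P.Ray → ℝ) (z : Fin n → ℂ) :
    P.mixedSum ∅ h ε z = P.vertexSum ∅ h z := by
  simp [mixedSum, vertexSum, Complex.exp_sum]

lemma continuous_weight (σ : P.Cone n) (ρ : P.Ray) : Continuous (P.weight σ ρ) := by
  unfold weight cpair
  fun_prop

lemma IsSimple.continuous_vertexCoeff_comp (hP : P.IsSimple) {T : Type*} [TopologicalSpace T]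
    {ζ : T → Fin n → ℂ} (hζ : Continuous ζ) (hgen : ∀ t, P.IsGeneric (ζ t)) (σ : P.Cone n) :
    Continuous fun t => P.vertexCoeff σ (ζ t) := by
  unfold vertexCoeff
  refine Continuous.div ?_ ?_ fun t => ?_
  · exact Complex.continuous_exp.comp (continuous_cpair_uncurry.comp (continuous_const.prodMk hζ))
  · exact continuous_const.mul (continuous_finsetProd _ fun ρ _ => (continuous_weight σ ρ).comp hζ)
  · exact mul_ne_zero (by exact_mod_cast hP.mult_ne_zero (σ := σ) subset_rfl)
      (Finset.prod_ne_zero_iff.2 fun ρ hρ => hgen t σ ρ hρ)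

lemma dilate_eq_mixedRegion (h ε : P.Ray → ℝ) : P.dilate h = P.mixedRegion ∅ h ε := by
  ext m
  simp [dilate, mixedRegion, slack]

lemma isOpen_forall_abs_lt (P : LatticePolytope n) (δ : ℝ) : IsOpen {h : P.Ray → ℝ | ∀ ρ, |h ρ| < δ} := by
  simp only [Set.ofPred_forall]
  exact isOpen_iInter_of_finite fun ρ =>
    isOpen_lt (continuous_abs.comp (continuous_apply ρ)) continuous_const

section Superposition

variable {δ : ℝ} {f : MvPolynomial (Fin n) ℂ} {z : Fin n → ℂ} {r : Fin n → ℝ}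
  {w : (Fin n → ℝ) → ℂ}

/-- The function `h ↦ ∫_{P(h)} f(m) e^{⟨m, z⟩} dm` is a superposition of the sums of the
contributions of the vertices for generic parameters. -/
lemma IsSimple.expIntegral_eq (hP : P.IsSimple) (hδ : P.IsTolerance δ)
    (hgen : ∀ θ, P.IsGeneric (z + torusPoint r θ)) (hw : Continuous w)
    (hwf : ∀ m : Fin n → ℝ, MvPolynomial.eval (fun i => (m i : ℂ)) f =
      ∫ θ in phaseBox n, w θ * Complex.exp (cpair m (torusPoint r θ)))
    {h : P.Ray → ℝ} (hh : ∀ ρ, |h ρ| < δ) :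
    P.expIntegral f z h =
      ∫ θ in phaseBox n, w θ * P.vertexSum ∅ h (z + torusPoint r θ) := by
  obtain ⟨C, hC⟩ := P.exists_norm_le δ hδ.pos.le
  have hmem : ∀ m ∈ P.mixedRegion ∅ h 0, ‖m‖ ≤ C := fun m hm =>
    hC m fun ρ => neg_le_slack_of_mem hh (by simp) hm ρ
  have hfin : volume (P.mixedRegion ∅ h 0) < ⊤ :=
    (measure_mono fun m hm => by simpa using hmem m hm).trans_lt
      (measure_closedBall_lt_top (x := (0 : Fin n → ℝ)) (r := C))
  rw [expIntegral, dilate_eq_mixedRegion h 0]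
  have : IsFiniteMeasure (volume.restrict (P.mixedRegion ∅ h 0)) :=
    ⟨by rwa [Measure.restrict_apply_univ]⟩
  rw [integral_eval_mul_exp hw hwf (C := C)
    ((ae_restrict_iff' (measurableSet_mixedRegion _ _ _)).2 (Eventually.of_forall hmem))]
  refine setIntegral_congr_fun (isCompact_phaseBox n).measurableSet fun θ _ => ?_
  rw [hP.integral_mixedRegion hδ (hgen θ) ∅ hh (by simp) (by simp), mixedSum_empty]

/-- The superposition as an exponential sum over the Banach algebra of continuous functions on the
box of angles, which makes it analytic and allows differentiation under the integral sign. -/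
lemma IsSimple.exists_expSum_eq (hP : P.IsSimple)
    (hgen : ∀ θ, P.IsGeneric (z + torusPoint r θ)) (hw : Continuous w) :
    ∃ (K : Set (Fin n → ℝ)) (_ : CompactSpace K) (L : C(K, ℂ) →L[ℝ] ℂ) (c : P.Cone n → C(K, ℂ))
      (a : P.Cone n → P.Ray → C(K, ℂ)),
      ∀ (l : List P.Ray) (A : Finset P.Ray), l.Nodup → (∀ ρ, ρ ∈ l ↔ ρ ∈ A) → ∀ h,
        expSum L (fun σ => c σ * (l.map (a σ)).prod) a h =
          ∫ θ in phaseBox n, w θ * P.vertexSum A h (z + torusPoint r θ) := by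
  have hcz : Continuous fun θ => z + torusPoint r θ :=
    continuous_const.add (continuous_torusPoint r)
  have hK : CompactSpace (phaseBox n) := isCompact_iff_compactSpace.1 (isCompact_phaseBox n)
  have hfin : IsFiniteMeasure (Measure.comap ((↑) : phaseBox n → Fin n → ℝ) volume) := by
    refine ⟨?_⟩
    rw [(MeasurableEmbedding.subtype_coe (isCompact_phaseBox n).measurableSet).comap_apply]
    simpa using (isCompact_phaseBox n).measure_lt_top
  refine ⟨phaseBox n, hK, continuousIntegral (Measure.comap ((↑) : phaseBox n → Fin n → ℝ) volume),
    fun σ => ⟨fun θ => w θ * P.vertexCoeff σ (z + torusPoint r θ), ?_⟩,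
    fun σ ρ => ⟨fun θ => P.weight σ ρ (z + torusPoint r θ), ?_⟩, ?_⟩
  · exact (hw.mul (hP.continuous_vertexCoeff_comp hcz hgen σ)).comp continuous_subtype_val
  · exact ((continuous_weight σ ρ).comp hcz).comp continuous_subtype_val
  intro l A hl hlA h
  classical
  obtain rfl : A = l.toFinset := by
    ext ρ
    rw [List.mem_toFinset, hlA]
  rw [expSum_continuousIntegral, ← integral_subtype_comap (isCompact_phaseBox n).measurableSet]
  congr 1
  ext θ
  rw [vertexSum, Finset.mul_sum]
  refine Finset.sum_congr rfl fun σ _ => ?_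
  have hprod : ∀ l' : List P.Ray, (l'.map fun ρ => (⟨fun θ : phaseBox n =>
      P.weight σ ρ (z + torusPoint r θ), ((continuous_weight σ ρ).comp hcz).comp
        continuous_subtype_val⟩ : C(phaseBox n, ℂ))).prod θ =
      (l'.map fun ρ => P.weight σ ρ (z + torusPoint r θ)).prod := by
    intro l'
    induction l' with
    | nil => simp
    | cons ρ l' ih => simp [ih]
  rw [ContinuousMap.mul_apply, hprod, List.prod_toFinset _ hl]
  simp only [ContinuousMap.coe_mk]
  ring

end Superposition

/-- The integrals of a polynomial times an exponential over `P(h)` are analytic in `h`. -/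
lemma IsSimple.analyticAt_expIntegral (hP : P.IsSimple) {δ : ℝ} (hδ : P.IsTolerance δ)
    (f : MvPolynomial (Fin n) ℂ) (z : Fin n → ℂ) {h : P.Ray → ℝ} (hh : ∀ ρ, |h ρ| < δ) :
    AnalyticAt ℝ (P.expIntegral f z) h := by
  obtain ⟨r, hr, hgen⟩ := hP.exists_isGeneric_torusPoint z
  obtain ⟨w, hw, hwf⟩ := exists_eval_eq_setIntegral_exp hr f
  obtain ⟨K, _, L, c, a, hL⟩ := hP.exists_expSum_eq hgen hw
  refine (analyticAt_expSum L (fun σ => c σ * (([] : List P.Ray).map (a σ)).prod) a h).congr ?_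
  filter_upwards [(P.isOpen_forall_abs_lt δ).mem_nhds hh] with h' hh'
  rw [hL [] ∅ (by simp) (by simp), hP.expIntegral_eq hδ hgen hw hwf hh']

/-- Mixed partial derivatives multiply the contribution of each vertex by the weights. -/
lemma IsSimple.iterPartial_expIntegral (hP : P.IsSimple) {δ : ℝ} (hδ : P.IsTolerance δ)
    {f : MvPolynomial (Fin n) ℂ} {z : Fin n → ℂ} {r : Fin n → ℝ} {w : (Fin n → ℝ) → ℂ}
    (hgen : ∀ θ, P.IsGeneric (z + torusPoint r θ)) (hw : Continuous w)
    (hwf : ∀ m : Fin n → ℝ, MvPolynomial.eval (fun i => (m i : ℂ)) f =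
      ∫ θ in phaseBox n, w θ * Complex.exp (cpair m (torusPoint r θ)))
    {l : List P.Ray} {A : Finset P.Ray} (hl : l.Nodup) (hlA : ∀ ρ, ρ ∈ l ↔ ρ ∈ A)
    {h : P.Ray → ℝ} (hh : ∀ ρ, |h ρ| < δ) :
    P.iterPartial l (P.expIntegral f z) h =
      ∫ θ in phaseBox n, w θ * P.vertexSum A h (z + torusPoint r θ) := by
  obtain ⟨K, _, L, c, a, hL⟩ := hP.exists_expSum_eq hgen hw
  have h1 : P.expIntegral f z =ᶠ[𝓝 h] expSum L c a := by
    filter_upwards [(P.isOpen_forall_abs_lt δ).mem_nhds hh] with h' hh'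
    rw [hP.expIntegral_eq hδ hgen hw hwf hh', ← hL [] ∅ (by simp) (by simp)]
    simp
  rw [(iterPartial_congr l h1).eq_of_nhds, iterPartial_expSum, hL l A hl hlA]

end LatticePolytope

/-! ### Slices of polyhedral regions and coordinates adapted to a face -/

section Slices

/-- The integral over a slice of a bounded region cut out by finitely many inequalities depends
continuously on the slice, if the boundary of the slice is a null set. -/
lemma continuousAt_setIntegral_slice {I A κ : Type*} [Fintype I] [Fintype A] [Finite κ]
    {g : κ → (I → ℝ) × (A → ℝ) → ℝ} (hg : ∀ k, Continuous (g k))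
    {φ : (I → ℝ) × (A → ℝ) → ℂ} (hφ : Continuous φ) {y₀ : A → ℝ} {C : ℝ}
    (hC : ∀ᶠ y in 𝓝 y₀, ∀ t, (∀ k, 0 ≤ g k (t, y)) → ‖t‖ ≤ C)
    (hnull : ∀ k, volume {t | g k (t, y₀) = 0} = 0) :
    ContinuousAt (fun y => ∫ t in {t | ∀ k, 0 ≤ g k (t, y)}, φ (t, y)) y₀ := by
  classical
  have hmeas : ∀ y, MeasurableSet {t | ∀ k, 0 ≤ g k (t, y)} := by
    intro y
    refine IsClosed.measurableSet ?_
    rw [Set.ofPred_forall]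
    exact isClosed_iInter fun k => isClosed_le continuous_const
      ((hg k).comp (continuous_id.prodMk continuous_const))
  have heq : (fun y => ∫ t in {t | ∀ k, 0 ≤ g k (t, y)}, φ (t, y)) =
      fun y => ∫ t, {t | ∀ k, 0 ≤ g k (t, y)}.indicator (fun t => φ (t, y)) t := by
    ext y
    rw [integral_indicator (hmeas y)]
  rw [heq]
  obtain ⟨B, hB⟩ := ((isCompact_closedBall (0 : I → ℝ) C).prod
    (isCompact_closedBall y₀ 1)).exists_bound_of_continuousOn hφ.continuousOn
  refine continuousAt_of_dominated (bound := (Metric.closedBall 0 C).indicator fun _ => B) ?_ ?_ ?_ ?_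
  · refine Eventually.of_forall fun y => ?_
    exact ((hφ.comp (continuous_id.prodMk continuous_const)).measurable.indicator
      (hmeas y)).aestronglyMeasurable
  · filter_upwards [hC, Metric.closedBall_mem_nhds y₀ one_pos] with y hy hy1
    refine Eventually.of_forall fun t => ?_
    by_cases ht : t ∈ {t | ∀ k, 0 ≤ g k (t, y)}
    · have htC : t ∈ Metric.closedBall (0 : I → ℝ) C := by simpa using hy t ht
      rw [Set.indicator_of_mem ht, Set.indicator_of_mem htC]
      exact hB (t, y) ⟨htC, hy1⟩
    · rw [Set.indicator_of_notMem ht, norm_zero]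
      by_cases htC : t ∈ Metric.closedBall (0 : I → ℝ) C
      · rw [Set.indicator_of_mem htC]
        exact (norm_nonneg _).trans
          (hB (t, y₀) ⟨htC, Metric.mem_closedBall_self zero_le_one⟩)
      · rw [Set.indicator_of_notMem htC]
  · exact (integrable_indicator_iff measurableSet_closedBall).2
      (integrableOn_const (isCompact_closedBall _ _).measure_lt_top.ne)
  · have hae : ∀ᵐ t : I → ℝ, ∀ k, g k (t, y₀) ≠ 0 :=
      ae_all_iff.2 fun k => by simpa [ae_iff] using hnull k
    filter_upwards [hae] with t ht
    have hgc : ∀ k, ContinuousAt (fun y => g k (t, y)) y₀ := fun k =>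
      ((hg k).comp (continuous_const.prodMk continuous_id)).continuousAt
    by_cases hmem : ∀ k, 0 ≤ g k (t, y₀)
    · have hev : ∀ᶠ y in 𝓝 y₀, ∀ k, 0 < g k (t, y) := eventually_all.2 fun k =>
        (hgc k).eventually (lt_mem_nhds (lt_of_le_of_ne (hmem k) (ht k).symm))
      refine ContinuousAt.congr (f := fun y => φ (t, y))
        (hφ.comp (continuous_const.prodMk continuous_id)).continuousAt ?_
      filter_upwards [hev] with y hy
      exact (Set.indicator_of_mem (s := {t | ∀ k, 0 ≤ g k (t, y)})
        (fun k => (hy k).le) fun t => φ (t, y)).symm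
    · push Not at hmem
      obtain ⟨k, hk⟩ := hmem
      refine ContinuousAt.congr (f := fun _ => (0 : ℂ)) continuousAt_const ?_
      filter_upwards [(hgc k).eventually (gt_mem_nhds hk)] with y hy
      exact (Set.indicator_of_notMem (s := {t | ∀ k, 0 ≤ g k (t, y)})
        (fun h => absurd (h k) (not_le.2 hy)) fun t => φ (t, y)).symm

/-- A function whose integrals over small boxes at a point of continuity vanish is zero there. -/
lemma eq_zero_of_setIntegral_box {A : Type*} [Fintype A] {F : (A → ℝ) → ℂ} {y₀ : A → ℝ}
    (hF : ContinuousAt F y₀)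
    (hint : ∀ᶠ ε : ℝ in 𝓝[>] 0,
      IntegrableOn F (Set.univ.pi fun a => Set.Ico (y₀ a - ε) (y₀ a)) ∧
      ∫ y in Set.univ.pi fun a => Set.Ico (y₀ a - ε) (y₀ a), F y = 0) :
    F y₀ = 0 := by
  by_contra h0
  have hpos : 0 < ‖F y₀‖ / 2 := half_pos (norm_pos_iff.2 h0)
  obtain ⟨η, hη, hball⟩ := Metric.eventually_nhds_iff_ball.1
    (hF.eventually (Metric.ball_mem_nhds _ hpos))
  have hεη : ∀ᶠ ε : ℝ in 𝓝[>] 0, ε < η := nhdsWithin_le_nhds (gt_mem_nhds hη)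
  obtain ⟨ε, ⟨⟨hFi, hF0⟩, hεη⟩, hε⟩ := ((hint.and hεη).and self_mem_nhdsWithin).exists
  have hε : 0 < ε := hε
  set S := Set.univ.pi fun a => Set.Ico (y₀ a - ε) (y₀ a) with hS
  have hvol : volume.real S = ε ^ Fintype.card A := by
    rw [Measure.real, hS, volume_pi_pi]
    simp [hε.le]
  have hfin : volume S < ⊤ := by
    rw [hS, volume_pi_pi]
    exact ENNReal.prod_lt_top fun a _ => by simp
  have hbound : ∀ y ∈ S, ‖F y - F y₀‖ ≤ ‖F y₀‖ / 2 := by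
    intro y hy
    have hy' : y ∈ Metric.ball y₀ η := by
      rw [Metric.mem_ball, dist_pi_lt_iff hη]
      intro a
      have := hy a (Set.mem_univ a)
      rw [Real.dist_eq, abs_lt]
      constructor <;> linarith [this.1, this.2]
    have := hball y hy'
    rw [dist_eq_norm] at this
    exact this.le
  have h1 := norm_setIntegral_le_of_norm_le_const hfin hbound
  rw [integral_sub hFi (integrableOn_const hfin.ne), hF0, setIntegral_const, zero_sub, norm_neg,
    norm_smul, hvol, Real.norm_eq_abs, abs_of_pos (by positivity), mul_comm] at h1
  have h2 : 0 < ε ^ Fintype.card A := by positivity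
  have := le_of_mul_le_mul_right h1 h2
  linarith

/-- The zero set of an affine function that is not identically zero is a null set. -/
lemma volume_affine_eq_zero {I : Type*} [Fintype I] (ℓ : (I → ℝ) →ₗ[ℝ] ℝ) (c : ℝ) {t₁ : I → ℝ}
    (ht₁ : ℓ t₁ + c ≠ 0) : volume {t | ℓ t + c = 0} = 0 := by
  let s : AffineSubspace ℝ (I → ℝ) :=
    { carrier := {t | ℓ t + c = 0}
      smul_vsub_vadd_mem' := by
        intro a p₁ p₂ p₃ h1 h2 h3
        simp only [Set.mem_ofPred_eq, vsub_eq_sub, vadd_eq_add, map_add, map_smul, map_sub,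
          smul_eq_mul] at *
        linear_combination a * h1 - a * h2 + h3 }
  have hs : s ≠ ⊤ := by
    intro h
    have : t₁ ∈ s := h ▸ AffineSubspace.mem_top ℝ _ t₁
    exact ht₁ this
  exact Measure.addHaar_affineSubspace volume s hs

lemma setIntegral_Ico_mul_exp {a b : ℝ} (hab : a ≤ b) (w : ℂ) :
    ∫ s in Set.Ico (-b) (-a), w * Complex.exp (-(s : ℂ) * w) =
      Complex.exp ((b : ℂ) * w) - Complex.exp ((a : ℂ) * w) := by
  by_cases hw : w = 0
  · simp [hw]
  · rw [integral_const_mul, LatticePolytope.setIntegral_Ico_exp hab hw, mul_div_cancel₀ _ hw]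

/-- The range cannot be a proper subspace, which would be a null set. -/
lemma surjective_of_map_volume {n : ℕ} {I A : Type*} [Fintype I] [Fintype A]
    {Φ : ((I → ℝ) × (A → ℝ)) →ₗ[ℝ] (Fin n → ℝ)} {c : ℕ}
    (hmap : Measure.map Φ volume = (c : ENNReal) • volume) : Function.Surjective Φ := by
  rw [← LinearMap.range_eq_top]
  by_contra h
  have h1 := Measure.addHaar_submodule (volume : Measure (Fin n → ℝ)) _ h
  have hcont : Continuous Φ := LinearMap.continuous_of_finiteDimensional Φ
  have h2 := congrArg (fun μ => μ (LinearMap.range Φ : Set (Fin n → ℝ))) hmap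
  rw [Measure.smul_apply, h1, smul_zero, Measure.map_apply hcont.measurable
    (Submodule.closed_of_finiteDimensional _).measurableSet, LinearMap.coe_range,
    Set.preimage_range] at h2
  exact NeZero.ne _ h2

end Slices

namespace LatticePolytope

variable {n : ℕ} {P : LatticePolytope n}

/-- Coordinates `(t, s)` on `M_ℝ` adapted to a face: `t` are coordinates along the face with respect
to a lattice basis, and `s` the slacks of the facets containing the face. -/
lemma IsSimple.exists_face_coordinates (hP : P.IsSimple) {E : Set (Fin n → ℝ)} (hE : P.IsFace E) :
    ∃ (p : Fin n → ℝ) (Φ : ((Module.Free.ChooseBasisIndex ℤ (faceLattice E) → ℝ) ×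
        (P.rays (P.normalCone E) → ℝ)) →ₗ[ℝ] (Fin n → ℝ)),
      Function.Injective Φ ∧ Function.Surjective Φ ∧
      Measure.map Φ volume = (P.mult (P.normalCone E) : ENNReal) • volume ∧
      (∀ x a, P.slack a.1 (p + Φ x) = x.2 a) ∧
      ∀ t, Φ (t, 0) = ∑ i, t i • latticeIncl n (Module.Free.chooseBasis ℤ (faceLattice E) i) := by
  classical
  obtain ⟨σ, hσ⟩ := hE.exists_cone_rays_subset
  have hli := hP.linearIndependent_gen hσ
  have hL : ∀ m : Fin n → ℤ, m ∈ faceLattice E ↔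
      ∀ a, m ⬝ᵥ P.genFamily (P.rays (P.normalCone E)) a = 0 := by
    intro m
    have h1 : m ∈ faceLattice E ↔ latticeIncl n m ∈ vectorSpan ℝ E := Iff.rfl
    rw [h1, hE.mem_vectorSpan_iff]
    constructor
    · intro h a
      have := h a.1 a.2
      rw [latticeIncl_dotProduct] at this
      exact_mod_cast this
    · intro h ρ hρ
      rw [latticeIncl_dotProduct]
      exact_mod_cast h ⟨ρ, hρ⟩
  obtain ⟨e, Φ, he, hΦ, hinj, hmap⟩ := exists_lattice_coordinates hli hL
    (Module.Free.chooseBasis ℤ (faceLattice E))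
  refine ⟨P.rvertex σ, Φ, hinj, surjective_of_map_volume hmap, ?_, fun x a => ?_, fun t => ?_⟩
  · rw [hmap, mult_eq_index hli]
  · rw [slack_add, (P.mem_rays_cone_iff σ a.1).1 (hσ a.2), hΦ, zero_add, add_dotProduct,
      sum_dotProduct, sum_dotProduct, Finset.sum_eq_zero, zero_add, Finset.sum_eq_single a]
    · rw [smul_dotProduct, he, if_pos rfl, smul_eq_mul, mul_one]
    · intro b _ hb
      rw [smul_dotProduct, he, if_neg hb, smul_zero]
    · simp
    · intro i _
      rw [smul_dotProduct, latticeIncl_dotProduct, (hL _).1 (Subtype.property _) a]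
      simp
  · rw [hΦ]
    simp

/-- For small `h` there is a point in the relative interior of `E(h)`. -/
lemma IsSimple.exists_slack_add_pos (hP : P.IsSimple) {δ : ℝ} (hδ : P.IsTolerance δ)
    {E : Set (Fin n → ℝ)} (hE : P.IsFace E) {h : P.Ray → ℝ} (hh : ∀ ρ, |h ρ| < δ) :
    ∃ m, (∀ ρ ∈ P.rays (P.normalCone E), P.slack ρ m + h ρ = 0) ∧
      ∀ ρ ∉ P.rays (P.normalCone E), 0 < P.slack ρ m + h ρ := by
  classical
  obtain ⟨σ, hσ⟩ := hE.exists_cone_rays_subset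
  set A := P.rays (P.normalCone E)
  have hev : ∀ᶠ η : ℝ in 𝓝[>] 0, ∀ ρ, η < δ - |h ρ| := eventually_all.2 fun ρ =>
    nhdsWithin_le_nhds (gt_mem_nhds (sub_pos.2 (hh ρ)))
  obtain ⟨η, hη, hη0⟩ := (hev.and self_mem_nhdsWithin).exists
  have hη0 : 0 < η := hη0
  let v : P.Ray → ℝ := fun ρ => if ρ ∈ A then -h ρ else -h ρ + η
  have hslack : ∀ ρ ∈ P.rays σ.1,
      P.slack ρ (P.rvertex σ + ∑ ρ' ∈ P.rays σ.1, v ρ' • P.edge σ ρ') = v ρ := by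
    intro ρ hρ
    rw [slack_add, (P.mem_rays_cone_iff σ ρ).1 hρ, zero_add, sum_dotProduct,
      Finset.sum_eq_single ρ]
    · rw [smul_dotProduct, (hP.edge_spec σ).2.1 _ hρ _ hρ, if_pos rfl, smul_eq_mul, mul_one]
    · intro b hb hne
      rw [smul_dotProduct, (hP.edge_spec σ).2.1 _ hb _ hρ, if_neg hne, smul_zero]
    · exact fun h => absurd hρ h
  refine ⟨P.rvertex σ + ∑ ρ' ∈ P.rays σ.1, v ρ' • P.edge σ ρ',
    fun ρ hρ => ?_, fun ρ hρ => ?_⟩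
  · rw [hslack ρ (hσ hρ)]
    simp [v, hρ]
  · by_cases hρσ : ρ ∈ P.rays σ.1
    · rw [hslack ρ hρσ]
      simp [v, hρ, hη0]
    · have h1 := hδ.near_vertex σ _ (fun ρ' hρ' => by
        rw [hslack ρ' hρ']
        have h2 := hη ρ'
        have h3 := hh ρ'
        simp only [v]
        split_ifs
        · rw [abs_neg]; exact h3.le
        · refine (abs_add_le _ _).trans ?_
          rw [abs_neg, abs_of_pos hη0]
          linarith) ρ hρσ
      have := (abs_lt.1 (hh ρ)).1
      linarith

end LatticePolytope

/-! ### Exponential integrals over slices -/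

namespace LatticePolytope

variable {n : ℕ} {P : LatticePolytope n}

section FaceSlice

variable {I : Type*} {A : Finset P.Ray} {p : Fin n → ℝ}
  {Φ : ((I → ℝ) × (A → ℝ)) →ₗ[ℝ] (Fin n → ℝ)}

/-- In coordinates `(t, s)` in which `s` gives the slacks of the facets in `A`, the slice with given
`s` of the region cut out by the inequalities of `P(h)` for the remaining facets. -/
def faceSlice (p : Fin n → ℝ) (Φ : ((I → ℝ) × (A → ℝ)) →ₗ[ℝ] (Fin n → ℝ)) (h : P.Ray → ℝ)
    (s : A → ℝ) : Set (I → ℝ) :=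
  {t | ∀ ρ : {ρ // ρ ∉ A}, 0 ≤ P.slack ρ.1 (p + Φ (t, s)) + h ρ.1}

/-- The mixed region is swept out by the slices. -/
lemma mixedRegion_indicator (hslack : ∀ x a, P.slack a.1 (p + Φ x) = x.2 a) (h : P.Ray → ℝ) (ε : ℝ)
    (g : (Fin n → ℝ) → ℂ) (t : I → ℝ) (s : A → ℝ) :
    (P.mixedRegion A h fun _ => ε).indicator g (p + Φ (t, s)) =
      (Set.univ.pi fun a : A => Set.Ico (-h a.1 - ε) (-h a.1)).indicator
        (fun s => (faceSlice p Φ h s).indicator (fun t => g (p + Φ (t, s))) t) s := by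
  have hmem : p + Φ (t, s) ∈ (P.mixedRegion A h fun _ => ε) ↔
      s ∈ (Set.univ.pi fun a : A => Set.Ico (-h a.1 - ε) (-h a.1)) ∧ t ∈ faceSlice p Φ h s := by
    refine and_congr ⟨fun h1 a _ => ?_, fun h1 ρ hρ => ?_⟩
      ⟨fun h1 ρ => h1 ρ.1 ρ.2, fun h1 ρ hρ => h1 ⟨ρ, hρ⟩⟩
    · have h2 := h1 a.1 a.2
      rw [hslack] at h2
      exact ⟨by linarith [h2.1], by linarith [h2.2]⟩
    · have h2 := h1 ⟨ρ, hρ⟩ (Set.mem_univ _)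
      have h3 := hslack (t, s) ⟨ρ, hρ⟩
      simp only at h3
      rw [h3]
      exact ⟨by linarith [h2.1], by linarith [h2.2]⟩
  by_cases hs : s ∈ (Set.univ.pi fun a : A => Set.Ico (-h a.1 - ε) (-h a.1))
  · rw [Set.indicator_of_mem hs]
    by_cases ht : t ∈ faceSlice p Φ h s
    · rw [Set.indicator_of_mem ht, Set.indicator_of_mem (hmem.2 ⟨hs, ht⟩)]
    · rw [Set.indicator_of_notMem ht, Set.indicator_of_notMem fun h' => ht (hmem.1 h').2]
  · rw [Set.indicator_of_notMem hs, Set.indicator_of_notMem fun h' => hs (hmem.1 h').1]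

variable [Fintype I]

lemma continuous_add_linearMap (p : Fin n → ℝ) (Φ : ((I → ℝ) × (A → ℝ)) →ₗ[ℝ] (Fin n → ℝ)) :
    Continuous fun x => p + Φ x :=
  continuous_const.add (LinearMap.continuous_of_finiteDimensional Φ)

lemma isClosed_faceSlice (h : P.Ray → ℝ) (s : A → ℝ) : IsClosed (faceSlice p Φ h s) := by
  rw [faceSlice, Set.ofPred_forall]
  exact isClosed_iInter fun ρ => isClosed_le continuous_const
    (((continuous_slack ρ.1).comp ((continuous_add_linearMap p Φ).comp
      (continuous_id.prodMk continuous_const))).add continuous_const)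

lemma exists_norm_le_of_mem_faceSlice (hinj : Function.Injective Φ)
    (hslack : ∀ x a, P.slack a.1 (p + Φ x) = x.2 a) {δ : ℝ} (hδ : 0 ≤ δ) {h : P.Ray → ℝ}
    (hh : ∀ ρ, |h ρ| < δ) :
    ∃ C, ∀ s : A → ℝ, (∀ a, -δ ≤ s a) → ∀ t ∈ faceSlice p Φ h s, ‖t‖ ≤ C := by
  obtain ⟨C, hC⟩ := P.exists_norm_le δ hδ
  obtain ⟨K, -, hK⟩ := Φ.exists_antilipschitzWith (LinearMap.ker_eq_bot.2 hinj)
  refine ⟨K * (C + ‖p‖), fun s hs t ht => ?_⟩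
  have h1 : ‖p + Φ (t, s)‖ ≤ C := hC _ fun ρ => by
    by_cases hρ : ρ ∈ A
    · have := hslack (t, s) ⟨ρ, hρ⟩
      simp only at this
      rw [this]
      exact hs _
    · have h2 := ht ⟨ρ, hρ⟩
      have h3 := (abs_lt.1 (hh ρ)).2
      simp only at h2
      linarith
  have h2 : ‖Φ (t, s)‖ ≤ C + ‖p‖ := by
    have h3 := norm_sub_le (p + Φ (t, s)) p
    rw [add_sub_cancel_left] at h3
    linarith
  have h3 := hK.le_mul_dist (t, s) 0
  rw [map_zero, dist_zero_right, dist_zero_right] at h3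
  calc ‖t‖ ≤ ‖((t, s) : (I → ℝ) × (A → ℝ))‖ := norm_fst_le (t, s)
    _ ≤ _ := h3.trans (mul_le_mul_of_nonneg_left h2 K.2)

/-- The integral of an exponential over the slice of `P(h)` with given slacks. -/
noncomputable def sliceIntegral (p : Fin n → ℝ) (Φ : ((I → ℝ) × (A → ℝ)) →ₗ[ℝ] (Fin n → ℝ))
    (h : P.Ray → ℝ) (z : Fin n → ℂ) (s : A → ℝ) : ℂ :=
  ∫ t in faceSlice p Φ h s, Complex.exp (cpair (p + Φ (t, s)) z)

/-- The slice integral is continuous at the slice through a face: no remaining facet inequality is an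
equality on the whole slice, so the boundary of the slice is a null set. -/
lemma continuousAt_sliceIntegral (hinj : Function.Injective Φ) (hsurj : Function.Surjective Φ)
    (hslack : ∀ x a, P.slack a.1 (p + Φ x) = x.2 a) {δ : ℝ} (hδ : 0 ≤ δ) {h : P.Ray → ℝ}
    (hh : ∀ ρ, |h ρ| < δ) {m : Fin n → ℝ} (hm : ∀ ρ ∈ A, P.slack ρ m + h ρ = 0)
    (hm' : ∀ ρ ∉ A, 0 < P.slack ρ m + h ρ) (z : Fin n → ℂ) :
    ContinuousAt (sliceIntegral p Φ h z) (fun a : A => -h a.1) := by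
  have hcont := continuous_add_linearMap p Φ
  obtain ⟨C, hC⟩ := exists_norm_le_of_mem_faceSlice hinj hslack hδ hh
  have hev : ∀ᶠ s : A → ℝ in 𝓝 fun a => -h a.1, ∀ a, -δ < s a := eventually_all.2 fun a =>
    (continuous_apply a).continuousAt.eventually
      (lt_mem_nhds (by have := (abs_lt.1 (hh a.1)).2; linarith))
  refine continuousAt_setIntegral_slice (κ := {ρ // ρ ∉ A})
    (g := fun ρ x => P.slack ρ.1 (p + Φ x) + h ρ.1)
    (φ := fun x => Complex.exp (cpair (p + Φ x) z)) (fun ρ => ?_) ?_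
    (hev.mono fun s hs => hC s fun a => (hs a).le) fun ρ => ?_
  · exact ((continuous_slack ρ.1).comp hcont).add continuous_const
  · exact Complex.continuous_exp.comp ((continuous_cpair z).comp hcont)
  · obtain ⟨⟨t₁, s₁⟩, hx⟩ := hsurj (m - p)
    have hx' : p + Φ (t₁, s₁) = m := by rw [hx]; abel
    have hs₁ : s₁ = fun a : A => -h a.1 := by
      ext a
      have h1 := hslack (t₁, s₁) a
      rw [hx'] at h1
      have h2 := hm a.1 a.2
      simp only at h1
      linarith
    subst hs₁
    let ℓ : (I → ℝ) →ₗ[ℝ] ℝ :=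
      { toFun := fun t => Φ (t, 0) ⬝ᵥ P.rgen ρ.1
        map_add' := fun t t' => by
          rw [← add_dotProduct, ← map_add, Prod.mk_add_mk, add_zero]
        map_smul' := fun c t => by
          rw [RingHom.id_apply, ← smul_dotProduct, ← map_smul, Prod.smul_mk, smul_zero] }
    have hℓ : ∀ t, P.slack ρ.1 (p + Φ (t, fun a : A => -h a.1)) + h ρ.1 =
        ℓ t + (P.slack ρ.1 (p + Φ (0, fun a : A => -h a.1)) + h ρ.1) := by
      intro t
      have h1 : Φ (t, fun a : A => -h a.1) = Φ (0, fun a : A => -h a.1) + Φ (t, 0) := by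
        rw [← map_add, Prod.mk_add_mk, zero_add, add_zero]
      rw [h1, ← add_assoc, slack_add]
      simp only [ℓ, LinearMap.coe_mk, AddHom.coe_mk]
      ring
    have h1 := volume_affine_eq_zero ℓ _ (t₁ := t₁) (by
      rw [← hℓ, hx']
      exact (hm' ρ.1 ρ.2).ne')
    refine (congrArg volume (Set.ext fun t => ?_)).trans h1
    rw [Set.mem_ofPred_eq, Set.mem_ofPred_eq, ← hℓ]

/-- Fubini's theorem for the decomposition of a mixed region into slices. -/
lemma integral_sliceIntegral (hinj : Function.Injective Φ) {c : ℕ}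
    (hmap : Measure.map Φ volume = (c : ENNReal) • volume)
    (hslack : ∀ x a, P.slack a.1 (p + Φ x) = x.2 a) {δ ε : ℝ} (hδ : 0 ≤ δ) {h : P.Ray → ℝ}
    (hh : ∀ ρ, |h ρ| < δ) (hε : ∀ ρ ∈ A, h ρ + ε < δ) (z : Fin n → ℂ) :
    IntegrableOn (sliceIntegral p Φ h z) (Set.univ.pi fun a : A => Set.Ico (-h a.1 - ε) (-h a.1)) ∧
    ∫ s in Set.univ.pi fun a : A => Set.Ico (-h a.1 - ε) (-h a.1), sliceIntegral p Φ h z s =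
      c * ∫ m in P.mixedRegion A h fun _ => ε, Complex.exp (cpair m z) := by
  set G := (P.mixedRegion A h fun _ => ε).indicator fun m => Complex.exp (cpair m z) with hG
  have hbox : MeasurableSet (Set.univ.pi fun a : A => Set.Ico (-h a.1 - ε) (-h a.1)) :=
    MeasurableSet.univ_pi fun _ => measurableSet_Ico
  have hcontΦ : Continuous Φ := LinearMap.continuous_of_finiteDimensional Φ
  have hGi : Integrable G := (integrable_indicator_iff (measurableSet_mixedRegion _ _ _)).2
    (integrableOn_mixedRegion hδ hh hε (Complex.continuous_exp.comp (continuous_cpair z)))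
  have hi : Integrable (fun x => G (p + Φ x)) := by
    have h1 := (hcontΦ.measurableEmbedding hinj).integrable_map_iff (μ := volume)
      (g := fun m => G (p + m))
    refine h1.1 ?_
    rw [hmap]
    exact (hGi.comp_add_left p).smul_measure (ENNReal.natCast_ne_top c)
  have hslice : ∀ s, ∫ t, G (p + Φ (t, s)) =
      (Set.univ.pi fun a : A => Set.Ico (-h a.1 - ε) (-h a.1)).indicator
        (sliceIntegral p Φ h z) s := by
    intro s
    simp only [hG, mixedRegion_indicator hslack]
    by_cases hs : s ∈ (Set.univ.pi fun a : A => Set.Ico (-h a.1 - ε) (-h a.1))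
    · simp only [Set.indicator_of_mem hs]
      rw [integral_indicator (isClosed_faceSlice h s).measurableSet, sliceIntegral]
    · simp only [Set.indicator_of_notMem hs, integral_zero]
  have h1 := integral_comp_of_map_eq hinj hmap p G
  rw [Measure.volume_eq_prod] at hi h1
  constructor
  · have := hi.integral_prod_right
    simp only [hslice] at this
    exact (integrable_indicator_iff hbox).1 this
  · rw [integral_prod_symm _ hi] at h1
    simp only [hslice] at h1
    rw [integral_indicator hbox, hG, integral_indicator (measurableSet_mixedRegion _ _ _)] at h1
    exact h1

/-- The mixed difference of the sum of the contributions of the vertices as an integral of the mixed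
derivative. -/
lemma mixedSum_eq_integral (h : P.Ray → ℝ) {ε : ℝ} (hε : 0 ≤ ε) (z : Fin n → ℂ) :
    P.mixedSum A h (fun _ => ε) z =
      ∫ s in Set.univ.pi fun a : A => Set.Ico (-h a.1 - ε) (-h a.1),
        P.vertexSum A (fun ρ => if hρ : ρ ∈ A then -s ⟨ρ, hρ⟩ else h ρ) z := by
  classical
  have hterm : ∀ (σ : P.Cone n) (s : A → ℝ),
      P.vertexCoeff σ z * (∏ ρ ∈ A, P.weight σ ρ z) *
        Complex.exp (∑ ρ, ((if hρ : ρ ∈ A then -s ⟨ρ, hρ⟩ else h ρ : ℝ) : ℂ) * P.weight σ ρ z) =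
      (P.vertexCoeff σ z * ∏ ρ ∈ Finset.univ \ A, Complex.exp ((h ρ : ℂ) * P.weight σ ρ z)) *
        ∏ a : A, (P.weight σ a.1 z * Complex.exp (-(s a : ℂ) * P.weight σ a.1 z)) := by
    intro σ s
    rw [Complex.exp_sum, ← Finset.prod_sdiff (Finset.subset_univ A), Finset.prod_mul_distrib,
      Finset.prod_coe_sort A (fun ρ => P.weight σ ρ z),
      ← Finset.prod_coe_sort A (fun ρ => Complex.exp (((if hρ : ρ ∈ A then -s ⟨ρ, hρ⟩ else h ρ : ℝ) :
        ℂ) * P.weight σ ρ z))]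
    have h1 : ∏ ρ ∈ Finset.univ \ A,
        Complex.exp (((if hρ : ρ ∈ A then -s ⟨ρ, hρ⟩ else h ρ : ℝ) : ℂ) * P.weight σ ρ z) =
        ∏ ρ ∈ Finset.univ \ A, Complex.exp ((h ρ : ℂ) * P.weight σ ρ z) :=
      Finset.prod_congr rfl fun ρ hρ => by rw [dif_neg (Finset.mem_sdiff.1 hρ).2]
    have h2 : ∏ a : A,
        Complex.exp (((if hρ : a.1 ∈ A then -s ⟨a.1, hρ⟩ else h a.1 : ℝ) : ℂ) * P.weight σ a.1 z) =
        ∏ a : A, Complex.exp (-(s a : ℂ) * P.weight σ a.1 z) :=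
      Finset.prod_congr rfl fun a _ => by rw [dif_pos a.2]; push_cast; rfl
    rw [h1, h2]
    ring
  have hint : ∀ σ : P.Cone n, IntegrableOn (fun s : A → ℝ =>
      ∏ a : A, (P.weight σ a.1 z * Complex.exp (-(s a : ℂ) * P.weight σ a.1 z)))
      (Set.univ.pi fun a : A => Set.Ico (-h a.1 - ε) (-h a.1)) := by
    intro σ
    refine (Continuous.continuousOn ?_ |>.integrableOn_compact
      (isCompact_univ_pi fun a : A => isCompact_Icc (a := -h a.1 - ε) (b := -h a.1))).mono_set
      (Set.pi_mono fun a _ => Set.Ico_subset_Icc_self)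
    fun_prop
  simp only [vertexSum, hterm]
  rw [integral_finsetSum _ fun σ _ => (hint σ).const_mul _, mixedSum]
  refine Finset.sum_congr rfl fun σ _ => ?_
  have hbox : ∫ s in Set.univ.pi fun a : A => Set.Ico (-h a.1 - ε) (-h a.1),
      ∏ a : A, (P.weight σ a.1 z * Complex.exp (-(s a : ℂ) * P.weight σ a.1 z)) =
      ∏ ρ ∈ A, (Complex.exp (((h ρ + ε : ℝ) : ℂ) * P.weight σ ρ z) -
        Complex.exp ((h ρ : ℂ) * P.weight σ ρ z)) := by
    have h2 := integral_fintype_prod_eq_prod (𝕜 := ℂ)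
      (fun (a : A) (t : ℝ) => P.weight σ a.1 z * Complex.exp (-(t : ℂ) * P.weight σ a.1 z))
      (μ := fun a : A => (volume : Measure ℝ).restrict (Set.Ico (-h a.1 - ε) (-h a.1)))
    rw [volume_pi, Measure.restrict_pi_pi, h2,
      ← Finset.prod_coe_sort A (fun ρ => Complex.exp (((h ρ + ε : ℝ) : ℂ) * P.weight σ ρ z) -
        Complex.exp ((h ρ : ℂ) * P.weight σ ρ z))]
    refine Finset.prod_congr rfl fun a _ => ?_
    have h3 : -h a.1 - ε = -(h a.1 + ε) := by ring
    rw [h3, setIntegral_Ico_mul_exp (by linarith)]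
  rw [integral_const_mul, hbox, mul_assoc]
  congr 1
  rw [← Finset.prod_sdiff (Finset.subset_univ A)]
  congr 1
  · exact Finset.prod_congr rfl fun ρ hρ => by rw [if_neg (Finset.mem_sdiff.1 hρ).2]
  · exact Finset.prod_congr rfl fun ρ hρ => by rw [if_pos hρ]

/-- Continuity in the slacks `s`, which stand for the parameters `-h_ρ` with `ρ ∈ A`. -/
lemma continuous_vertexSum_slice (h : P.Ray → ℝ) (z : Fin n → ℂ) : Continuous fun s : A → ℝ =>
    P.vertexSum A (fun ρ => if hρ : ρ ∈ A then -s ⟨ρ, hρ⟩ else h ρ) z := by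
  unfold vertexSum
  refine continuous_finsetSum _ fun σ _ => continuous_const.mul (Complex.continuous_exp.comp
    (continuous_finsetSum _ fun ρ _ => Continuous.mul ?_ continuous_const))
  refine Complex.continuous_ofReal.comp ?_
  by_cases hρ : ρ ∈ A
  · simp only [dif_pos hρ]
    fun_prop
  · simp only [dif_neg hρ]
    fun_prop

/-- The integral of an exponential over the slice through the face is the sum of the contributions
of the vertices: both sides have the same integrals over small boxes of slices. -/
lemma IsSimple.sliceIntegral_eq (hP : P.IsSimple) (hinj : Function.Injective Φ)
    (hsurj : Function.Surjective Φ) {c : ℕ}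
    (hmap : Measure.map Φ volume = (c : ENNReal) • volume)
    (hslack : ∀ x a, P.slack a.1 (p + Φ x) = x.2 a) {δ : ℝ} (hδ : P.IsTolerance δ)
    {h : P.Ray → ℝ} (hh : ∀ ρ, |h ρ| < δ) {m : Fin n → ℝ} (hm : ∀ ρ ∈ A, P.slack ρ m + h ρ = 0)
    (hm' : ∀ ρ ∉ A, 0 < P.slack ρ m + h ρ) {z : Fin n → ℂ} (hz : P.IsGeneric z) :
    sliceIntegral p Φ h z (fun a : A => -h a.1) = c * P.vertexSum A h z := by
  have hJ := (continuous_vertexSum_slice (A := A) h z).const_mul (c : ℂ)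
  have hF := (continuousAt_sliceIntegral hinj hsurj hslack hδ.pos.le hh hm hm' z).sub hJ.continuousAt
  have hzero := eq_zero_of_setIntegral_box hF (by
    have hev : ∀ᶠ ε : ℝ in 𝓝[>] 0, ∀ ρ, ε < δ - h ρ := eventually_all.2 fun ρ =>
      nhdsWithin_le_nhds (gt_mem_nhds (sub_pos.2 (abs_lt.1 (hh ρ)).2))
    filter_upwards [hev, self_mem_nhdsWithin] with ε hε hε0
    have hε0 : 0 < ε := hε0
    have hε' : ∀ ρ ∈ A, h ρ + ε < δ := fun ρ _ => by linarith [hε ρ]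
    obtain ⟨h1, h2⟩ := integral_sliceIntegral hinj hmap hslack hδ.pos.le hh hε' z
    have h3 : IntegrableOn (fun s : A → ℝ => (c : ℂ) *
        P.vertexSum A (fun ρ => if hρ : ρ ∈ A then -s ⟨ρ, hρ⟩ else h ρ) z)
        (Set.univ.pi fun a : A => Set.Ico (-h a.1 - ε) (-h a.1)) :=
      (hJ.continuousOn.integrableOn_compact (isCompact_univ_pi fun a : A =>
        isCompact_Icc (a := -h a.1 - ε) (b := -h a.1))).mono_set
        (Set.pi_mono fun a _ => Set.Ico_subset_Icc_self)
    refine ⟨h1.sub h3, ?_⟩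
    have h4 := integral_sub h1 h3
    rw [h2, hP.integral_mixedRegion hδ hz A hh (fun _ _ => hε0.le) hε',
      mixedSum_eq_integral h hε0.le z, integral_const_mul, sub_self] at h4
    exact h4)
  have h1 : (fun ρ => if _ : ρ ∈ A then - -h ρ else h ρ) = h := by
    ext ρ
    simp
  simp only [Pi.sub_apply] at hzero
  rw [h1] at hzero
  exact sub_eq_zero.1 hzero

end FaceSlice

end LatticePolytope

/-! ### Integrals over the faces -/

namespace LatticePolytope

variable {n : ℕ} {P : LatticePolytope n}

lemma mem_dilateFace_iff {E : Set (Fin n → ℝ)} {h : P.Ray → ℝ} {m : Fin n → ℝ} :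
    m ∈ P.dilateFace E h ↔ (∀ ρ ∈ P.rays (P.normalCone E), P.slack ρ m + h ρ = 0) ∧
      ∀ ρ ∉ P.rays (P.normalCone E), 0 ≤ P.slack ρ m + h ρ := by
  constructor
  · rintro ⟨h1, h2⟩
    exact ⟨h2, fun ρ _ => h1 ρ⟩
  · rintro ⟨h1, h2⟩
    refine ⟨fun ρ => ?_, h1⟩
    by_cases hρ : ρ ∈ P.rays (P.normalCone E)
    · exact (h1 ρ hρ).ge
    · exact h2 ρ hρ

section FaceMeasure

variable {E : Set (Fin n → ℝ)} {h : P.Ray → ℝ} {p : Fin n → ℝ}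
  {Φ : ((Module.Free.ChooseBasisIndex ℤ (faceLattice E) → ℝ) ×
    (P.rays (P.normalCone E) → ℝ)) →ₗ[ℝ] (Fin n → ℝ)}

lemma add_mem_dilateFace_iff (hslack : ∀ x a, P.slack a.1 (p + Φ x) = x.2 a)
    (x : (Module.Free.ChooseBasisIndex ℤ (faceLattice E) → ℝ) ×
      (P.rays (P.normalCone E) → ℝ)) :
    p + Φ x ∈ P.dilateFace E h ↔ x.2 = (fun a => -h a.1) ∧ x.1 ∈ faceSlice p Φ h x.2 := by
  rw [mem_dilateFace_iff]
  refine and_congr ⟨fun h1 => ?_, fun h1 ρ hρ => ?_⟩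
    ⟨fun h1 ρ => h1 ρ.1 ρ.2, fun h1 ρ hρ => h1 ⟨ρ, hρ⟩⟩
  · ext a
    have := h1 a.1 a.2
    rw [hslack] at this
    linarith
  · rw [hslack x ⟨ρ, hρ⟩, h1]
    simp

/-- In coordinates adapted to the face, the measure on `E(h)` is Lebesgue measure on the slice
through `E(h)`. -/
lemma faceMeasure_eq_map (hsurj : Function.Surjective Φ)
    (hslack : ∀ x a, P.slack a.1 (p + Φ x) = x.2 a)
    (hΦ : ∀ t, Φ (t, 0) = ∑ i, t i • latticeIncl n (Module.Free.chooseBasis ℤ (faceLattice E) i))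
    (hne : (P.dilateFace E h).Nonempty) :
    P.faceMeasure E h = Measure.map (fun t => p + Φ (t, fun a => -h a.1)) volume := by
  have hmeas : Measurable fun t => p + Φ (t, fun a => -h a.1) :=
    ((continuous_add_linearMap p Φ).comp (by fun_prop)).measurable
  obtain ⟨⟨t₀, s₀⟩, hx⟩ := hsurj (hne.some - p)
  have hx' : p + Φ (t₀, s₀) = hne.some := by rw [hx]; abel
  have hs₀ : s₀ = fun a => -h a.1 :=
    ((add_mem_dilateFace_iff (h := h) hslack (t₀, s₀)).1 (hx' ▸ hne.some_mem)).1
  subst hs₀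
  rw [faceMeasure, dif_pos hne, latticeMeasure, Measure.map_map (by fun_prop) (by fun_prop)]
  have h1 : ((fun w => hne.some + w) ∘
      fun t : Module.Free.ChooseBasisIndex ℤ (faceLattice E) → ℝ =>
        ∑ i, t i • latticeIncl n (Module.Free.chooseBasis ℤ (faceLattice E) i : Fin n → ℤ)) =
      (fun t => p + Φ (t, fun a => -h a.1)) ∘ fun t => t₀ + t := by
    ext1 t
    simp only [Function.comp]
    rw [← hΦ, ← hx', add_assoc, ← map_add, Prod.mk_add_mk, add_zero]
  rw [h1, ← Measure.map_map hmeas (by fun_prop), map_add_left_eq_self]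

/-- Integration over `E(h)` in coordinates adapted to the face. -/
lemma integral_dilateFace (hinj : Function.Injective Φ) (hsurj : Function.Surjective Φ)
    (hslack : ∀ x a, P.slack a.1 (p + Φ x) = x.2 a)
    (hΦ : ∀ t, Φ (t, 0) = ∑ i, t i • latticeIncl n (Module.Free.chooseBasis ℤ (faceLattice E) i))
    (hne : (P.dilateFace E h).Nonempty) :
    P.faceMeasure E h (P.dilateFace E h) = volume (faceSlice p Φ h fun a => -h a.1) ∧
    ∀ g : (Fin n → ℝ) → ℂ, ∫ m in P.dilateFace E h, g m ∂(P.faceMeasure E h) =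
      ∫ t in faceSlice p Φ h fun a => -h a.1, g (p + Φ (t, fun a => -h a.1)) := by
  have hcont : Continuous fun t => p + Φ (t, fun a => -h a.1) :=
    (continuous_add_linearMap p Φ).comp (by fun_prop)
  have hemb : MeasurableEmbedding fun t => p + Φ (t, fun a => -h a.1) :=
    hcont.measurableEmbedding fun t t' htt' => (Prod.ext_iff.1 (hinj (add_left_cancel htt'))).1
  have hpre : (fun t => p + Φ (t, fun a => -h a.1)) ⁻¹' P.dilateFace E h =
      faceSlice p Φ h fun a => -h a.1 := by
    ext t
    rw [Set.mem_preimage, add_mem_dilateFace_iff hslack]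
    exact and_iff_right rfl
  rw [faceMeasure_eq_map hsurj hslack hΦ hne]
  refine ⟨?_, fun g => ?_⟩
  · rw [hemb.map_apply, hpre]
  · rw [hemb.setIntegral_map, hpre]

end FaceMeasure

lemma isClosed_dilateFace (E : Set (Fin n → ℝ)) (h : P.Ray → ℝ) :
    IsClosed (P.dilateFace E h) := by
  have h1 : ∀ ρ, Continuous fun m => P.slack ρ m + h ρ := fun ρ =>
    (continuous_slack ρ).add continuous_const
  have h2 : P.dilateFace E h = (⋂ ρ, {m | 0 ≤ P.slack ρ m + h ρ}) ∩
      ⋂ ρ ∈ P.rays (P.normalCone E), {m | P.slack ρ m + h ρ = 0} := by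
    ext m
    simp [dilateFace, dilate, slack]
  rw [h2]
  exact (isClosed_iInter fun ρ => isClosed_le continuous_const (h1 ρ)).inter
    (isClosed_biInter fun ρ _ => isClosed_eq (h1 ρ) continuous_const)

section Integrals

variable {δ : ℝ} {E : Set (Fin n → ℝ)} {h : P.Ray → ℝ}

lemma IsTolerance.exists_norm_le_of_mem_dilateFace (hδ : P.IsTolerance δ) (hh : ∀ ρ, |h ρ| < δ) :
    ∃ C, ∀ m ∈ P.dilateFace E h, ‖m‖ ≤ C := by
  obtain ⟨C, hC⟩ := P.exists_norm_le δ hδ.pos.le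
  refine ⟨C, fun m hm => hC m fun ρ => ?_⟩
  have h1 : 0 ≤ P.slack ρ m + h ρ := hm.1 ρ
  have h2 := (abs_lt.1 (hh ρ)).2
  linarith

/-- The integral of an exponential over `E(h)` for a generic parameter, together with the finiteness
of the volume of `E(h)`. -/
lemma IsSimple.faceMeasure_lt_top_and_integral_eq (hP : P.IsSimple) (hδ : P.IsTolerance δ)
    (hE : P.IsFace E) (hh : ∀ ρ, |h ρ| < δ) :
    P.faceMeasure E h (P.dilateFace E h) < ⊤ ∧
    ∀ z : Fin n → ℂ, P.IsGeneric z →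
      ∫ m in P.dilateFace E h, Complex.exp (cpair m z) ∂(P.faceMeasure E h) =
        P.mult (P.normalCone E) * P.vertexSum (P.rays (P.normalCone E)) h z := by
  obtain ⟨p, Φ, hinj, hsurj, hmap, hslack, hΦ⟩ := hP.exists_face_coordinates hE
  obtain ⟨m, hm, hm'⟩ := hP.exists_slack_add_pos hδ hE hh
  have hne : (P.dilateFace E h).Nonempty :=
    ⟨m, mem_dilateFace_iff.2 ⟨hm, fun ρ hρ => (hm' ρ hρ).le⟩⟩
  obtain ⟨h1, h2⟩ := integral_dilateFace hinj hsurj hslack hΦ hne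
  constructor
  · rw [h1]
    obtain ⟨C, hC⟩ := exists_norm_le_of_mem_faceSlice hinj hslack hδ.pos.le hh
    refine (measure_mono fun t ht => ?_).trans_lt
      (measure_closedBall_lt_top (μ := volume) (x := 0) (r := C))
    rw [mem_closedBall_zero_iff]
    refine hC _ (fun a => ?_) t ht
    have := (abs_lt.1 (hh a.1)).2
    linarith
  · intro z hz
    rw [h2]
    exact hP.sliceIntegral_eq hinj hsurj hmap hslack hδ hh hm hm' hz

lemma IsSimple.integrableOn_dilateFace (hP : P.IsSimple) (hδ : P.IsTolerance δ)
    (hE : P.IsFace E) (hh : ∀ ρ, |h ρ| < δ) {g : (Fin n → ℝ) → ℂ} (hg : Continuous g) :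
    IntegrableOn g (P.dilateFace E h) (P.faceMeasure E h) := by
  have hcl := isClosed_dilateFace (P := P) E h
  obtain ⟨C, hC⟩ := hδ.exists_norm_le_of_mem_dilateFace (E := E) hh
  have hK : IsCompact (P.dilateFace E h) := Metric.isCompact_of_isClosed_isBounded hcl
    (isBounded_iff_forall_norm_le.2 ⟨C, hC⟩)
  obtain ⟨B, hB⟩ := hK.exists_bound_of_continuousOn hg.continuousOn
  exact IntegrableOn.of_bound (hP.faceMeasure_lt_top_and_integral_eq hδ hE hh).1
    hg.aestronglyMeasurable B ((ae_restrict_iff' hcl.measurableSet).2 (Eventually.of_forall hB))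

/-- The integral of a polynomial times an exponential over `E(h)` is an iterated derivative of the
integral over `P(h)`. -/
lemma IsSimple.integral_dilateFace_eq_iterPartial (hP : P.IsSimple) (hδ : P.IsTolerance δ)
    (hE : P.IsFace E) (hh : ∀ ρ, |h ρ| < δ) (f : MvPolynomial (Fin n) ℂ) (z : Fin n → ℂ)
    {l : List P.Ray} (hl : l.Nodup) (hlE : ∀ ρ, ρ ∈ l ↔ ρ ∈ P.rays (P.normalCone E)) :
    ∫ m in P.dilateFace E h, MvPolynomial.eval (fun i => (m i : ℂ)) f * Complex.exp (cpair m z)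
        ∂(P.faceMeasure E h) =
      P.mult (P.normalCone E) * P.iterPartial l (P.expIntegral f z) h := by
  obtain ⟨r, hr, hgen⟩ := hP.exists_isGeneric_torusPoint z
  obtain ⟨w, hw, hwf⟩ := exists_eval_eq_setIntegral_exp hr f
  obtain ⟨hfin, hint⟩ := hP.faceMeasure_lt_top_and_integral_eq hδ hE hh
  obtain ⟨C, hC⟩ := hδ.exists_norm_le_of_mem_dilateFace (E := E) hh
  have : IsFiniteMeasure ((P.faceMeasure E h).restrict (P.dilateFace E h)) :=
    ⟨by rwa [Measure.restrict_apply_univ]⟩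
  rw [integral_eval_mul_exp hw hwf (C := C)
    ((ae_restrict_iff' (isClosed_dilateFace E h).measurableSet).2 (Eventually.of_forall hC)),
    hP.iterPartial_expIntegral hδ hgen hw hwf hl hlE hh, ← integral_const_mul]
  refine setIntegral_congr_fun (isCompact_phaseBox n).measurableSet fun θ _ => ?_
  rw [hint _ (hgen θ), mul_left_comm]

end Integrals

end LatticePolytope

theorem theorem5p2 {n : ℕ} (P : LatticePolytope n) (hP : P.IsSimple) :
    ∀ᶠ h : P.Ray → ℝ in 𝓝 0,
      (∀ (f : MvPolynomial (Fin n) ℂ) (z : Fin n → ℂ), AnalyticAt ℝ (P.expIntegral f z) h) ∧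
      ∀ E : Set (Fin n → ℝ), P.IsFace E →
        (∀ (f : MvPolynomial (Fin n) ℂ) (z : Fin n → ℂ),
          IntegrableOn (fun m => MvPolynomial.eval (fun i => (m i : ℂ)) f * Complex.exp (cpair m z))
            (P.dilateFace E h) (P.faceMeasure E h)) ∧
        (∀ z : Fin n → ℂ,
          (∀ σ : P.Cone n, ∀ ρ ∈ P.rays σ.1, ptEval z (P.restrictF σ.1 ρ) ≠ 0) →
          ∫ m in P.dilateFace E h, Complex.exp (cpair m z) ∂(P.faceMeasure E h) =
            (P.mult (P.normalCone E) : ℂ) *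
              ∑ σ : P.Cone n,
                Complex.exp (ptEval z (P.restrictClass σ.1 P.const)) /
                    ptEval z (P.eulerClass σ.1) *
                  Complex.exp (∑ ρ, (h ρ : ℂ) * ptEval z (P.restrictF σ.1 ρ)) *
                  ∏ ρ ∈ P.rays (P.normalCone E), ptEval z (P.restrictF σ.1 ρ)) ∧
        (∀ (f : MvPolynomial (Fin n) ℂ) (z : Fin n → ℂ) (l : List P.Ray), l.Nodup →
          (∀ ρ, ρ ∈ l ↔ ρ ∈ P.rays (P.normalCone E)) →
          ∫ m in P.dilateFace E h,
              MvPolynomial.eval (fun i => (m i : ℂ)) f * Complex.exp (cpair m z)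
                ∂(P.faceMeasure E h) =
            (P.mult (P.normalCone E) : ℂ) * P.iterPartial l (P.expIntegral f z) h) := by
  obtain ⟨δ, hδ⟩ := hP.exists_isTolerance
  have h0 : (0 : P.Ray → ℝ) ∈ {h : P.Ray → ℝ | ∀ ρ, |h ρ| < δ} := fun ρ => by
    simpa using hδ.pos
  filter_upwards [(P.isOpen_forall_abs_lt δ).mem_nhds h0] with h hh
  refine ⟨fun f z => hP.analyticAt_expIntegral hδ f z hh, fun E hE => ⟨fun f z => ?_, fun z hz => ?_,
    fun f z l hl hlE => hP.integral_dilateFace_eq_iterPartial hδ hE hh f z hl hlE⟩⟩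
  · refine hP.integrableOn_dilateFace hδ hE hh (Continuous.mul ?_
      (Complex.continuous_exp.comp (continuous_cpair z)))
    exact (MvPolynomial.continuous_eval f).comp (by fun_prop)
  · simp only [hP.ptEval_restrictF, hP.ptEval_restrictClass_const, hP.ptEval_eulerClass] at hz ⊢
    rw [(hP.faceMeasure_lt_top_and_integral_eq hδ hE hh).2 z hz, LatticePolytope.vertexSum]
    congr 1
    refine Finset.sum_congr rfl fun σ _ => ?_
    rw [LatticePolytope.vertexCoeff]
    ring
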